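/- Conventions. For $n\ge 0$, $\Sigma_1(\mathbf R^n)$ is the Gelfand–Shilov space of all $f\in C^\infty(\mathbf R^n)$ such that $\|f\|_h=\sup_{\alpha,\beta,x}\frac{|x^\beta\partial^\alpha f(x)|}{h^{|\alpha+\beta|}\alpha!\,\beta!}<\infty$ for every $h>0$, with the topology defined by the norms $\|\cdot\|_h$, $h>0$; $\Sigma_1'(\mathbf R^n)$ is its dual, and $\Sigma_1\subseteq\Sigma_1'$ through $\langle f,\varphi\rangle=\int f\varphi\,dx$. For a linear bijection $T$ of $\mathbf R^n$ and $u\in\Sigma_1'(\mathbf R^n)$, the pullback is given by $\langle T^*u,\varphi\rangle=|\det T|^{-1}\langle u,\varphi\circ T^{-1}\rangle$, so that $T^*f=f\circ T$ for $f\in\Sigma_1$. A weight is a positive function $\omega$ with $\omega,1/\omega\in L^\infty_{loc}$; $\mathscr P_E(\mathbf R^n)$ is the set of moderate weights, i.e. the weights $\omega$ such that, for some weight $v$ and some constant $C$, $\omega(x+y)\le C\omega(x)v(y)$ for all $x,y$. A Young function is a convex $\Phi:[0,\infty]\to[0,\infty]$ with $\Phi(0)=0$ and $\lim_{t\to\infty}\Phi(t)=\Phi(\infty)=\infty$.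 For $\omega\in\mathscr P_E(\mathbf R^{2n})$, the Orlicz modulation space $M^\Phi_{(\omega)}(\mathbf R^n)$ is the set of all $u\in\Sigma_1'(\mathbf R^n)$ such that $$\|u\|_{M^\Phi_{(\omega)}}=\inf\Big\{\lambda>0:\iint_{\mathbf R^{2n}}\Phi\big(|V_\phi u(x,\xi)|\,\omega(x,\xi)/\lambda\big)\,dx\,d\xi\le 1\Big\}<\infty ,$$ with the topology given by this norm, where $V_\phi u(x,\xi)=(2\pi)^{-n/2}\langle u,\overline{\phi(\cdot-x)}e^{-i\langle\cdot,\xi\rangle}\rangle$ and $\phi(x)=\pi^{-n/4}e^{-|x|^2/2}$. Proposition. Let $A$ be a real $d\times d$ matrix with transpose $A^*$, let $T_A:\mathbf R^{2d}\to\mathbf R^{2d}$ be the linear bijection $T_A(x,y)=(x-A(x-y),\,y-A(x-y))$, let $\Phi$ be a Young function with $\Phi(t)<\infty$ for some $t>0$, and let $\omega_0,\omega_A\in\mathscr P_E(\mathbf R^{4d})$ satisfy $$\omega_A(x,y,\xi,\eta)=\omega_0\big(x-A(x-y),\,y-A(x-y),\,\xi+A^*(\xi+\eta),\,\eta-A^*(\xi+\eta)\big),\qquad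 x,y,\xi,\eta\in\mathbf R^d .$$ Then $\Sigma_1(\mathbf R^{2d})$ is contained in $M^\Phi_{(\omega_0)}(\mathbf R^{2d})$ and in $M^\Phi_{(\omega_A)}(\mathbf R^{2d})$, and $T_A^*$ on $\Sigma_1(\mathbf R^{2d})$ extends to a linear homeomorphism from $M^\Phi_{(\omega_0)}(\mathbf R^{2d})$ onto $M^\Phi_{(\omega_A)}(\mathbf R^{2d})$, namely the restriction of the distributional pullback $T_A^*$. This extension is continuous with respect to the weak-$*$ topologies inherited from $\Sigma_1'(\mathbf R^{2d})$, and it is the only map from $M^\Phi_{(\omega_0)}(\mathbf R^{2d})$ to $M^\Phi_{(\omega_A)}(\mathbf R^{2d})$ with this continuity that extends $T_A^*$ on $\Sigma_1(\mathbf R^{2d})$. If moreover $\Phi(t)>0$ for every $t>0$ and there are $r>0$ and $C>0$ with $\Phi(2t)\le C\Phi(t)$ for $0\le t\le r$, then it is also the only norm-continuous map that extends $T_A^*$ on $\Sigma_1(\mathbf R^{2d})$. -/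

import Mathlib

noncomputable section

namespace OrliczModulation

open MeasureTheory Set Filter Topology
open scoped ENNReal NNReal

/-! ### The Gelfand–Shilov space `Σ₁` (Beurling type) and its dual -/

section GelfandShilov

open scoped ContDiff

variable {ι : Type*} [Fintype ι]

/-- `f` is smooth and, for every `h > 0`, the quantities `|x|^k |D^m f(x)| / (h^(k+m) k! m!)` are
bounded uniformly in `k`, `m`, `x`. Since `h > 0` is arbitrary, using the norms of `x` and of the
`m`-th Fréchet derivative is the same as using all monomials `x^β`, all partial derivatives `∂^α`
and the factorials `α! β!` : the two differ by factors `c^(k+m)`. -/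
def IsGelfandShilov (f : EuclideanSpace ℝ ι → ℂ) : Prop :=
  ContDiff ℝ ∞ f ∧ ∀ h : ℝ, 0 < h → ∃ C : ℝ, ∀ (k m : ℕ) (x : EuclideanSpace ℝ ι),
    ‖x‖ ^ k * ‖iteratedFDeriv ℝ m f x‖ / (h ^ (k + m) * (k.factorial * m.factorial)) ≤ C

variable (ι) in
/-- The functions in `Σ₁(ℝ^ι)`, as a linear space. -/
def gelfandShilovSubmodule : Submodule ℂ (EuclideanSpace ℝ ι → ℂ) where
  carrier := {f | IsGelfandShilov f}
  zero_mem' := by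
    refine ⟨contDiff_const, fun h _ => ⟨0, fun k m x => ?_⟩⟩
    have : (0 : EuclideanSpace ℝ ι → ℂ) = fun _ => 0 := rfl
    simp [this]
  add_mem' := by
    rintro f g ⟨hf, hf'⟩ ⟨hg, hg'⟩
    refine ⟨hf.add hg, fun h hh => ?_⟩
    obtain ⟨C, hC⟩ := hf' h hh
    obtain ⟨D, hD⟩ := hg' h hh
    refine ⟨C + D, fun k m x => ?_⟩
    refine le_trans ?_ (add_le_add (hC k m x) (hD k m x))
    rw [← add_div, ← mul_add, iteratedFDeriv_add_apply
      (hf.of_le (mod_cast le_top)).contDiffAt (hg.of_le (mod_cast le_top)).contDiffAt]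
    gcongr
    exact norm_add_le _ _
  smul_mem' := by
    rintro c f ⟨hf, hf'⟩
    refine ⟨hf.const_smul c, fun h hh => ?_⟩
    obtain ⟨C, hC⟩ := hf' h hh
    refine ⟨‖c‖ * C, fun k m x => ?_⟩
    refine le_trans (le_of_eq ?_) (mul_le_mul_of_nonneg_left (hC k m x) (norm_nonneg c))
    rw [iteratedFDeriv_const_smul_apply (hf.of_le (mod_cast le_top)).contDiffAt, norm_smul]
    ring

variable (ι) in
/-- The Gelfand–Shilov space `Σ₁(ℝ^ι)`. -/
def GelfandShilov : Type _ := gelfandShilovSubmodule ι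

namespace GelfandShilov

instance : AddCommGroup (GelfandShilov ι) := inferInstanceAs (AddCommGroup (gelfandShilovSubmodule ι))

instance : Module ℂ (GelfandShilov ι) := inferInstanceAs (Module ℂ (gelfandShilovSubmodule ι))

instance : CoeFun (GelfandShilov ι) fun _ => EuclideanSpace ℝ ι → ℂ := ⟨fun f => f.1⟩

theorem contDiff (f : GelfandShilov ι) : ContDiff ℝ ∞ f := f.2.1

theorem contDiffAt (f : GelfandShilov ι) (m : ℕ) (x : EuclideanSpace ℝ ι) :
    ContDiffAt ℝ m f x := (f.contDiff.of_le (mod_cast le_top)).contDiffAt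

/-- The norm `sup |x|^k |D^m f(x)| / (h^(k+m) k! m!)`. -/
def gsNorm (h : ℝ) (f : GelfandShilov ι) : ℝ :=
  ⨆ p : ℕ × ℕ × EuclideanSpace ℝ ι,
    ‖p.2.2‖ ^ p.1 * ‖iteratedFDeriv ℝ p.2.1 f p.2.2‖ / (h ^ (p.1 + p.2.1) * (p.1.factorial * p.2.1.factorial))

theorem le_gsNorm {h : ℝ} (hh : 0 < h) (f : GelfandShilov ι) (k m : ℕ)
    (x : EuclideanSpace ℝ ι) :
    ‖x‖ ^ k * ‖iteratedFDeriv ℝ m f x‖ / (h ^ (k + m) * (k.factorial * m.factorial)) ≤ gsNorm h f := by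
  obtain ⟨C, hC⟩ := f.2.2 h hh
  exact le_ciSup (f := fun p : ℕ × ℕ × EuclideanSpace ℝ ι =>
    ‖p.2.2‖ ^ p.1 * ‖iteratedFDeriv ℝ p.2.1 f p.2.2‖ / (h ^ (p.1 + p.2.1) * (p.1.factorial * p.2.1.factorial)))
    ⟨C, by rintro _ ⟨p, rfl⟩; exact hC _ _ _⟩ (k, m, x)

theorem gsNorm_le {h C : ℝ} (f : GelfandShilov ι)
    (hC : ∀ (k m : ℕ) (x : EuclideanSpace ℝ ι),
      ‖x‖ ^ k * ‖iteratedFDeriv ℝ m f x‖ / (h ^ (k + m) * (k.factorial * m.factorial)) ≤ C) :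
    gsNorm h f ≤ C :=
  ciSup_le fun p => hC p.1 p.2.1 p.2.2

theorem coe_add (f g : GelfandShilov ι) : ((f + g : GelfandShilov ι).1) = f.1 + g.1 := rfl

theorem coe_smul (c : ℂ) (f : GelfandShilov ι) : ((c • f : GelfandShilov ι).1) = c • f.1 := rfl

/-- The norms `gsNorm h`, `h > 0`, as a family of seminorms. -/
def gsSeminorm (h : {h : ℝ // 0 < h}) : Seminorm ℂ (GelfandShilov ι) :=
  Seminorm.ofSMulLE (gsNorm h.1)
    (by
      refine le_antisymm (gsNorm_le _ fun k m x => le_of_eq ?_)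
        (le_trans (by have := h.2; positivity) (le_gsNorm h.2 0 0 0 0))
      have : ((0 : GelfandShilov ι).1) = fun _ => 0 := rfl
      simp [this])
    (fun f g => gsNorm_le _ fun k m x => by
      refine le_trans ?_ (add_le_add (le_gsNorm h.2 f k m x) (le_gsNorm h.2 g k m x))
      have := h.2
      rw [← add_div, ← mul_add, coe_add,
        iteratedFDeriv_add_apply (f.contDiffAt m x) (g.contDiffAt m x)]
      gcongr
      exact norm_add_le _ _)
    (fun c f => gsNorm_le _ fun k m x => by
      refine le_trans (le_of_eq ?_)
        (mul_le_mul_of_nonneg_left (le_gsNorm h.2 f k m x) (norm_nonneg c))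
      rw [coe_smul, iteratedFDeriv_const_smul_apply (f.contDiffAt m x), norm_smul]
      ring)

theorem gsSeminorm_apply (h : {h : ℝ // 0 < h}) (f : GelfandShilov ι) :
    gsSeminorm h f = gsNorm h.1 f := rfl

variable (ι) in
/-- The family of seminorms that defines the topology of `Σ₁(ℝ^ι)`. -/
def gsFamily : SeminormFamily ℂ (GelfandShilov ι) {h : ℝ // 0 < h} := gsSeminorm

/-- The projective limit topology with respect to `h > 0`. -/
instance : TopologicalSpace (GelfandShilov ι) := (gsFamily ι).moduleFilterBasis.topology'

theorem withSeminorms : WithSeminorms (gsFamily ι) := ⟨rfl⟩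

instance : IsTopologicalAddGroup (GelfandShilov ι) := withSeminorms.topologicalAddGroup

instance : ContinuousSMul ℂ (GelfandShilov ι) := withSeminorms.continuousSMul

theorem norm_le_gsNorm_one (f : GelfandShilov ι) (x : EuclideanSpace ℝ ι) :
    ‖f x‖ ≤ gsNorm 1 f := by
  simpa using le_gsNorm one_pos f 0 0 x

theorem integrable (f : GelfandShilov ι) : Integrable (f : EuclideanSpace ℝ ι → ℂ) := by
  let g : SchwartzMap (EuclideanSpace ℝ ι) ℂ :=
    { toFun := f
      smooth' := f.contDiff
      decay' := fun k m => ⟨gsNorm 1 f * (k.factorial * m.factorial), fun x => by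
        have := le_gsNorm one_pos f k m x
        rwa [one_pow, one_mul, div_le_iff₀ (by positivity)] at this⟩ }
  exact g.integrable

theorem exists_gsNorm_comp_le (L : EuclideanSpace ℝ ι ≃L[ℝ] EuclideanSpace ℝ ι) (h : ℝ)
    (hh : 0 < h) : ∃ h' : ℝ, 0 < h' ∧ ∀ (f : GelfandShilov ι) (k m : ℕ)
      (x : EuclideanSpace ℝ ι), ‖x‖ ^ k * ‖iteratedFDeriv ℝ m (fun y => f (L y)) x‖ /
        (h ^ (k + m) * (k.factorial * m.factorial)) ≤ gsNorm h' f := by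
  set c : ℝ := ‖(L : EuclideanSpace ℝ ι →L[ℝ] EuclideanSpace ℝ ι)‖ +
    ‖(L.symm : EuclideanSpace ℝ ι →L[ℝ] EuclideanSpace ℝ ι)‖ + 1 with hc
  have hc0 : 0 < c := by positivity
  refine ⟨h / c, by positivity, fun f k m x => ?_⟩
  refine le_trans ?_ (le_gsNorm (h := h / c) (by positivity) f k m (L x))
  have h1 : ‖x‖ ≤ c * ‖L x‖ := by
    have := (L.symm : EuclideanSpace ℝ ι →L[ℝ] EuclideanSpace ℝ ι).le_opNorm (L x)
    simp only [ContinuousLinearEquiv.coe_coe, ContinuousLinearEquiv.symm_apply_apply] at this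
    refine this.trans ?_
    gcongr
    rw [hc]; linarith [norm_nonneg (L : EuclideanSpace ℝ ι →L[ℝ] EuclideanSpace ℝ ι)]
  have h2 : ‖iteratedFDeriv ℝ m (fun y => f (L y)) x‖ ≤
      c ^ m * ‖iteratedFDeriv ℝ m f (L x)‖ := by
    have := ContinuousLinearMap.iteratedFDeriv_comp_right
      (L : EuclideanSpace ℝ ι →L[ℝ] EuclideanSpace ℝ ι)
      (f.contDiff.of_le (mod_cast le_top) : ContDiff ℝ m f) x (le_refl (m : WithTop ℕ∞))
    have e : (fun y => f (L y)) =
      f ∘ (L : EuclideanSpace ℝ ι →L[ℝ] EuclideanSpace ℝ ι) := rfl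
    rw [e, this]
    refine (ContinuousMultilinearMap.norm_compContinuousLinearMap_le _ _).trans ?_
    rw [mul_comm]
    simp only [Finset.prod_const, Finset.card_univ, Fintype.card_fin]
    gcongr
    · rw [hc]; linarith [norm_nonneg (L.symm : EuclideanSpace ℝ ι →L[ℝ] EuclideanSpace ℝ ι)]
    · exact le_rfl
  calc _ ≤ (c * ‖L x‖) ^ k * (c ^ m * ‖iteratedFDeriv ℝ m f (L x)‖) /
        (h ^ (k + m) * (k.factorial * m.factorial)) := by gcongr
    _ = _ := by
      rw [div_pow, mul_pow, pow_add c k m]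
      field_simp

/-- The pullback `f ↦ f ∘ L` on `Σ₁` by a linear bijection `L`, as a linear map. -/
def compLinear (L : EuclideanSpace ℝ ι ≃L[ℝ] EuclideanSpace ℝ ι) :
    GelfandShilov ι →ₗ[ℂ] GelfandShilov ι where
  toFun f := ⟨fun y => f (L y), f.contDiff.comp L.contDiff, fun h hh =>
    let ⟨h', H⟩ := exists_gsNorm_comp_le L h hh
    ⟨gsNorm h' f, H.2 f⟩⟩
  map_add' _ _ := rfl
  map_smul' _ _ := rfl

/-- The pullback `f ↦ f ∘ L` on `Σ₁` by a linear bijection `L`. -/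
def compLin (L : EuclideanSpace ℝ ι ≃L[ℝ] EuclideanSpace ℝ ι) :
    GelfandShilov ι →L[ℂ] GelfandShilov ι where
  toLinearMap := compLinear L
  cont := by
    refine WithSeminorms.continuous_of_isBounded withSeminorms withSeminorms
      (compLinear L) fun h => ?_
    obtain ⟨h', hh', H⟩ := exists_gsNorm_comp_le L h.1 h.2
    refine ⟨{⟨h', hh'⟩}, 1, fun f => ?_⟩
    simp only [Finset.sup_singleton, one_smul]
    exact gsNorm_le _ (H f)

theorem compLin_apply (L : EuclideanSpace ℝ ι ≃L[ℝ] EuclideanSpace ℝ ι) (f : GelfandShilov ι)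
    (x : EuclideanSpace ℝ ι) : compLin L f x = f (L x) := rfl

end GelfandShilov

variable (ι) in
/-- The distribution space `Σ₁'(ℝ^ι)`. -/
abbrev GSDistribution : Type _ := GelfandShilov ι →L[ℂ] ℂ

namespace GSDistribution

theorem integrable_mul (f φ : GelfandShilov ι) : Integrable fun x => f x * φ x :=
  f.integrable.mul_bdd (c := GelfandShilov.gsNorm 1 φ) φ.contDiff.continuous.aestronglyMeasurable
    (Eventually.of_forall φ.norm_le_gsNorm_one)

/-- The linear form `φ ↦ ∫ f(x) φ(x) dx` on `Σ₁`. -/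
def ofGSLinear (f : GelfandShilov ι) : GelfandShilov ι →ₗ[ℂ] ℂ where
  toFun φ := ∫ x, f x * φ x
  map_add' φ ψ := by
    rw [← integral_add (integrable_mul f φ) (integrable_mul f ψ)]
    exact integral_congr_ae (Eventually.of_forall fun x => mul_add _ _ _)
  map_smul' c φ := by
    rw [RingHom.id_apply, smul_eq_mul, ← integral_const_mul]
    exact integral_congr_ae (Eventually.of_forall fun x => mul_left_comm _ _ _)

/-- The distribution `φ ↦ ∫ f(x) φ(x) dx` given by `f ∈ Σ₁`. -/
def ofGS (f : GelfandShilov ι) : GSDistribution ι where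
  toLinearMap := ofGSLinear f
  cont := by
    refine GelfandShilov.withSeminorms.continuous_normedSpace_rng ℂ (ofGSLinear f) ?_
    refine ⟨{⟨1, one_pos⟩}, ⟨∫ x, ‖f x‖, by positivity⟩, fun φ => ?_⟩
    simp only [Finset.sup_singleton]
    change ‖∫ x, f x * φ x‖ ≤ (∫ x, ‖f x‖) * GelfandShilov.gsNorm 1 φ
    rw [← integral_mul_const]
    refine norm_integral_le_of_norm_le (f.integrable.norm.mul_const _)
      (Eventually.of_forall fun x => ?_)
    rw [norm_mul]
    gcongr
    exact φ.norm_le_gsNorm_one x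

theorem ofGS_apply (f φ : GelfandShilov ι) : ofGS f φ = ∫ x, f x * φ x := rfl

/-- The pullback `⟨L^* u, φ⟩ = |det L|⁻¹ ⟨u, φ ∘ L⁻¹⟩`. -/
def pullback (L : EuclideanSpace ℝ ι ≃L[ℝ] EuclideanSpace ℝ ι) (u : GSDistribution ι) :
    GSDistribution ι :=
  ((|(L : EuclideanSpace ℝ ι →L[ℝ] EuclideanSpace ℝ ι).det|⁻¹ : ℝ) : ℂ) •
    u.comp (GelfandShilov.compLin L.symm)

end GSDistribution

/-! ### Gaussian wave packets and the short-time Fourier transform -/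

/-- Cauchy estimates for `t ↦ exp(-(t-a)²/2 - i b t)`. -/
theorem norm_iteratedDeriv_gauss_le (a b R : ℝ) (hR : 0 < R) : ∃ C : ℝ, 0 ≤ C ∧
    ∀ (m : ℕ) (t : ℝ),
    ‖iteratedDeriv m (fun t : ℝ => Complex.exp (-((t : ℂ) - a) ^ 2 / 2 - Complex.I * (t * b))) t‖ ≤
      C * (m.factorial / R ^ m) * Real.exp (-R * |t|) := by
  set G : ℂ → ℂ := fun z => Complex.exp (-(z - a) ^ 2 / 2 - Complex.I * (z * b)) with hG
  have hGd : ContDiff ℂ ∞ G := by fun_prop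
  have hre : ∀ m : ℕ, iteratedDeriv m (fun t : ℝ => G t) = fun t : ℝ => iteratedDeriv m G t := by
    intro m
    induction m with
    | zero => simp
    | succ m ih =>
      rw [iteratedDeriv_succ, ih]
      funext t
      rw [iteratedDeriv_succ]
      have : DifferentiableAt ℂ (iteratedDeriv m G) (t : ℂ) :=
        (hGd.differentiable_iteratedDeriv m (mod_cast ENat.natCast_lt_top m)) _
      exact this.hasDerivAt.comp_ofReal.deriv
  refine ⟨Real.exp (R * |a| + 2 * R ^ 2 + R * |b|), (Real.exp_pos _).le, fun m t => ?_⟩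
  have hbound : ∀ z ∈ Metric.sphere (t : ℂ) R,
      ‖G z‖ ≤ Real.exp (R * |a| + 2 * R ^ 2 + R * |b|) * Real.exp (-R * |t|) := by
    intro z hz
    rw [mem_sphere_iff_norm] at hz
    have h1 : |z.re - t| ≤ R := by
      have := Complex.abs_re_le_norm (z - t); rw [hz] at this; simpa using this
    have h2 : |z.im| ≤ R := by
      have := Complex.abs_im_le_norm (z - t); rw [hz] at this; simpa using this
    rw [hG, Complex.norm_exp, ← Real.exp_add, Real.exp_le_exp]
    have e : (-(z - a) ^ 2 / 2 - Complex.I * (z * b)).re =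
        -((z.re - a) ^ 2 - z.im ^ 2) / 2 + z.im * b := by
      simp [pow_two]
    rw [e]
    have h3 : z.im ^ 2 ≤ R ^ 2 := sq_le_sq' (by linarith [(abs_le.1 h2).1]) (abs_le.1 h2).2
    have h4 : z.im * b ≤ R * |b| := by
      calc z.im * b ≤ |z.im * b| := le_abs_self _
        _ = |z.im| * |b| := abs_mul _ _
        _ ≤ R * |b| := by gcongr
    have h5 : |t| ≤ |z.re - a| + |a| + R := by
      have : t = (z.re - a) + a - (z.re - t) := by ring
      calc |t| = |(z.re - a) + a - (z.re - t)| := by rw [← this]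
        _ ≤ |(z.re - a) + a| + |z.re - t| := abs_sub _ _
        _ ≤ |z.re - a| + |a| + R := by gcongr; exact abs_add_le _ _
    have h6 : 2 * R * |z.re - a| ≤ (z.re - a) ^ 2 + R ^ 2 := by
      nlinarith [sq_nonneg (|z.re - a| - R), sq_abs (z.re - a)]
    nlinarith
  change ‖iteratedDeriv m (fun t : ℝ => G t) t‖ ≤ _
  rw [hre]
  have := Complex.norm_iteratedDeriv_le_of_forall_mem_sphere_norm_le m hR
    (hGd.differentiable (by simp)).diffContOnCl hbound
  refine this.trans (le_of_eq ?_)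
  ring

theorem norm_iteratedFDeriv_coord_le (a b R : ℝ) (hR : 0 < R) (j : ι) : ∃ C : ℝ, 0 ≤ C ∧
    ∀ (m : ℕ) (y : EuclideanSpace ℝ ι), ‖iteratedFDeriv ℝ m (fun y : EuclideanSpace ℝ ι =>
      Complex.exp (-((y j : ℂ) - a) ^ 2 / 2 - Complex.I * (y j * b))) y‖ ≤
        C * (m.factorial / R ^ m) * Real.exp (-R * |y j|) := by
  obtain ⟨C, hC0, hC⟩ := norm_iteratedDeriv_gauss_le a b R hR
  refine ⟨C, hC0, fun m y => le_trans ?_ (hC m (y j))⟩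
  set g : ℝ → ℂ := fun t => Complex.exp (-((t : ℂ) - a) ^ 2 / 2 - Complex.I * (t * b)) with hg
  have hgd : ContDiff ℝ m g := by
    have : ContDiff ℝ m (fun t : ℝ => (t : ℂ)) := Complex.ofRealCLM.contDiff
    fun_prop
  set P : EuclideanSpace ℝ ι →L[ℝ] ℝ := EuclideanSpace.proj j with hP
  have e : (fun y : EuclideanSpace ℝ ι =>
      Complex.exp (-((y j : ℂ) - a) ^ 2 / 2 - Complex.I * (y j * b))) = g ∘ P := rfl
  have hPn : ‖P‖ ≤ 1 := by
    refine P.opNorm_le_bound zero_le_one fun x => ?_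
    rw [one_mul]
    exact PiLp.norm_apply_le x j
  rw [e, P.iteratedFDeriv_comp_right hgd y le_rfl, ← norm_iteratedFDeriv_eq_norm_iteratedDeriv]
  refine (ContinuousMultilinearMap.norm_compContinuousLinearMap_le _ _).trans ?_
  refine mul_le_of_le_one_right (norm_nonneg _) ?_
  simpa using pow_le_one₀ (norm_nonneg P) hPn

theorem norm_iteratedFDeriv_prod_coord_le (a b : ι → ℝ) (S : Finset ι) :
    ∀ R : ℝ, 0 < R → ∃ C : ℝ, 0 ≤ C ∧
    ∀ (m : ℕ) (y : EuclideanSpace ℝ ι), ‖iteratedFDeriv ℝ m (fun y : EuclideanSpace ℝ ι =>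
      ∏ j ∈ S, Complex.exp (-((y j : ℂ) - a j) ^ 2 / 2 - Complex.I * (y j * b j))) y‖ ≤
        C * (m.factorial / R ^ m) * Real.exp (-R * ∑ j ∈ S, |y j|) := by
  classical
  induction S using Finset.induction_on with
  | empty =>
    intro R hR
    refine ⟨1, zero_le_one, fun m y => ?_⟩
    rcases m with _ | m
    · simp
    · simp only [Finset.prod_empty]
      rw [iteratedFDeriv_const_of_ne (by simp)]
      simp only [Pi.zero_apply, norm_zero]
      positivity
  | insert i S hi ih =>
    intro R hR
    obtain ⟨C, hC0, hC⟩ := norm_iteratedFDeriv_coord_le (a i) (b i) (2 * R) (by positivity) i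
    obtain ⟨D, hD0, hD⟩ := ih (2 * R) (by positivity)
    refine ⟨C * D, by positivity, fun m y => ?_⟩
    simp only [Finset.prod_insert hi, Finset.sum_insert hi]
    have hsm : ∀ j : ι, ContDiff ℝ m (fun y : EuclideanSpace ℝ ι =>
        Complex.exp (-((y j : ℂ) - a j) ^ 2 / 2 - Complex.I * (y j * b j))) := by
      intro j
      have : ContDiff ℝ m (fun y : EuclideanSpace ℝ ι => (y j : ℂ)) :=
        Complex.ofRealCLM.contDiff.comp (EuclideanSpace.proj (𝕜 := ℝ) j).contDiff
      fun_prop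
    refine (norm_iteratedFDeriv_mul_le (N := m) (hsm i) (contDiff_prod fun j _ => hsm j) y
      le_rfl).trans ?_
    have hterm : ∀ k ∈ Finset.range (m + 1), (m.choose k : ℝ) *
        ‖iteratedFDeriv ℝ k (fun y : EuclideanSpace ℝ ι =>
          Complex.exp (-((y i : ℂ) - a i) ^ 2 / 2 - Complex.I * (y i * b i))) y‖ *
        ‖iteratedFDeriv ℝ (m - k) (fun y : EuclideanSpace ℝ ι => ∏ j ∈ S,
          Complex.exp (-((y j : ℂ) - a j) ^ 2 / 2 - Complex.I * (y j * b j))) y‖ ≤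
        C * D * (m.factorial / (2 * R) ^ m) *
          Real.exp (-(2 * R) * (|y i| + ∑ j ∈ S, |y j|)) := by
      intro k hk
      have hkm : k ≤ m := Nat.lt_succ_iff.1 (Finset.mem_range.1 hk)
      calc _ ≤ (m.choose k : ℝ) * (C * (k.factorial / (2 * R) ^ k) *
            Real.exp (-(2 * R) * |y i|)) * (D * ((m - k).factorial / (2 * R) ^ (m - k)) *
            Real.exp (-(2 * R) * ∑ j ∈ S, |y j|)) := by
            gcongr
            · exact hC k y
            · exact hD (m - k) y
        _ = C * D * ((m.choose k * k.factorial * (m - k).factorial : ℕ) /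
            ((2 * R) ^ k * (2 * R) ^ (m - k))) * (Real.exp (-(2 * R) * |y i|) *
            Real.exp (-(2 * R) * ∑ j ∈ S, |y j|)) := by
            push_cast
            field_simp
        _ = _ := by
            rw [Nat.choose_mul_factorial_mul_factorial hkm, ← pow_add, ← Real.exp_add,
              Nat.add_sub_cancel' hkm, mul_add]
    refine (Finset.sum_le_card_nsmul _ _ _ hterm).trans ?_
    rw [Finset.card_range, nsmul_eq_mul]
    have h2 : ((m + 1 : ℕ) : ℝ) ≤ 2 ^ m := by
      exact_mod_cast Nat.lt_two_pow_self
    have h0 : 0 ≤ |y i| + ∑ j ∈ S, |y j| := by positivity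
    have h3 : Real.exp (-(2 * R) * (|y i| + ∑ j ∈ S, |y j|)) ≤
        Real.exp (-R * (|y i| + ∑ j ∈ S, |y j|)) := by
      rw [Real.exp_le_exp]; nlinarith
    calc _ ≤ (2 : ℝ) ^ m * (C * D * (m.factorial / (2 * R) ^ m) *
          Real.exp (-R * (|y i| + ∑ j ∈ S, |y j|))) := by gcongr
      _ = _ := by
        rw [mul_pow]
        field_simp

/-- The Gaussian window `π^(-n/4) exp(-|x|²/2)` on `ℝ^ι`, `n = |ι|`. -/
def gaussianWindow (x : EuclideanSpace ℝ ι) : ℝ :=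
  Real.pi ^ (-(Fintype.card ι : ℝ) / 4) * Real.exp (-‖x‖ ^ 2 / 2)

theorem isGelfandShilov_gaussianPacket (x ξ : EuclideanSpace ℝ ι) :
    IsGelfandShilov fun y : EuclideanSpace ℝ ι =>
      (gaussianWindow (y - x) : ℂ) * Complex.exp (-Complex.I * (inner ℝ y ξ : ℝ)) := by
  set c : ℂ := ((Real.pi ^ (-(Fintype.card ι : ℝ) / 4) : ℝ) : ℂ) with hc
  have e : (fun y : EuclideanSpace ℝ ι =>
      (gaussianWindow (y - x) : ℂ) * Complex.exp (-Complex.I * (inner ℝ y ξ : ℝ))) =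
      c • fun y : EuclideanSpace ℝ ι => ∏ j,
        Complex.exp (-((y j : ℂ) - x j) ^ 2 / 2 - Complex.I * (y j * ξ j)) := by
    funext y
    rw [Pi.smul_apply, ← Complex.exp_sum, smul_eq_mul, gaussianWindow, Complex.ofReal_mul, ← hc,
      mul_assoc, Complex.ofReal_exp, ← Complex.exp_add, EuclideanSpace.norm_sq_eq]
    congr 2
    simp only [PiLp.inner_apply, Finset.sum_sub_distrib, neg_div, Finset.sum_neg_distrib]
    push_cast
    rw [Finset.sum_div, ← Finset.mul_sum, neg_mul]
    have e1 : ∑ j, ((‖(y - x) j‖ : ℝ) : ℂ) ^ 2 / 2 = ∑ j, ((y j : ℂ) - x j) ^ 2 / 2 := by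
      refine Finset.sum_congr rfl fun j _ => ?_
      rw [← Complex.ofReal_pow, Real.norm_eq_abs, sq_abs]
      simp
    have e2 : ∑ j, ((inner ℝ (y j) (ξ j) : ℝ) : ℂ) = ∑ j, (y j : ℂ) * ξ j := by
      refine Finset.sum_congr rfl fun j _ => ?_
      simp [mul_comm]
    rw [e1, e2, sub_eq_add_neg]
  rw [e]
  refine (gelfandShilovSubmodule ι).smul_mem c ⟨?_, fun h hh => ?_⟩
  · refine contDiff_prod fun j _ => ?_
    have : ContDiff ℝ ∞ (fun y : EuclideanSpace ℝ ι => (y j : ℂ)) :=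
      Complex.ofRealCLM.contDiff.comp (EuclideanSpace.proj (𝕜 := ℝ) j).contDiff
    fun_prop
  · obtain ⟨C, hC0, hC⟩ := norm_iteratedFDeriv_prod_coord_le (fun j => x j) (fun j => ξ j)
      Finset.univ h⁻¹ (by positivity)
    refine ⟨C, fun k m y => ?_⟩
    have hy : ‖y‖ ≤ ∑ j, |y j| := by
      have h1 : y = ∑ j, y j • EuclideanSpace.basisFun ι ℝ j := by
        simpa using ((EuclideanSpace.basisFun ι ℝ).sum_repr y).symm
      calc ‖y‖ = ‖∑ j, y j • EuclideanSpace.basisFun ι ℝ j‖ := by rw [← h1]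
        _ ≤ ∑ j, ‖y j • EuclideanSpace.basisFun ι ℝ j‖ := norm_sum_le _ _
        _ = ∑ j, |y j| := by simp [norm_smul]
    have hk : ‖y‖ ^ k ≤ h ^ k * k.factorial * Real.exp (h⁻¹ * ∑ j, |y j|) := by
      have := Real.pow_div_factorial_le_exp (h⁻¹ * ∑ j, |y j|) (by positivity) k
      rw [div_le_iff₀ (by positivity), mul_pow, inv_pow, inv_mul_le_iff₀ (by positivity)] at this
      refine (pow_le_pow_left₀ (norm_nonneg y) hy k).trans (this.trans (le_of_eq ?_))
      ring
    rw [div_le_iff₀ (by positivity)]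
    calc _ ≤ (h ^ k * k.factorial * Real.exp (h⁻¹ * ∑ j, |y j|)) *
          (C * (m.factorial / h⁻¹ ^ m) * Real.exp (-h⁻¹ * ∑ j, |y j|)) := by
          gcongr
          exact hC m y
      _ = C * (h ^ k * k.factorial * (m.factorial * h ^ m)) *
          (Real.exp (h⁻¹ * ∑ j, |y j|) * Real.exp (-h⁻¹ * ∑ j, |y j|)) := by
          rw [inv_pow, div_inv_eq_mul]
          ring
      _ = _ := by
          rw [← Real.exp_add, neg_mul, add_neg_cancel, Real.exp_zero, pow_add]
          ring

/-- The test function `y ↦ conj(φ(y - x)) e^{-i⟨y,ξ⟩}`, where `φ` is the (real) Gaussian window. -/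
def gaussianPacket (x ξ : EuclideanSpace ℝ ι) : GelfandShilov ι :=
  ⟨_, isGelfandShilov_gaussianPacket x ξ⟩

/-- The short-time Fourier transform
`V_φ u (x, ξ) = (2π)^(-n/2) ⟨u, conj(φ(· - x)) e^{-i⟨·,ξ⟩}⟩` with the Gaussian window `φ`. -/
def stft (u : GSDistribution ι) (z : EuclideanSpace ℝ ι × EuclideanSpace ℝ ι) : ℂ :=
  (((2 * Real.pi) ^ (-(Fintype.card ι : ℝ) / 2) : ℝ) : ℂ) * u (gaussianPacket z.1 z.2)

end GelfandShilov

/-! ### Young functions and moderate weights -/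

/-- A Young function `Φ : [0, ∞] → [0, ∞]`. -/
structure YoungFunction where
  toFun : ℝ≥0∞ → ℝ≥0∞
  convex' : ConvexOn ℝ≥0 univ toFun
  map_zero' : toFun 0 = 0
  map_top' : toFun ∞ = ∞
  tendsto' : Tendsto (fun t : ℝ≥0 => toFun t) atTop (𝓝 ∞)

namespace YoungFunction

instance : CoeFun YoungFunction fun _ => ℝ≥0∞ → ℝ≥0∞ := ⟨toFun⟩

/-- The `Δ₂`-condition near the origin. -/
def LocalDelta2 (Φ : YoungFunction) : Prop :=
  ∃ r : ℝ≥0, 0 < r ∧ ∃ C : ℝ≥0, ∀ t : ℝ≥0∞, t ≤ r → Φ (2 * t) ≤ C * Φ t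

theorem convex (Φ : YoungFunction) {a b : ℝ≥0} (hab : a + b = 1) (s t : ℝ≥0∞) :
    Φ (a * s + b * t) ≤ a * Φ s + b * Φ t :=
  Φ.convex'.2 (mem_univ s) (mem_univ t) zero_le zero_le hab

theorem mono (Φ : YoungFunction) : Monotone Φ := by
  intro s t hst
  rcases eq_or_ne t ∞ with rfl | ht
  · rw [Φ.map_top']; exact le_top
  rcases eq_or_ne t 0 with rfl | ht0
  · rw [le_antisymm hst zero_le]
  lift t to ℝ≥0 using ht
  lift s to ℝ≥0 using ne_top_of_le_ne_top ENNReal.coe_ne_top hst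
  have ht0' : t ≠ 0 := by simpa using ht0
  have hst' : s ≤ t := by exact_mod_cast hst
  have ha : s / t ≤ 1 := div_le_one_of_le₀ hst' zero_le
  have := Φ.convex (add_tsub_cancel_of_le ha) (t : ℝ≥0∞) 0
  rw [Φ.map_zero', mul_zero, add_zero, add_zero, ← ENNReal.coe_mul,
    div_mul_cancel₀ s ht0'] at this
  refine this.trans (mul_le_of_le_one_left zero_le ?_)
  exact_mod_cast ha

theorem measurable (Φ : YoungFunction) : Measurable Φ := Φ.mono.measurable

end YoungFunction

/-- A weight: a positive function `ω` such that `ω` and `1/ω` belong to `L^∞_loc`. -/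
def IsWeight {E : Type*} [TopologicalSpace E] [MeasureSpace E] (ω : E → ℝ) : Prop :=
  (∀ x, 0 < ω x) ∧ ∀ K : Set E, IsCompact K →
    MemLp ω ∞ (volume.restrict K) ∧ MemLp (fun x => (ω x)⁻¹) ∞ (volume.restrict K)

/-- The moderate weights, i.e. the class `𝒫_E`. -/
structure ModerateWeight (E : Type*) [AddCommGroup E] [TopologicalSpace E] [MeasureSpace E] where
  toFun : E → ℝ
  isWeight' : IsWeight toFun
  moderate' : ∃ v : E → ℝ, IsWeight v ∧ ∃ C : ℝ, ∀ x y, toFun (x + y) ≤ C * (toFun x * v y)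

namespace ModerateWeight

variable {E : Type*} [AddCommGroup E] [TopologicalSpace E] [MeasureSpace E]

instance : CoeFun (ModerateWeight E) fun _ => E → ℝ := ⟨toFun⟩

theorem pos (ω : ModerateWeight E) (x : E) : 0 < ω x := ω.isWeight'.1 x

theorem aemeasurable [SigmaCompactSpace E] (ω : ModerateWeight E) :
    AEMeasurable ω (volume : Measure E) := by
  have h : ∀ n, AEStronglyMeasurable ω (volume.restrict (compactCovering E n)) := fun n =>
    (ω.isWeight'.2 _ (isCompact_compactCovering E n)).1.1
  have := aestronglyMeasurable_iUnion_iff.2 h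
  rw [iUnion_compactCovering, Measure.restrict_univ] at this
  exact this.aemeasurable

end ModerateWeight

/-! ### Orlicz spaces -/

section Orlicz

variable {E : Type*} [MeasureSpace E]

/-- The numbers `lam > 0` with `∫ Φ(|F(z)| ω(z) / lam) dz ≤ 1`. -/
def orliczSet (Φ : YoungFunction) (ω : E → ℝ) (F : E → ℂ) : Set ℝ :=
  {lam | 0 < lam ∧ ∫⁻ z, Φ (ENNReal.ofReal (‖F z‖ * ω z / lam)) ≤ 1}

/-- The (Luxemburg) norm of the weighted Orlicz space `L^Φ_(ω)`. -/
def orliczNorm (Φ : YoungFunction) (ω : E → ℝ) (F : E → ℂ) : ℝ := sInf (orliczSet Φ ω F)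

/-- `F` is measurable with finite `L^Φ_(ω)` norm. -/
def MemOrlicz (Φ : YoungFunction) (ω : E → ℝ) (F : E → ℂ) : Prop :=
  AEStronglyMeasurable F ∧ (orliczSet Φ ω F).Nonempty

theorem orliczSet_bddBelow (Φ : YoungFunction) (ω : E → ℝ) (F : E → ℂ) :
    BddBelow (orliczSet Φ ω F) := ⟨0, fun _ h => h.1.le⟩

theorem orliczNorm_nonneg (Φ : YoungFunction) (ω : E → ℝ) (F : E → ℂ) :
    0 ≤ orliczNorm Φ ω F := Real.sInf_nonneg fun _ h => h.1.le

theorem mem_orliczSet_zero (Φ : YoungFunction) (ω : E → ℝ) {r : ℝ} (hr : 0 < r) :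
    r ∈ orliczSet Φ ω (fun _ : E => (0 : ℂ)) := by
  refine ⟨hr, ?_⟩
  simp [Φ.map_zero']

theorem orliczNorm_zero (Φ : YoungFunction) (ω : E → ℝ) :
    orliczNorm Φ ω (fun _ : E => (0 : ℂ)) = 0 := by
  refine le_antisymm (le_of_forall_pos_le_add fun ε hε => ?_) (orliczNorm_nonneg _ _ _)
  rw [zero_add]
  exact csInf_le (orliczSet_bddBelow _ _ _) (mem_orliczSet_zero Φ ω hε)

theorem mul_mem_orliczSet (Φ : YoungFunction) (ω : E → ℝ) (F : E → ℂ) {c : ℂ} (hc : c ≠ 0) {r : ℝ}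
    (hr : r ∈ orliczSet Φ ω F) : ‖c‖ * r ∈ orliczSet Φ ω (fun z => c * F z) := by
  have hc' : 0 < ‖c‖ := norm_pos_iff.2 hc
  refine ⟨mul_pos hc' hr.1, ?_⟩
  convert hr.2 using 5 with z
  rw [norm_mul, mul_assoc, mul_div_mul_left _ _ hc'.ne']

theorem orliczNorm_mul_le (Φ : YoungFunction) (ω : E → ℝ) (F : E → ℂ) (c : ℂ)
    (hF : (orliczSet Φ ω F).Nonempty) :
    orliczNorm Φ ω (fun z => c * F z) ≤ ‖c‖ * orliczNorm Φ ω F := by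
  rcases eq_or_ne c 0 with rfl | hc
  · simp [orliczNorm_zero]
  have hc' : 0 < ‖c‖ := norm_pos_iff.2 hc
  rw [← div_le_iff₀' hc']
  refine le_csInf hF fun r hr => ?_
  rw [div_le_iff₀' hc']
  exact csInf_le (orliczSet_bddBelow _ _ _) (mul_mem_orliczSet Φ ω F hc hr)

theorem add_mem_orliczSet [AddCommGroup E] [TopologicalSpace E] [SigmaCompactSpace E]
    (Φ : YoungFunction) (ω : ModerateWeight E)
    {F G : E → ℂ} (hF : AEStronglyMeasurable F) {r s : ℝ} (hr : r ∈ orliczSet Φ ω F)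
    (hs : s ∈ orliczSet Φ ω G) : r + s ∈ orliczSet Φ ω (fun z => F z + G z) := by
  have hr0 := hr.1
  have hs0 := hs.1
  have hrs : 0 < r + s := add_pos hr0 hs0
  refine ⟨hrs, ?_⟩
  set a : ℝ≥0 := (r / (r + s)).toNNReal with ha
  set b : ℝ≥0 := (s / (r + s)).toNNReal with hb
  have hab : a + b = 1 := by
    rw [ha, hb, ← Real.toNNReal_add (by positivity) (by positivity), ← add_div,
      div_self hrs.ne', Real.toNNReal_one]
  have key : ∀ z, Φ (ENNReal.ofReal (‖F z + G z‖ * ω z / (r + s))) ≤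
      a * Φ (ENNReal.ofReal (‖F z‖ * ω z / r)) + b * Φ (ENNReal.ofReal (‖G z‖ * ω z / s)) := by
    intro z
    have hω := ω.pos z
    refine le_trans (Φ.mono ?_) (Φ.convex hab _ _)
    change _ ≤ ENNReal.ofReal _ * _ + ENNReal.ofReal _ * _
    rw [← ENNReal.ofReal_mul (by positivity), ← ENNReal.ofReal_mul (by positivity),
      ← ENNReal.ofReal_add (by positivity) (by positivity)]
    refine ENNReal.ofReal_le_ofReal ?_
    calc ‖F z + G z‖ * ω z / (r + s) ≤ (‖F z‖ + ‖G z‖) * ω z / (r + s) := by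
          gcongr
          exact norm_add_le _ _
      _ = _ := by field_simp
  have hmeas : AEMeasurable (fun z => (a : ℝ≥0∞) * Φ (ENNReal.ofReal (‖F z‖ * ω z / r))) :=
    (Φ.measurable.comp_aemeasurable
      ((hF.norm.aemeasurable.mul ω.aemeasurable).div_const r).ennreal_ofReal).const_mul _
  calc _ ≤ ∫⁻ z, (a * Φ (ENNReal.ofReal (‖F z‖ * ω z / r)) +
          b * Φ (ENNReal.ofReal (‖G z‖ * ω z / s))) := lintegral_mono key
    _ = a * (∫⁻ z, Φ (ENNReal.ofReal (‖F z‖ * ω z / r))) +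
          b * ∫⁻ z, Φ (ENNReal.ofReal (‖G z‖ * ω z / s)) := by
        rw [lintegral_add_left' hmeas, lintegral_const_mul' _ _ ENNReal.coe_ne_top,
          lintegral_const_mul' _ _ ENNReal.coe_ne_top]
    _ ≤ a * 1 + b * 1 := by
        gcongr
        · exact hr.2
        · exact hs.2
    _ = 1 := by
        rw [mul_one, mul_one]
        exact_mod_cast hab

theorem orliczNorm_add_le [AddCommGroup E] [TopologicalSpace E] [SigmaCompactSpace E]
    (Φ : YoungFunction) (ω : ModerateWeight E)
    {F G : E → ℂ} (hF : MemOrlicz Φ ω F) (hG : MemOrlicz Φ ω G) :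
    orliczNorm Φ ω (fun z => F z + G z) ≤ orliczNorm Φ ω F + orliczNorm Φ ω G := by
  have h : ∀ r ∈ orliczSet Φ ω F, ∀ s ∈ orliczSet Φ ω G,
      orliczNorm Φ ω (fun z => F z + G z) ≤ r + s := fun r hr s hs =>
    csInf_le (orliczSet_bddBelow _ _ _) (add_mem_orliczSet Φ ω hF.1 hr hs)
  have h1 : ∀ r ∈ orliczSet Φ ω F,
      orliczNorm Φ ω (fun z => F z + G z) - r ≤ orliczNorm Φ ω G := fun r hr =>
    le_csInf hG.2 fun s hs => by linarith [h r hr s hs]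
  have h2 : orliczNorm Φ ω (fun z => F z + G z) - orliczNorm Φ ω G ≤ orliczNorm Φ ω F :=
    le_csInf hF.2 fun r hr => by linarith [h1 r hr]
  linarith

end Orlicz

/-! ### Orlicz modulation spaces -/

section Modulation

variable {ι : Type*} [Fintype ι]

theorem stft_zero : stft (0 : GSDistribution ι) = fun _ => 0 := by
  funext z; simp [stft]

theorem stft_add (u w : GSDistribution ι) : stft (u + w) = fun z => stft u z + stft w z := by
  funext z; simp [stft, mul_add]

theorem stft_smul (c : ℂ) (u : GSDistribution ι) : stft (c • u) = fun z => c * stft u z := by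
  funext z; simp [stft, mul_left_comm]

/-- The elements of `M^Φ_(ω)(ℝ^ι)`: all `u ∈ Σ₁'(ℝ^ι)` whose short-time Fourier transform belongs
to `L^Φ_(ω)(ℝ^ι × ℝ^ι)`. -/
def modulationSubmodule (Φ : YoungFunction)
    (ω : ModerateWeight (EuclideanSpace ℝ ι × EuclideanSpace ℝ ι)) :
    Submodule ℂ (GSDistribution ι) where
  carrier := {u | MemOrlicz Φ ω (stft u)}
  zero_mem' := by
    rw [mem_ofPred_eq, stft_zero]
    exact ⟨aestronglyMeasurable_const, 1, mem_orliczSet_zero Φ ω one_pos⟩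
  add_mem' := by
    rintro u w ⟨hu, r, hr⟩ ⟨hw, s, hs⟩
    rw [mem_ofPred_eq, stft_add]
    exact ⟨hu.add hw, r + s, add_mem_orliczSet Φ ω hu hr hs⟩
  smul_mem' := by
    rintro c u ⟨hu, r, hr⟩
    rw [mem_ofPred_eq, stft_smul]
    refine ⟨hu.const_mul c, ?_⟩
    rcases eq_or_ne c 0 with rfl | hc
    · simp only [zero_mul]
      exact ⟨1, mem_orliczSet_zero Φ ω one_pos⟩
    · exact ⟨_, mul_mem_orliczSet Φ ω _ hc hr⟩

/-- The Orlicz modulation space `M^Φ_(ω)(ℝ^ι)`. -/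
def OrliczModulationSpace (Φ : YoungFunction)
    (ω : ModerateWeight (EuclideanSpace ℝ ι × EuclideanSpace ℝ ι)) : Type _ :=
  modulationSubmodule Φ ω

namespace OrliczModulationSpace

variable (Φ : YoungFunction) (ω : ModerateWeight (EuclideanSpace ℝ ι × EuclideanSpace ℝ ι))

instance : AddCommGroup (OrliczModulationSpace Φ ω) :=
  inferInstanceAs (AddCommGroup (modulationSubmodule Φ ω))

instance : Module ℂ (OrliczModulationSpace Φ ω) :=
  inferInstanceAs (Module ℂ (modulationSubmodule Φ ω))

/-- The inclusion of `M^Φ_(ω)` in `Σ₁'`. -/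
def toDistribution : OrliczModulationSpace Φ ω →ₗ[ℂ] GSDistribution ι :=
  (modulationSubmodule Φ ω).subtype

/-- The norm `‖V_φ u‖` in `L^Φ_(ω)` of `u ∈ M^Φ_(ω)`. -/
def modulationSeminorm : Seminorm ℂ (OrliczModulationSpace Φ ω) :=
  Seminorm.ofSMulLE (fun u => orliczNorm Φ ω (stft (toDistribution Φ ω u)))
    (by
      rw [map_zero, stft_zero, orliczNorm_zero])
    (fun u w => by
      rw [map_add, stft_add]
      exact orliczNorm_add_le Φ ω u.2 w.2)
    (fun c u => by
      rw [map_smul, stft_smul]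
      exact orliczNorm_mul_le Φ ω _ c u.2.2)

/-- The topology of `M^Φ_(ω)` is given by its norm. (Only the properties of a seminorm are recorded
here.) -/
instance : SeminormedAddCommGroup (OrliczModulationSpace Φ ω) :=
  (modulationSeminorm Φ ω).toAddGroupSeminorm.toSeminormedAddCommGroup

theorem norm_def (u : OrliczModulationSpace Φ ω) :
    ‖u‖ = orliczNorm Φ ω (stft (toDistribution Φ ω u)) := rfl

instance : NormedSpace ℂ (OrliczModulationSpace Φ ω) where
  norm_smul_le c u := ((modulationSeminorm Φ ω).smul' c u).le

/-- The topology on `M^Φ_(ω)` induced by the weak-* topology `σ(Σ₁', Σ₁)`: pointwise convergence on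
test functions. -/
@[reducible]
def weakStarTopology : TopologicalSpace (OrliczModulationSpace Φ ω) :=
  TopologicalSpace.induced
    (fun u (φ : GelfandShilov ι) => toDistribution Φ ω u φ) Pi.topologicalSpace

/-- `S : M^Φ_(ω) → M^Φ_(ω')` extends the pullback `f ↦ f ∘ L` on `Σ₁`. -/
def ExtendsPullback {Φ : YoungFunction}
    {ω ω' : ModerateWeight (EuclideanSpace ℝ ι × EuclideanSpace ℝ ι)}
    (L : EuclideanSpace ℝ ι ≃L[ℝ] EuclideanSpace ℝ ι)
    (S : OrliczModulationSpace Φ ω → OrliczModulationSpace Φ ω') : Prop :=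
  ∀ (f : GelfandShilov ι) (u : OrliczModulationSpace Φ ω),
    toDistribution Φ ω u = GSDistribution.ofGS f →
      toDistribution Φ ω' (S u) = GSDistribution.ofGS (GelfandShilov.compLin L f)

end OrliczModulationSpace

end Modulation

/-! ### The shear `T_A` on `ℝ^{2d}` -/

section Shear

variable {d : ℕ}

/-- The point `(x, y) ∈ ℝ^{2d}`. -/
def pair (x y : EuclideanSpace ℝ (Fin d)) : EuclideanSpace ℝ (Fin d ⊕ Fin d) :=
  WithLp.toLp 2 (Sum.elim x y)

/-- The component `x` of `(x, y) ∈ ℝ^{2d}`. -/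
def fstPart (z : EuclideanSpace ℝ (Fin d ⊕ Fin d)) : EuclideanSpace ℝ (Fin d) :=
  WithLp.toLp 2 fun i => z (Sum.inl i)

/-- The component `y` of `(x, y) ∈ ℝ^{2d}`. -/
def sndPart (z : EuclideanSpace ℝ (Fin d ⊕ Fin d)) : EuclideanSpace ℝ (Fin d) :=
  WithLp.toLp 2 fun i => z (Sum.inr i)

/-- The action of a real `d × d` matrix on `ℝ^d`. -/
def act (A : Matrix (Fin d) (Fin d) ℝ) (x : EuclideanSpace ℝ (Fin d)) :
    EuclideanSpace ℝ (Fin d) := Matrix.toEuclideanLin A x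

theorem fstPart_pair (x y : EuclideanSpace ℝ (Fin d)) : fstPart (pair x y) = x := rfl

theorem sndPart_pair (x y : EuclideanSpace ℝ (Fin d)) : sndPart (pair x y) = y := rfl

theorem pair_fstPart_sndPart (z : EuclideanSpace ℝ (Fin d ⊕ Fin d)) :
    pair (fstPart z) (sndPart z) = z := by
  ext i
  cases i <;> rfl

theorem pair_add (x y x' y' : EuclideanSpace ℝ (Fin d)) :
    pair (x + x') (y + y') = pair x y + pair x' y' := by
  ext i
  cases i <;> rfl

theorem pair_smul (c : ℝ) (x y : EuclideanSpace ℝ (Fin d)) :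
    pair (c • x) (c • y) = c • pair x y := by
  ext i
  cases i <;> rfl

theorem fstPart_add (z w : EuclideanSpace ℝ (Fin d ⊕ Fin d)) :
    fstPart (z + w) = fstPart z + fstPart w := rfl

theorem sndPart_add (z w : EuclideanSpace ℝ (Fin d ⊕ Fin d)) :
    sndPart (z + w) = sndPart z + sndPart w := rfl

theorem fstPart_smul (c : ℝ) (z : EuclideanSpace ℝ (Fin d ⊕ Fin d)) :
    fstPart (c • z) = c • fstPart z := rfl

theorem sndPart_smul (c : ℝ) (z : EuclideanSpace ℝ (Fin d ⊕ Fin d)) :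
    sndPart (c • z) = c • sndPart z := rfl

/-- The map `T_A(x, y) = (x - A(x - y), y - A(x - y))`, a linear bijection with inverse
`T_{-A}`. -/
def shear (A : Matrix (Fin d) (Fin d) ℝ) :
    EuclideanSpace ℝ (Fin d ⊕ Fin d) ≃L[ℝ] EuclideanSpace ℝ (Fin d ⊕ Fin d) :=
  LinearEquiv.toContinuousLinearEquiv
    { toFun := fun z =>
        pair (fstPart z - act A (fstPart z - sndPart z)) (sndPart z - act A (fstPart z - sndPart z))
      invFun := fun z =>
        pair (fstPart z + act A (fstPart z - sndPart z)) (sndPart z + act A (fstPart z - sndPart z))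
      map_add' := fun z w => by
        rw [← pair_add]
        simp only [fstPart_add, sndPart_add, act, add_sub_add_comm, map_add]
      map_smul' := fun c z => by
        rw [RingHom.id_apply, ← pair_smul]
        simp only [fstPart_smul, sndPart_smul, act, ← smul_sub, map_smul]
      left_inv := fun z => by
        simp only [fstPart_pair, sndPart_pair, sub_sub_sub_cancel_right, sub_add_cancel,
          pair_fstPart_sndPart]
      right_inv := fun z => by
        simp only [fstPart_pair, sndPart_pair, add_sub_add_right_eq_sub, add_sub_cancel_right,
          pair_fstPart_sndPart] }

theorem shear_pair (A : Matrix (Fin d) (Fin d) ℝ) (x y : EuclideanSpace ℝ (Fin d)) :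
    shear A (pair x y) = pair (x - act A (x - y)) (y - act A (x - y)) := rfl

end Shear

end OrliczModulation

end

open OrliczModulation OrliczModulation.OrliczModulationSpace
open scoped Topology ENNReal

noncomputable section

namespace OrliczModulation

open MeasureTheory Set Filter Topology
open scoped ENNReal NNReal ContDiff

/-! ### Cauchy estimates in several variables -/

section Cauchy

/-! Write V for the short-time Fourier transform, let L be a linear bijection with inverse transpose
M, and put Λ = L × M. By definition V(L^*u)(w) is a constant times u applied to the Gaussian packet
at w composed with L⁻¹. The inversion formula for V, paired with u (`apply_eq_integral_stft`), turns
this into an integral operator acting on Vu (`stft_pullback`). The packet at w composed with L⁻¹ is,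
up to a phase, the phase-space shift by Λw of the packet at 0 composed with L⁻¹. Hence the modulus
of the kernel depends only on z - Λw (`norm_pullbackKernel_eq`), and it decays faster than every
exponential because that packet lies in Σ₁ (`norm_stft_ofGS_le`).

A moderate weight changes at most exponentially under translation (`ModerateWeight.exists_le_exp`).
If ω' = ω ∘ Λ, the weighted operator is therefore dominated by convolution with exp(-|·|) followed
by composition with Λ. Jensen's inequality and Tonelli's theorem bound this on L^Φ for every Young
function (`exists_lintegral_map_le_one`). For L = T_A the inverse transpose is `shearDual A`, and
the assumption on the weights says exactly that ω_A = ω_0 ∘ Λ. The same argument for L⁻¹ bounds the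
inverse.

The inversion formula rests on Σ₁-valued integrals: packets depend continuously on their parameters
and grow at most exponentially in each norm, and each distribution factors through a Banach space of
weighted jets (`GelfandShilov.exists_integral`).

Uniqueness is density of Σ₁ in a Hausdorff setting. For the weak-* topology, finitely many test
functions cannot distinguish a distribution from all elements of Σ₁ (`exists_ofGS_eq_on_finset`).
For the norm, positivity of Φ makes ω·Vu vanish at infinity, so the doubling condition near 0
controls the tails of Vu. Truncating the inversion integral to balls then gives approximants in Σ₁
(`dense_gsSet`). -/

theorem norm_fderiv_le_of_forall_mem_closedBall {V W : Type*} [NormedAddCommGroup V]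
    [NormedSpace ℂ V] [NormedAddCommGroup W] [NormedSpace ℂ W] {G : V → W}
    (hG : Differentiable ℂ G) {x : V} {r M : ℝ} (hr : 0 < r)
    (hM : ∀ ζ ∈ Metric.closedBall x r, ‖G ζ‖ ≤ M) : ‖fderiv ℂ G x‖ ≤ M / r := by
  have hM0 : 0 ≤ M := (norm_nonneg _).trans (hM x (Metric.mem_closedBall_self hr.le))
  refine ContinuousLinearMap.opNorm_le_bound _ (by positivity) fun v => ?_
  rcases eq_or_ne v 0 with rfl | hv
  · simp
  have hv' : 0 < ‖v‖ := norm_pos_iff.2 hv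
  have hd : Differentiable ℂ fun t : ℂ => G (x + t • v) := by fun_prop
  have h1 : HasDerivAt (fun t : ℂ => x + t • v) v 0 := by
    simpa using ((hasDerivAt_id (0 : ℂ)).smul_const v).const_add x
  have h2 : HasFDerivAt G (fderiv ℂ G x) (x + (0 : ℂ) • v) := by
    simpa using (hG x).hasFDerivAt
  have h3 : deriv (fun t : ℂ => G (x + t • v)) 0 = fderiv ℂ G x v :=
    (h2.comp_hasDerivAt (0 : ℂ) h1).deriv
  -- The parameter radius r/‖v‖ makes the disc in direction v have radius r in V; the Cauchy
  -- estimate then gives M‖v‖/r.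
  have := Complex.norm_deriv_le_of_forall_mem_sphere_norm_le (c := 0) (R := r / ‖v‖) (C := M)
    (div_pos hr hv') hd.diffContOnCl (fun t ht => hM _ ?_)
  · rw [h3] at this
    refine this.trans (le_of_eq ?_)
    field_simp
  · rw [mem_sphere_zero_iff_norm] at ht
    rw [mem_closedBall_iff_norm, add_sub_cancel_left, norm_smul, ht, div_mul_cancel₀ _ hv'.ne']

/-- Iterating the first-order estimate costs one radius r for each derivative, hence the ball of
radius m·r. With m·r fixed this produces m^m instead of m!, a loss of a factor e^m that the freedom
in h absorbs. -/
theorem norm_iteratedFDeriv_le_of_forall_mem_closedBall {V W : Type*} [NormedAddCommGroup V]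
    [NormedSpace ℂ V] [NormedAddCommGroup W] [NormedSpace ℂ W] {G : V → W}
    (hG : ContDiff ℂ ∞ G) {r M : ℝ} (hr : 0 < r) (m : ℕ) :
    ∀ x : V, (∀ ζ ∈ Metric.closedBall x (m * r), ‖G ζ‖ ≤ M) →
      ‖iteratedFDeriv ℂ m G x‖ ≤ M / r ^ m := by
  induction m with
  | zero =>
    intro x h
    simpa using h x (by simp)
  | succ m ih =>
    intro x h
    rw [← norm_fderiv_iteratedFDeriv, pow_succ, ← div_div]
    refine norm_fderiv_le_of_forall_mem_closedBall
      (hG.differentiable_iteratedFDeriv (mod_cast ENat.natCast_lt_top m)) hr fun ζ hζ => ?_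
    refine ih ζ fun w hw => h w ?_
    rw [Metric.mem_closedBall] at hζ hw ⊢
    push_cast
    linarith [dist_triangle w ζ x]

variable {ι : Type*} [Fintype ι]

variable (ι) in
/-- The embedding of `ℝ^ι` in `ℂ^ι`. -/
def complexify : EuclideanSpace ℝ ι →L[ℝ] EuclideanSpace ℂ ι :=
  LinearMap.toContinuousLinearMap
    { toFun := fun y => WithLp.toLp 2 fun j => (y j : ℂ)
      map_add' := fun y w => by ext j; simp
      map_smul' := fun c y => by ext j; simp }

theorem complexify_apply (y : EuclideanSpace ℝ ι) (j : ι) : complexify ι y j = (y j : ℂ) := rfl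

theorem norm_complexify (y : EuclideanSpace ℝ ι) : ‖complexify ι y‖ = ‖y‖ := by
  simp [EuclideanSpace.norm_eq, complexify_apply]

theorem norm_complexify_le : ‖complexify ι‖ ≤ 1 :=
  ContinuousLinearMap.opNorm_le_bound _ zero_le_one fun y => by rw [norm_complexify, one_mul]

theorem pow_le_exp_mul_factorial (m : ℕ) : (m : ℝ) ^ m ≤ Real.exp 1 ^ m * m.factorial := by
  have := Real.pow_div_factorial_le_exp (m : ℝ) (by positivity) m
  rwa [div_le_iff₀ (by positivity), ← mul_one (m : ℝ), Real.exp_nat_mul, mul_one] at this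

/-- Functions that extend to entire functions with exponential decay on a tube satisfy
Gelfand–Shilov estimates. -/
theorem gelfandShilov_bound_of_entire {F : EuclideanSpace ℂ ι → ℂ} (hF : ContDiff ℂ ∞ F)
    {a M h : ℝ} (ha : 0 < a) (hah : Real.exp 1 ≤ a * h)
    (hM : ∀ (y : EuclideanSpace ℝ ι) (ζ : EuclideanSpace ℂ ι), ‖ζ - complexify ι y‖ ≤ a →
      ‖F ζ‖ ≤ M * Real.exp (-a * ‖y‖)) (k m : ℕ) (x : EuclideanSpace ℝ ι) :
    ‖x‖ ^ k * ‖iteratedFDeriv ℝ m (fun y => F (complexify ι y)) x‖ /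
      (h ^ (k + m) * (k.factorial * m.factorial)) ≤ M := by
  have hh : 0 < h := by
    by_contra! hh
    linarith [mul_nonpos_of_nonneg_of_nonpos ha.le hh, Real.exp_pos 1]
  have hM0 : 0 ≤ M := by
    have := (norm_nonneg _).trans (hM 0 (complexify ι 0) (by simpa using ha.le))
    simpa using this
  have h1 : ‖iteratedFDeriv ℝ m (fun y => F (complexify ι y)) x‖ ≤
      ‖iteratedFDeriv ℂ m F (complexify ι x)‖ := by
    have hFm : ContDiff ℂ m F := hF.of_le (mod_cast le_top)
    have e1 := (complexify ι).iteratedFDeriv_comp_right (hFm.restrict_scalars ℝ) x le_rfl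
    change iteratedFDeriv ℝ m (fun y => F (complexify ι y)) x = _ at e1
    rw [e1]
    refine (ContinuousMultilinearMap.norm_compContinuousLinearMap_le _ _).trans ?_
    rw [← (hFm.contDiffAt).restrictScalars_iteratedFDeriv (𝕜 := ℝ), Function.comp_apply,
      ContinuousMultilinearMap.norm_restrictScalars]
    simp only [Finset.prod_const, Finset.card_univ, Fintype.card_fin]
    exact mul_le_of_le_one_right (norm_nonneg _) (pow_le_one₀ (norm_nonneg _) norm_complexify_le)
  have h2 : ‖iteratedFDeriv ℂ m F (complexify ι x)‖ ≤
      M * Real.exp (-a * ‖x‖) * (h ^ m * m.factorial) := by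
    rcases Nat.eq_zero_or_pos m with rfl | hm
    · simpa using hM x (complexify ι x) (by simpa using ha.le)
    have hm' : (0 : ℝ) < m := by exact_mod_cast hm
    -- The m steps of length a/m use up the width a of the tube. The resulting (m/a)^m is at most
    -- (e/a)^m m!, and e ≤ a h bounds this by h^m m!.
    refine (norm_iteratedFDeriv_le_of_forall_mem_closedBall hF (r := a / m) (by positivity) m
      (complexify ι x) (M := M * Real.exp (-a * ‖x‖)) fun ζ hζ => hM x ζ ?_).trans ?_
    · rw [mem_closedBall_iff_norm, mul_div_cancel₀ _ hm'.ne'] at hζ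
      exact hζ
    · rw [div_eq_mul_inv]
      refine mul_le_mul_of_nonneg_left ?_ (by positivity)
      rw [div_pow, inv_div, div_le_iff₀ (by positivity)]
      calc (m : ℝ) ^ m ≤ Real.exp 1 ^ m * m.factorial := pow_le_exp_mul_factorial m
        _ ≤ (a * h) ^ m * m.factorial := by gcongr
        _ = h ^ m * m.factorial * a ^ m := by rw [mul_pow]; ring
  have h3 : ‖x‖ ^ k * Real.exp (-a * ‖x‖) ≤ h ^ k * k.factorial := by
    have := Real.pow_div_factorial_le_exp (a * ‖x‖) (by positivity) k
    rw [div_le_iff₀ (by positivity), mul_pow] at this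
    have hah' : 1 ≤ (a * h) ^ k := one_le_pow₀ (by
      linarith [Real.add_one_le_exp (1 : ℝ)])
    rw [neg_mul, Real.exp_neg, ← div_eq_mul_inv, div_le_iff₀ (Real.exp_pos _)]
    have e : ‖x‖ ^ k ≤ h ^ k * (a ^ k * ‖x‖ ^ k) := by
      rw [← mul_assoc, mul_comm (h ^ k), ← mul_pow]
      exact le_mul_of_one_le_left (by positivity) hah'
    calc ‖x‖ ^ k ≤ h ^ k * (a ^ k * ‖x‖ ^ k) := e
      _ ≤ h ^ k * (Real.exp (a * ‖x‖) * k.factorial) := by gcongr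
      _ = _ := by ring
  rw [div_le_iff₀ (by positivity)]
  calc _ ≤ ‖x‖ ^ k * (M * Real.exp (-a * ‖x‖) * (h ^ m * m.factorial)) := by
        gcongr; exact h1.trans h2
    _ = M * (h ^ m * m.factorial) * (‖x‖ ^ k * Real.exp (-a * ‖x‖)) := by ring
    _ ≤ M * (h ^ m * m.factorial) * (h ^ k * k.factorial) := by gcongr
    _ = _ := by rw [pow_add]; ring

end Cauchy

/-! ### Gaussian wave packets as a continuous family in `Σ₁` -/

section Packet

variable {ι : Type*} [Fintype ι]

/-- The entire extension of a Gaussian wave packet. -/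
def packetExt (z : EuclideanSpace ℝ ι × EuclideanSpace ℝ ι) (ζ : EuclideanSpace ℂ ι) : ℂ :=
  ((Real.pi ^ (-(Fintype.card ι : ℝ) / 4) : ℝ) : ℂ) *
    Complex.exp (∑ j, (-(ζ j - z.1 j) ^ 2 / 2 - Complex.I * (ζ j * z.2 j)))

theorem gaussianPacket_apply (x ξ y : EuclideanSpace ℝ ι) :
    gaussianPacket x ξ y =
      (gaussianWindow (y - x) : ℂ) * Complex.exp (-Complex.I * (inner ℝ y ξ : ℝ)) := rfl

theorem packetExt_complexify (z : EuclideanSpace ℝ ι × EuclideanSpace ℝ ι)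
    (y : EuclideanSpace ℝ ι) : packetExt z (complexify ι y) = gaussianPacket z.1 z.2 y := by
  rw [gaussianPacket_apply, packetExt, gaussianWindow, Complex.ofReal_mul, mul_assoc,
    Complex.ofReal_exp, ← Complex.exp_add, EuclideanSpace.norm_sq_eq]
  congr 2
  simp only [PiLp.inner_apply, complexify_apply, Finset.sum_sub_distrib]
  push_cast
  rw [← Finset.mul_sum, neg_mul, sub_eq_add_neg, ← Finset.sum_neg_distrib, Finset.sum_div]
  congr 1
  · refine Finset.sum_congr rfl fun j _ => ?_
    rw [← Complex.ofReal_pow, Real.norm_eq_abs, sq_abs]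
    simp
  · congr 2
    refine Finset.sum_congr rfl fun j _ => ?_
    simp [mul_comm]

theorem contDiff_packetExt (z : EuclideanSpace ℝ ι × EuclideanSpace ℝ ι) :
    ContDiff ℂ ∞ (packetExt z) := by
  have : ∀ j : ι, ContDiff ℂ ∞ fun ζ : EuclideanSpace ℂ ι => ζ j := fun j =>
    (EuclideanSpace.proj (𝕜 := ℂ) j).contDiff
  unfold packetExt
  fun_prop

theorem continuous_packetExt :
    Continuous fun p : (EuclideanSpace ℝ ι × EuclideanSpace ℝ ι) × EuclideanSpace ℂ ι =>
      packetExt p.1 p.2 := by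
  unfold packetExt
  fun_prop

/-- For ζ = p + iq and z = (x, ξ), the real part of the exponent is -|p - x|²/2 + |q|²/2 + ⟨q, ξ⟩.
On the tube |q| ≤ a and |y| ≤ a + ‖z‖ + |p - x|, while -|p - x|²/2 ≤ b²/2 - b|p - x|. So the
Gaussian supplies decay exp(-b|y|) of any rate b, at the price of exponential growth in ‖z‖. -/
theorem norm_packetExt_le {a b : ℝ} (hb : 0 ≤ b)
    (z : EuclideanSpace ℝ ι × EuclideanSpace ℝ ι) (y : EuclideanSpace ℝ ι)
    (ζ : EuclideanSpace ℂ ι) (hζ : ‖ζ - complexify ι y‖ ≤ a) :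
    ‖packetExt z ζ‖ ≤ Real.pi ^ (-(Fintype.card ι : ℝ) / 4) *
      Real.exp (a * b + (a ^ 2 + b ^ 2) / 2 + (a + b) * ‖z‖) * Real.exp (-b * ‖y‖) := by
  set p : EuclideanSpace ℝ ι := WithLp.toLp 2 fun j => (ζ j).re with hp
  set q : EuclideanSpace ℝ ι := WithLp.toLp 2 fun j => (ζ j).im with hq
  have ha : 0 ≤ a := (norm_nonneg _).trans hζ
  have h1 : ‖p - y‖ ≤ a := by
    refine le_trans ?_ hζ
    rw [EuclideanSpace.norm_eq, EuclideanSpace.norm_eq]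
    refine Real.sqrt_le_sqrt (Finset.sum_le_sum fun j _ => ?_)
    gcongr
    simpa [hp, complexify_apply] using Complex.abs_re_le_norm (ζ j - (y j : ℂ))
  have h2 : ‖q‖ ≤ a := by
    refine le_trans ?_ hζ
    rw [EuclideanSpace.norm_eq, EuclideanSpace.norm_eq]
    refine Real.sqrt_le_sqrt (Finset.sum_le_sum fun j _ => ?_)
    gcongr
    simpa [hq, complexify_apply] using Complex.abs_im_le_norm (ζ j - (y j : ℂ))
  have e : (∑ j, (-(ζ j - z.1 j) ^ 2 / 2 - Complex.I * (ζ j * z.2 j))).re =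
      -‖p - z.1‖ ^ 2 / 2 + ‖q‖ ^ 2 / 2 + inner ℝ q z.2 := by
    rw [Complex.re_sum, EuclideanSpace.norm_sq_eq, EuclideanSpace.norm_sq_eq, PiLp.inner_apply,
      ← Finset.sum_neg_distrib, Finset.sum_div, Finset.sum_div, ← Finset.sum_add_distrib,
      ← Finset.sum_add_distrib]
    refine Finset.sum_congr rfl fun j _ => ?_
    simp only [hp, hq, PiLp.sub_apply, Real.norm_eq_abs, sq_abs]
    simp [pow_two]
    ring
  rw [packetExt, norm_mul, Complex.norm_exp, e, mul_assoc, Complex.norm_real,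
    Real.norm_of_nonneg (by positivity), ← Real.exp_add]
  refine mul_le_mul_of_nonneg_left (Real.exp_le_exp.2 ?_) (by positivity)
  have h3 : inner ℝ q z.2 ≤ a * ‖z‖ :=
    (real_inner_le_norm _ _).trans (mul_le_mul h2 (norm_snd_le z) (norm_nonneg _) ha)
  have h4 : ‖y‖ ≤ a + ‖z‖ + ‖p - z.1‖ := by
    have : y = -(p - y) + z.1 + (p - z.1) := by abel
    calc ‖y‖ = ‖-(p - y) + z.1 + (p - z.1)‖ := by rw [← this]
      _ ≤ ‖-(p - y)‖ + ‖z.1‖ + ‖p - z.1‖ := norm_add₃_le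
      _ ≤ _ := by rw [norm_neg]; gcongr; exact norm_fst_le z
  have h5 : ‖q‖ ^ 2 ≤ a ^ 2 := by gcongr
  nlinarith [mul_le_mul_of_nonneg_left h4 hb, sq_nonneg (‖p - z.1‖ - b)]

theorem gsNorm_gaussianPacket_le (h : ℝ) (hh : 0 < h) : ∃ C a : ℝ, 0 ≤ C ∧ 0 ≤ a ∧
    ∀ z : EuclideanSpace ℝ ι × EuclideanSpace ℝ ι,
      GelfandShilov.gsNorm h (gaussianPacket z.1 z.2) ≤ C * Real.exp (a * ‖z‖) := by
  have ha : 0 < Real.exp 1 / h := by positivity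
  set a := Real.exp 1 / h with hadef
  refine ⟨Real.pi ^ (-(Fintype.card ι : ℝ) / 4) * Real.exp (a * a + (a ^ 2 + a ^ 2) / 2), a + a,
    by positivity, by positivity, fun z => GelfandShilov.gsNorm_le _ fun k m x => ?_⟩
  have e : ((gaussianPacket z.1 z.2 : GelfandShilov ι).1) =
    fun y => packetExt z (complexify ι y) := funext fun y => (packetExt_complexify z y).symm
  rw [e]
  refine gelfandShilov_bound_of_entire (contDiff_packetExt z) ha
    (le_of_eq (by rw [hadef]; field_simp)) (fun y ζ hζ => ?_) k m x
  refine (norm_packetExt_le ha.le z y ζ hζ).trans (le_of_eq ?_)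
  rw [Real.exp_add _ ((a + a) * ‖z‖)]
  ring

/-- The entire extensions are compared on the tube. For ‖y‖ ≤ R the point ζ stays in a compact set
and joint continuity suffices. For ‖y‖ > R the packets decay at rate a + 1, and the surplus
exp(-‖y‖) over the required rate a is small. -/
theorem gsNorm_gaussianPacket_sub_le (h : ℝ) (hh : 0 < h)
    (z₀ : EuclideanSpace ℝ ι × EuclideanSpace ℝ ι) (ε : ℝ) (hε : 0 < ε) :
    ∀ᶠ z in 𝓝 z₀, GelfandShilov.gsNorm h
      (gaussianPacket z.1 z.2 - gaussianPacket z₀.1 z₀.2) ≤ ε := by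
  have ha : 0 < Real.exp 1 / h := by positivity
  set a := Real.exp 1 / h with hadef
  set B : ℝ := Real.pi ^ (-(Fintype.card ι : ℝ) / 4) *
      Real.exp (a * (a + 1) + (a ^ 2 + (a + 1) ^ 2) / 2 + (a + (a + 1)) * (‖z₀‖ + 1)) with hB
  have hB0 : 0 < B := by positivity
  obtain ⟨R, hR⟩ : ∃ R : ℝ, 2 * B * Real.exp (-R) ≤ ε := by
    have : Tendsto (fun R : ℝ => 2 * B * Real.exp (-R)) atTop (𝓝 (2 * B * 0)) :=
      (Real.tendsto_exp_neg_atTop_nhds_zero).const_mul _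
    rw [mul_zero] at this
    exact ((this.eventually (gt_mem_nhds hε)).mono fun _ => le_of_lt).exists
  have hcpt : IsCompact (Metric.closedBall (0 : EuclideanSpace ℂ ι) (R + a)) :=
    isCompact_closedBall _ _
  -- The tolerance ε exp(-aR) is below the target ε exp(-a‖y‖) as long as ‖y‖ ≤ R.
  obtain ⟨v, hv, hvK⟩ := hcpt.mem_uniformity_of_prod (f := packetExt (ι := ι)) (s := univ)
    (q := z₀) continuous_packetExt.continuousOn (mem_univ _)
    (Metric.dist_mem_uniformity (show 0 < ε * Real.exp (-a * R) by positivity))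
  rw [nhdsWithin_univ] at hv
  filter_upwards [hv, Metric.ball_mem_nhds z₀ one_pos] with z hz hz1
  have hzn : ‖z‖ ≤ ‖z₀‖ + 1 := by
    rw [mem_ball_iff_norm] at hz1
    linarith [norm_le_norm_add_norm_sub' z z₀]
  refine GelfandShilov.gsNorm_le _ fun k m x => ?_
  have e : ((gaussianPacket z.1 z.2 - gaussianPacket z₀.1 z₀.2 : GelfandShilov ι).1) =
      fun y => (packetExt z - packetExt z₀) (complexify ι y) := by
    funext y
    rw [Pi.sub_apply, packetExt_complexify, packetExt_complexify]
    rfl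
  rw [e]
  refine gelfandShilov_bound_of_entire ((contDiff_packetExt z).sub (contDiff_packetExt z₀)) ha
    (le_of_eq (by rw [hadef]; field_simp)) (fun y ζ hζ => ?_) k m x
  rcases le_or_gt ‖y‖ R with hy | hy
  · have hζ' : ζ ∈ Metric.closedBall (0 : EuclideanSpace ℂ ι) (R + a) := by
      rw [mem_closedBall_zero_iff]
      have := norm_le_norm_add_norm_sub' ζ (complexify ι y)
      rw [norm_complexify] at this
      linarith
    have := hvK z hz ζ hζ'
    rw [mem_ofPred_eq, dist_eq_norm] at this
    exact this.le.trans (mul_le_mul_of_nonneg_left (Real.exp_le_exp.2 (by nlinarith)) hε.le)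
  · have hbd : ∀ w : EuclideanSpace ℝ ι × EuclideanSpace ℝ ι, ‖w‖ ≤ ‖z₀‖ + 1 →
        ‖packetExt w ζ‖ ≤ B * Real.exp (-(a + 1) * ‖y‖) := fun w hw => by
      refine (norm_packetExt_le (b := a + 1) (by positivity) w y ζ hζ).trans ?_
      rw [hB]
      gcongr
    calc ‖packetExt z ζ - packetExt z₀ ζ‖
        ≤ B * Real.exp (-(a + 1) * ‖y‖) + B * Real.exp (-(a + 1) * ‖y‖) :=
          (norm_sub_le _ _).trans (add_le_add (hbd z hzn) (hbd z₀ (by linarith)))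
      _ = 2 * B * Real.exp (-‖y‖) * Real.exp (-a * ‖y‖) := by
          rw [mul_assoc (2 * B), ← Real.exp_add]; ring_nf
      _ ≤ 2 * B * Real.exp (-R) * Real.exp (-a * ‖y‖) := by gcongr
      _ ≤ ε * Real.exp (-a * ‖y‖) := by gcongr

/-- This gives continuity, hence measurability, of every short-time Fourier transform, and makes
packets admissible integrands in Σ₁. -/
theorem continuous_gaussianPacket :
    Continuous fun z : EuclideanSpace ℝ ι × EuclideanSpace ℝ ι =>
      (gaussianPacket z.1 z.2 : GelfandShilov ι) := by
  rw [continuous_iff_continuousAt]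
  intro z₀
  rw [ContinuousAt, GelfandShilov.withSeminorms.tendsto_nhds]
  intro h ε hε
  filter_upwards [gsNorm_gaussianPacket_sub_le h.1 h.2 z₀ (ε / 2) (by positivity)] with z hz
  exact lt_of_le_of_lt hz (by linarith)

theorem continuous_stft (u : GSDistribution ι) : Continuous (stft u) :=
  (u.continuous.comp continuous_gaussianPacket).const_mul _

end Packet

end OrliczModulation

end

noncomputable section

namespace OrliczModulation

open MeasureTheory Set Filter Topology
open scoped ENNReal NNReal ContDiff

/-! ### Integrals of families in `Σ₁` -/

namespace GelfandShilov

variable {ι : Type*} [Fintype ι]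

theorem gsNorm_nonneg (h : {h : ℝ // 0 < h}) (f : GelfandShilov ι) : 0 ≤ gsNorm h.1 f :=
  apply_nonneg (gsSeminorm h) f

theorem gsNorm_anti {h h' : ℝ} (hh : 0 < h) (hhh' : h ≤ h') (f : GelfandShilov ι) :
    gsNorm h' f ≤ gsNorm h f :=
  gsNorm_le f fun k m x => le_trans (by gcongr) (le_gsNorm hh f k m x)

theorem continuous_gsNorm (h : ℝ) (hh : 0 < h) : Continuous (gsNorm h : GelfandShilov ι → ℝ) :=
  withSeminorms.continuous_seminorm (⟨h, hh⟩ : {h : ℝ // 0 < h})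

theorem norm_iteratedFDeriv_le (f : GelfandShilov ι) (m : ℕ) (x : EuclideanSpace ℝ ι) :
    ‖iteratedFDeriv ℝ m f x‖ ≤ m.factorial * gsNorm 1 f := by
  have := le_gsNorm one_pos f 0 m x
  rw [div_le_iff₀ (by positivity)] at this
  simpa [mul_comm] using this

/-- The map `f ↦ D^m f(x)` on `Σ₁`. -/
def iteratedFDerivAt (m : ℕ) (x : EuclideanSpace ℝ ι) :
    GelfandShilov ι →ₗ[ℂ] (EuclideanSpace ℝ ι [×m]→L[ℝ] ℂ) where
  toFun f := iteratedFDeriv ℝ m f x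
  map_add' f g := by
    rw [coe_add, iteratedFDeriv_add_apply (f.contDiffAt m x) (g.contDiffAt m x)]
  map_smul' c f := by
    rw [coe_smul, iteratedFDeriv_const_smul_apply (f.contDiffAt m x), RingHom.id_apply]

theorem iteratedFDerivAt_apply (m : ℕ) (x : EuclideanSpace ℝ ι) (f : GelfandShilov ι) :
    iteratedFDerivAt m x f = iteratedFDeriv ℝ m f x := rfl

theorem continuous_iteratedFDerivAt (m : ℕ) (x : EuclideanSpace ℝ ι) :
    Continuous (iteratedFDerivAt m x : GelfandShilov ι → _) := by
  refine withSeminorms.continuous_normedSpace_rng _ (iteratedFDerivAt m x) ?_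
  refine ⟨{⟨1, one_pos⟩}, m.factorial, fun f => ?_⟩
  simp only [Finset.sup_singleton]
  exact (norm_iteratedFDeriv_le f m x).trans (le_of_eq (by rfl))

/-- The norms increase as h decreases, so the finitely many norms that control a continuous form are
dominated by the one with the smallest h. -/
theorem exists_le_gsNorm (u : GSDistribution ι) : ∃ h : ℝ, 0 < h ∧ ∃ C : ℝ, 0 ≤ C ∧
    ∀ f, ‖u f‖ ≤ C * gsNorm h f := by
  obtain ⟨s, C, -, hC⟩ := Seminorm.bound_of_continuous withSeminorms
    ((normSeminorm ℂ ℂ).comp u.toLinearMap) (continuous_norm.comp u.continuous)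
  obtain ⟨h, hh, hs⟩ : ∃ h : ℝ, 0 < h ∧ ∀ i ∈ s, h ≤ i.1 := by
    clear hC
    induction s using Finset.induction_on with
    | empty => exact ⟨1, one_pos, by simp⟩
    | insert i s _ ih =>
      obtain ⟨h, hh, hs⟩ := ih
      refine ⟨min h i.1, lt_min hh i.2, fun j hj => ?_⟩
      rcases Finset.mem_insert.1 hj with rfl | hj
      · exact min_le_right _ _
      · exact (min_le_left _ _).trans (hs j hj)
  refine ⟨h, hh, C, C.2, fun f => (hC f).trans ?_⟩
  change (C : ℝ) * (s.sup (gsFamily ι)) f ≤ _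
  refine mul_le_mul_of_nonneg_left ?_ C.2
  exact Seminorm.finset_sup_apply_le (gsNorm_nonneg ⟨h, hh⟩ f) fun i hi => gsNorm_anti hh (hs i hi) f

/-! ### Embeddings of Σ₁ in Banach spaces of jets -/

section Embedding

variable (ι) in
/-- The index `(k, m, x)` of the quantities `|x|^k D^m f(x)`. -/
abbrev JetIndex : Type _ := ℕ × ℕ × EuclideanSpace ℝ ι

/-- The factor `|x|^k / (h^(k+m) k! m!)`. -/
def jetWeight (h : ℝ) (p : JetIndex ι) : ℝ :=
  ‖p.2.2‖ ^ p.1 / (h ^ (p.1 + p.2.1) * (p.1.factorial * p.2.1.factorial))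

theorem norm_jetWeight_smul {h : ℝ} (hh : 0 < h) (p : JetIndex ι) (f : GelfandShilov ι) :
    ‖((jetWeight h p : ℝ) : ℂ) • iteratedFDerivAt p.2.1 p.2.2 f‖ =
      ‖p.2.2‖ ^ p.1 * ‖iteratedFDeriv ℝ p.2.1 f p.2.2‖ /
        (h ^ (p.1 + p.2.1) * (p.1.factorial * p.2.1.factorial)) := by
  rw [norm_smul, Complex.norm_real, Real.norm_of_nonneg (by unfold jetWeight; positivity),
    jetWeight, iteratedFDerivAt_apply]
  ring

/-- The isometric embedding `f ↦ (|x|^k D^m f(x) / (h^(k+m) k! m!))` of `Σ₁` with the norm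
`gsNorm h` in a space of bounded families. -/
def jet (h : ℝ) (hh : 0 < h) : GelfandShilov ι →ₗ[ℂ]
    lp (fun p : JetIndex ι => EuclideanSpace ℝ ι [×p.2.1]→L[ℝ] ℂ) ∞ where
  toFun f := ⟨fun p => ((jetWeight h p : ℝ) : ℂ) • iteratedFDerivAt p.2.1 p.2.2 f, by
    refine memℓp_infty_iff.2 ⟨gsNorm h f, ?_⟩
    rintro _ ⟨p, rfl⟩
    simp only [norm_jetWeight_smul hh]
    exact le_gsNorm hh f _ _ _⟩
  map_add' f g := Subtype.ext <| funext fun p =>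
    (congrArg (((jetWeight h p : ℝ) : ℂ) • ·) (map_add (iteratedFDerivAt p.2.1 p.2.2) f g)).trans
      (smul_add _ _ _)
  map_smul' c f := Subtype.ext <| funext fun p =>
    (congrArg (((jetWeight h p : ℝ) : ℂ) • ·) (map_smul (iteratedFDerivAt p.2.1 p.2.2) c f)).trans
      (smul_comm _ _ _)

theorem norm_jet (h : ℝ) (hh : 0 < h) (f : GelfandShilov ι) : ‖jet h hh f‖ = gsNorm h f := by
  rw [lp.norm_eq_ciSup, gsNorm]
  exact iSup_congr fun p => norm_jetWeight_smul hh p f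

theorem jet_injective (h : ℝ) (hh : 0 < h) : Function.Injective (jet (ι := ι) h hh) := by
  rw [← LinearMap.ker_eq_bot, LinearMap.ker_eq_bot']
  intro f hf
  have hn : gsNorm h f = 0 := by rw [← norm_jet h hh, hf, norm_zero]
  refine Subtype.ext (funext fun x => ?_)
  have := le_gsNorm hh f 0 0 x
  simp only [hn, pow_zero, norm_iteratedFDeriv_zero, one_mul, Nat.factorial_zero, Nat.cast_one,
    mul_one, div_one, add_zero] at this
  exact norm_le_zero_iff.1 this

theorem continuous_jet (h : ℝ) (hh : 0 < h) : Continuous (jet (ι := ι) h hh) := by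
  refine withSeminorms.continuous_normedSpace_rng
    (lp (fun p : JetIndex ι => EuclideanSpace ℝ ι [×p.2.1]→L[ℝ] ℂ) ∞) (𝕝₂ := ℂ) (jet h hh) ?_
  refine ⟨{⟨h, hh⟩}, 1, fun f => ?_⟩
  simp only [Finset.sup_singleton, one_smul]
  exact (norm_jet h hh f).le

/-- Every distribution factors through some embedding `jet h`. -/
theorem exists_factor_jet (u : GSDistribution ι) : ∃ (h : ℝ) (hh : 0 < h)
    (w : lp (fun p : JetIndex ι => EuclideanSpace ℝ ι [×p.2.1]→L[ℝ] ℂ) ∞ →L[ℂ] ℂ),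
    ∀ f, w (jet h hh f) = u f := by
  obtain ⟨h, hh, C, hC0, hC⟩ := exists_le_gsNorm u
  let e := LinearEquiv.ofInjective (jet (ι := ι) h hh) (jet_injective h hh)
  let v : LinearMap.range (jet (ι := ι) h hh) →L[ℂ] ℂ :=
    LinearMap.mkContinuous (u.toLinearMap ∘ₗ e.symm.toLinearMap) C fun x => by
      obtain ⟨f, rfl⟩ := e.surjective x
      have : ‖e f‖ = gsNorm h f := norm_jet h hh f
      simpa [this] using hC f
  -- Hahn–Banach: u is bounded on the range of the isometric embedding, and extends to the whole
  -- Banach space, where Bochner integrals commute with it.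
  obtain ⟨w, hw, -⟩ := exists_extension_norm_eq _ v
  refine ⟨h, hh, w, fun f => ?_⟩
  have := hw (e f)
  have e2 : v (e f) = u f := by simp [v]
  rw [e2] at this
  exact this

end Embedding

/-! ### Integration of families with values in Σ₁ -/

section Integral

variable {Z : Type*} [TopologicalSpace Z] [SecondCountableTopology Z] [MeasurableSpace Z]
  [OpensMeasurableSpace Z] {μ : Measure Z} {F : Z → GelfandShilov ι}

theorem integrable_iteratedFDeriv (hF : Continuous F)
    (hint : Integrable (fun z => gsNorm 1 (F z)) μ) (m : ℕ) (x : EuclideanSpace ℝ ι) :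
    Integrable (fun z => iteratedFDeriv ℝ m (F z) x) μ :=
  (hint.const_mul (m.factorial : ℝ)).mono'
    ((continuous_iteratedFDerivAt m x).comp hF).aestronglyMeasurable
    (Eventually.of_forall fun z => norm_iteratedFDeriv_le (F z) m x)

/-- Differentiation under the integral: the derivative of order m + 1 of F z is dominated, uniformly
in the base point, by (m + 1)! times the integrable function `gsNorm 1 (F z)`. -/
theorem hasFDerivAt_integral_iteratedFDeriv (hF : Continuous F)
    (hint : Integrable (fun z => gsNorm 1 (F z)) μ) (m : ℕ) (x : EuclideanSpace ℝ ι) :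
    HasFDerivAt (fun x => ∫ z, iteratedFDeriv ℝ m (F z) x ∂μ)
      (∫ z, fderiv ℝ (iteratedFDeriv ℝ m (F z)) x ∂μ) x := by
  have e : ∀ z, fderiv ℝ (iteratedFDeriv ℝ m (F z)) x =
      (continuousMultilinearCurryLeftEquiv ℝ (fun _ : Fin (m + 1) => EuclideanSpace ℝ ι) ℂ)
        (iteratedFDeriv ℝ (m + 1) (F z) x) := fun z => by
    rw [fderiv_iteratedFDeriv]; rfl
  refine hasFDerivAt_integral_of_dominated_of_fderiv_le (s := univ)
    (F' := fun x z => fderiv ℝ (iteratedFDeriv ℝ m (F z)) x)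
    (bound := fun z => (m + 1).factorial * gsNorm 1 (F z)) univ_mem
    (Eventually.of_forall fun y => (integrable_iteratedFDeriv hF hint m y).1)
    (integrable_iteratedFDeriv hF hint m x) ?_ (Eventually.of_forall fun z y _ => ?_)
    (hint.const_mul _) (Eventually.of_forall fun z y _ => ?_)
  · simp only [e]
    exact (LinearIsometryEquiv.continuous _).comp_aestronglyMeasurable
      (integrable_iteratedFDeriv hF hint (m + 1) x).1
  · rw [norm_fderiv_iteratedFDeriv]
    exact norm_iteratedFDeriv_le (F z) (m + 1) y
  · exact (((F z).contDiff.differentiable_iteratedFDeriv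
      (mod_cast ENat.natCast_lt_top m)) y).hasFDerivAt

theorem iteratedFDeriv_integral (hF : Continuous F)
    (hint : Integrable (fun z => gsNorm 1 (F z)) μ) (m : ℕ) :
    iteratedFDeriv ℝ m (fun x => ∫ z, F z x ∂μ) =
      fun x => ∫ z, iteratedFDeriv ℝ m (F z) x ∂μ := by
  induction m with
  | zero =>
    funext x
    have := ((continuousMultilinearCurryFin0 ℝ (EuclideanSpace ℝ ι) ℂ).symm
      |>.toContinuousLinearEquiv).integral_comp_comm (μ := μ) (fun z => F z x)
    rw [iteratedFDeriv_zero_eq_comp, Function.comp_apply]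
    exact this.symm
  | succ m ih =>
    funext x
    have := ((continuousMultilinearCurryLeftEquiv ℝ (fun _ : Fin (m + 1) => EuclideanSpace ℝ ι) ℂ
      ).symm.toContinuousLinearEquiv).integral_comp_comm (𝕜 := ℝ) (μ := μ)
        (fun z => fderiv ℝ (iteratedFDeriv ℝ m (F z)) x)
    rw [iteratedFDeriv_succ_eq_comp_left, Function.comp_apply, ih,
      (hasFDerivAt_integral_iteratedFDeriv hF hint m x).fderiv]
    exact this.symm

/-- A continuous family in `Σ₁` that is integrable with respect to every norm `gsNorm h` has an
integral in `Σ₁`, and distributions may be applied under the integral sign. -/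
theorem exists_integral (hF : Continuous F)
    (hint : ∀ h : ℝ, 0 < h → Integrable (fun z => gsNorm h (F z)) μ) :
    ∃ f : GelfandShilov ι, (∀ x, f x = ∫ z, F z x ∂μ) ∧
      ∀ u : GSDistribution ι, u f = ∫ z, u (F z) ∂μ := by
  have h1 := hint 1 one_pos
  have hder := iteratedFDeriv_integral hF h1
  have hmem : IsGelfandShilov fun x => ∫ z, F z x ∂μ := by
    refine ⟨contDiff_of_differentiable_iteratedFDeriv fun m _ => ?_, fun h hh =>
      ⟨∫ z, gsNorm h (F z) ∂μ, fun k m x => ?_⟩⟩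
    · rw [hder]
      exact fun x => (hasFDerivAt_integral_iteratedFDeriv hF h1 m x).differentiableAt
    · rw [hder, mul_div_right_comm]
      refine (mul_le_mul_of_nonneg_left (norm_integral_le_integral_norm _)
        (by positivity)).trans ?_
      rw [← integral_const_mul]
      refine integral_mono ((integrable_iteratedFDeriv hF h1 m x).norm.const_mul _) (hint h hh)
        fun z => ?_
      refine le_trans (le_of_eq ?_) (le_gsNorm hh (F z) k m x)
      dsimp only
      ring
  obtain ⟨f, hf⟩ : ∃ f : GelfandShilov ι, f.1 = fun x => ∫ z, F z x ∂μ := ⟨⟨_, hmem⟩, rfl⟩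
  refine ⟨f, congr_fun hf, fun u => ?_⟩
  obtain ⟨h, hh, w, hw⟩ := exists_factor_jet u
  -- The target space need not be separable; strong measurability comes from continuity on the
  -- second countable space `Z`.
  have hJ : Integrable (fun z => jet h hh (F z)) μ :=
    (hint h hh).mono' ((continuous_jet h hh).comp hF).aestronglyMeasurable
      (Eventually.of_forall fun z => (norm_jet h hh (F z)).le)
  -- Evaluations at indices are continuous and separate bounded families, so the Bochner integral
  -- can be identified one derivative at a time.
  have e : jet h hh f = ∫ z, jet h hh (F z) ∂μ := by
    ext p : 2
    have := (lp.evalCLM ℂ (fun p : JetIndex ι => EuclideanSpace ℝ ι [×p.2.1]→L[ℝ] ℂ) ∞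
      p).integral_comp_comm hJ
    change _ = (lp.evalCLM ℂ (fun p : JetIndex ι => EuclideanSpace ℝ ι [×p.2.1]→L[ℝ] ℂ) ∞ p) _
    rw [← this]
    change ((jetWeight h p : ℝ) : ℂ) • iteratedFDeriv ℝ p.2.1 f.1 p.2.2 =
      ∫ z, ((jetWeight h p : ℝ) : ℂ) • iteratedFDeriv ℝ p.2.1 (F z) p.2.2 ∂μ
    rw [hf, hder, integral_smul]
  rw [← hw, e, ← w.integral_comp_comm hJ]
  simp only [hw]

end Integral

end GelfandShilov

end OrliczModulation

end

noncomputable section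

namespace OrliczModulation

open MeasureTheory Set Filter Topology
open scoped ENNReal NNReal ContDiff FourierTransform

/-! ### Decay of the short-time Fourier transform and the inversion formula -/

section Exponentials

/-- Divide the k-th bound by (2h)^k k! and sum over k: the left side becomes an exponential series,
the right side a geometric one. This is how factorial bounds become exponential decay. -/
theorem mul_exp_le_of_forall_pow_mul_le {t A N h : ℝ} (hh : 0 < h)
    (H : ∀ k : ℕ, t ^ k * A ≤ N * (h ^ k * k.factorial)) :
    A * Real.exp (t / (2 * h)) ≤ 2 * N := by
  have h1 : HasSum (fun k : ℕ => A * ((t / (2 * h)) ^ k / k.factorial))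
      (A * Real.exp (t / (2 * h))) := by
    rw [Real.exp_eq_exp_ℝ]
    exact (NormedSpace.expSeries_div_hasSum_exp (t / (2 * h))).mul_left A
  have h2 : HasSum (fun k : ℕ => N * (1 / 2 : ℝ) ^ k) (N * 2) := hasSum_geometric_two.mul_left N
  rw [mul_comm 2 N]
  refine hasSum_le (fun k => ?_) h1 h2
  have := H k
  rw [← mul_div_assoc, div_le_iff₀ (by positivity), div_pow, mul_pow, div_pow, one_pow]
  rw [← mul_div_assoc, div_le_iff₀ (by positivity)]
  calc A * t ^ k = t ^ k * A := mul_comm _ _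
    _ ≤ _ := this
    _ = _ := by field_simp

theorem integrable_exp_neg_mul_norm {V : Type*} [NormedAddCommGroup V] [NormedSpace ℝ V]
    [FiniteDimensional ℝ V] [MeasurableSpace V] [BorelSpace V] (μ : Measure V)
    [μ.IsAddHaarMeasure] {R : ℝ} (hR : 0 < R) : Integrable (fun x : V => Real.exp (-R * ‖x‖)) μ := by
  set n : ℕ := Module.finrank ℝ V + 1 with hn
  have h1 := integrable_one_add_norm (μ := μ) (r := (n : ℝ)) (E := V) (by rw [hn]; push_cast; linarith)
  refine (h1.const_mul (n.factorial * Real.exp R / R ^ n)).mono'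
    (by fun_prop) (Eventually.of_forall fun x => ?_)
  rw [Real.norm_of_nonneg (Real.exp_pos _).le, Real.rpow_neg (by positivity), Real.rpow_natCast]
  have := Real.pow_div_factorial_le_exp (R * (1 + ‖x‖)) (by positivity) n
  rw [div_le_iff₀ (by positivity), mul_pow, mul_add, Real.exp_add, mul_one] at this
  rw [neg_mul, Real.exp_neg, ← div_eq_mul_inv, div_div, inv_eq_one_div,
    div_le_div_iff₀ (Real.exp_pos _) (by positivity)]
  linarith

end Exponentials

section Decay

variable {ι : Type*} [Fintype ι]

instance : (volume : Measure (EuclideanSpace ℝ ι × EuclideanSpace ℝ ι)).IsAddHaarMeasure :=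
  inferInstanceAs ((volume : Measure (EuclideanSpace ℝ ι)).prod volume).IsAddHaarMeasure

theorem GelfandShilov.norm_iteratedFDeriv_le_exp {h : ℝ} (hh : 0 < h) (f : GelfandShilov ι) (m : ℕ)
    (y : EuclideanSpace ℝ ι) : ‖iteratedFDeriv ℝ m f y‖ ≤
      2 * gsNorm h f * (h ^ m * m.factorial) * Real.exp (-(‖y‖ / (2 * h))) := by
  have := mul_exp_le_of_forall_pow_mul_le (t := ‖y‖) (A := ‖iteratedFDeriv ℝ m f y‖)
    (N := gsNorm h f * (h ^ m * m.factorial)) hh fun k => by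
      have := le_gsNorm hh f k m y
      rw [div_le_iff₀ (by positivity)] at this
      refine this.trans (le_of_eq ?_)
      rw [pow_add]; ring
  rw [Real.exp_neg, ← div_eq_mul_inv, le_div_iff₀ (Real.exp_pos _)]
  linarith

theorem gaussianPacket_zero_apply (x y : EuclideanSpace ℝ ι) :
    gaussianPacket x 0 y = (gaussianWindow (y - x) : ℂ) := by
  simp [gaussianPacket_apply]

/-- The function `f φ(· - x)`, where `φ` is the Gaussian window. -/
def windowed (f : GelfandShilov ι) (x y : EuclideanSpace ℝ ι) : ℂ := f y * gaussianPacket x 0 y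

theorem contDiff_windowed (f : GelfandShilov ι) (x : EuclideanSpace ℝ ι) :
    ContDiff ℝ ∞ (windowed f x) := f.contDiff.mul (gaussianPacket x 0).contDiff

/-- In Leibniz' formula the binomial coefficients cancel against the factorials, leaving k + 1 equal
bounds. The factors decay like exp(-‖y‖/2h) and exp(-‖y - x‖/2h), and ‖x‖ ≤ ‖y‖ + ‖y - x‖
redistributes this decay between x and y at half the rate. -/
theorem norm_iteratedFDeriv_windowed_le {h : ℝ} (hh : 0 < h) (f : GelfandShilov ι) : ∃ N : ℝ,
    0 ≤ N ∧ ∀ (k : ℕ) (x y : EuclideanSpace ℝ ι), ‖iteratedFDeriv ℝ k (windowed f x) y‖ ≤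
      N * ((k + 1) * (h ^ k * k.factorial)) * Real.exp (-(1 / (4 * h)) * ‖x‖) *
        Real.exp (-(1 / (4 * h)) * ‖y‖) := by
  set A := GelfandShilov.gsNorm h f with hA
  set B := GelfandShilov.gsNorm h (gaussianPacket (0 : EuclideanSpace ℝ ι) 0) with hB
  have hA0 : 0 ≤ A := GelfandShilov.gsNorm_nonneg ⟨h, hh⟩ f
  have hB0 : 0 ≤ B := GelfandShilov.gsNorm_nonneg ⟨h, hh⟩ _
  refine ⟨2 * A * (2 * B), by positivity, fun k x y => ?_⟩
  refine (norm_iteratedFDeriv_mul_le (N := k) (f.contDiff.of_le (mod_cast le_top))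
    ((gaussianPacket x 0).contDiff.of_le (mod_cast le_top)) y le_rfl).trans ?_
  have hterm : ∀ j ∈ Finset.range (k + 1), (k.choose j : ℝ) * ‖iteratedFDeriv ℝ j f y‖ *
      ‖iteratedFDeriv ℝ (k - j) (gaussianPacket x 0 : GelfandShilov ι) y‖ ≤
      2 * A * (2 * B) * (h ^ k * k.factorial) *
        (Real.exp (-(1 / (4 * h)) * ‖x‖) * Real.exp (-(1 / (4 * h)) * ‖y‖)) := by
    intro j hj
    have hjk : j ≤ k := Nat.lt_succ_iff.1 (Finset.mem_range.1 hj)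
    have e : iteratedFDeriv ℝ (k - j) (gaussianPacket x 0 : GelfandShilov ι) y =
        iteratedFDeriv ℝ (k - j) (gaussianPacket (0 : EuclideanSpace ℝ ι) 0) (y - x) := by
      rw [← iteratedFDeriv_comp_sub]
      congr 1
      funext w
      rw [gaussianPacket_zero_apply, gaussianPacket_zero_apply, sub_zero]
    rw [e]
    have hexp : Real.exp (-(‖y‖ / (2 * h))) * Real.exp (-(‖y - x‖ / (2 * h))) ≤
        Real.exp (-(1 / (4 * h)) * ‖x‖) * Real.exp (-(1 / (4 * h)) * ‖y‖) := by
      rw [← Real.exp_add, ← Real.exp_add, Real.exp_le_exp]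
      have h1 : ‖x‖ ≤ ‖y‖ + ‖y - x‖ := by
        have := norm_sub_le y (y - x); rwa [sub_sub_cancel] at this
      have e1 : -(‖y‖ / (2 * h)) + -(‖y - x‖ / (2 * h)) =
        -(1 / (4 * h)) * (2 * ‖y‖ + 2 * ‖y - x‖) := by field_simp; ring
      rw [e1]
      have h2 : 0 ≤ 1 / (4 * h) := by positivity
      nlinarith [norm_nonneg (y - x)]
    calc _ ≤ (k.choose j : ℝ) * (2 * A * (h ^ j * j.factorial) * Real.exp (-(‖y‖ / (2 * h)))) *
          (2 * B * (h ^ (k - j) * (k - j).factorial) * Real.exp (-(‖y - x‖ / (2 * h)))) := by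
          gcongr
          · exact f.norm_iteratedFDeriv_le_exp hh j y
          · exact GelfandShilov.norm_iteratedFDeriv_le_exp hh _ (k - j) (y - x)
      _ = 2 * A * (2 * B) * (h ^ j * h ^ (k - j) *
          (k.choose j * j.factorial * (k - j).factorial : ℕ)) *
          (Real.exp (-(‖y‖ / (2 * h))) * Real.exp (-(‖y - x‖ / (2 * h)))) := by
          push_cast; ring
      _ ≤ _ := by
          rw [Nat.choose_mul_factorial_mul_factorial hjk, ← pow_add, Nat.add_sub_cancel' hjk]
          gcongr
  refine (Finset.sum_le_card_nsmul _ _ _ hterm).trans (le_of_eq ?_)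
  rw [Finset.card_range, nsmul_eq_mul]
  push_cast
  ring

theorem integrable_iteratedFDeriv_windowed (f : GelfandShilov ι) (k : ℕ)
    (x : EuclideanSpace ℝ ι) : Integrable (iteratedFDeriv ℝ k (windowed f x)) := by
  obtain ⟨N, -, hN⟩ := norm_iteratedFDeriv_windowed_le one_pos f
  refine ((integrable_exp_neg_mul_norm volume (R := 1 / (4 * 1)) (by norm_num)).const_mul
    (N * ((k + 1) * (1 ^ k * k.factorial)) * Real.exp (-(1 / (4 * 1)) * ‖x‖))).mono' ?_
    (Eventually.of_forall fun y => hN k x y)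
  exact ((contDiff_windowed f x).continuous_iteratedFDeriv
    (mod_cast le_top)).aestronglyMeasurable

theorem integrable_windowed (f : GelfandShilov ι) (x : EuclideanSpace ℝ ι) :
    Integrable (windowed f x) := by
  have := integrable_iteratedFDeriv_windowed f 0 x
  rw [iteratedFDeriv_zero_eq_comp] at this
  exact (LinearIsometryEquiv.integrable_comp_iff _).1 this

/-- Serves to replace all derivatives of order j ≤ n by the bound for order n. With i = n - j, it
combines h^(-i) ≤ exp(1/h) i! with i! j! ≤ n!. -/
theorem factorial_mul_pow_le {h : ℝ} (hh : 0 < h) {j n : ℕ} (hjn : j ≤ n) :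
    h ^ j * j.factorial ≤ Real.exp (1 / h) * (h ^ n * n.factorial) := by
  obtain ⟨i, rfl⟩ := Nat.exists_eq_add_of_le hjn
  have h1 := Real.pow_div_factorial_le_exp (1 / h) (by positivity) i
  rw [div_le_iff₀ (by positivity), div_pow, one_pow, div_le_iff₀ (by positivity)] at h1
  have h2 : ((i.factorial * j.factorial : ℕ) : ℝ) ≤ (j + i).factorial := by
    exact_mod_cast Nat.le_of_dvd (Nat.factorial_pos _)
      (by rw [mul_comm]; exact Nat.factorial_mul_factorial_dvd_factorial_add j i)
  push_cast at h2
  calc h ^ j * j.factorial = h ^ j * j.factorial * 1 := (mul_one _).symm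
    _ ≤ h ^ j * j.factorial * (Real.exp (1 / h) * i.factorial * h ^ i) := by gcongr
    _ = Real.exp (1 / h) * h ^ (j + i) * (i.factorial * j.factorial) := by rw [pow_add]; ring
    _ ≤ Real.exp (1 / h) * h ^ (j + i) * (j + i).factorial := by gcongr
    _ = _ := by ring

/-- Powers of w are traded for derivatives of the windowed function, whose L¹ norms have factorial
bounds and already carry the decay in x. The bounds for all powers sum up to exponential decay in w.
-/
theorem norm_fourier_windowed_le {h : ℝ} (hh : 0 < h) (f : GelfandShilov ι) : ∃ N : ℝ,
    0 ≤ N ∧ ∀ x w : EuclideanSpace ℝ ι, ‖𝓕 (windowed f x) w‖ ≤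
      N * Real.exp (-(1 / (4 * h)) * ‖x‖) * Real.exp (-(1 / (16 * h)) * ‖w‖) := by
  obtain ⟨N, hN0, hN⟩ := norm_iteratedFDeriv_windowed_le hh f
  set I : ℝ := ∫ y : EuclideanSpace ℝ ι, Real.exp (-(1 / (4 * h)) * ‖y‖) with hI
  have hI0 : 0 ≤ I := integral_nonneg fun y => (Real.exp_pos _).le
  have hexp := integrable_exp_neg_mul_norm (volume : Measure (EuclideanSpace ℝ ι))
    (R := 1 / (4 * h)) (by positivity)
  refine ⟨2 * (N * Real.exp (1 / h) * I), by positivity, fun x w => ?_⟩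
  have hint : ∀ j : ℕ, ∫ y, ‖iteratedFDeriv ℝ j (windowed f x) y‖ ≤
      N * ((j + 1) * (h ^ j * j.factorial)) * Real.exp (-(1 / (4 * h)) * ‖x‖) * I := fun j => by
    rw [hI, ← integral_const_mul]
    exact integral_mono (integrable_iteratedFDeriv_windowed f j x).norm (hexp.const_mul _)
      fun y => hN j x y
  have key : ∀ n : ℕ, ‖w‖ ^ n * ‖𝓕 (windowed f x) w‖ ≤
      N * Real.exp (1 / h) * I * Real.exp (-(1 / (4 * h)) * ‖x‖) *
        ((8 * h) ^ n * n.factorial) := by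
    intro n
    have := Real.pow_mul_norm_iteratedFDeriv_fourier_le (K := 0) (N := ⊤)
      (contDiff_windowed f x) (fun k n hk _ => by
        have hk0 : k = 0 := by simpa using hk
        subst hk0
        simpa using (integrable_iteratedFDeriv_windowed f n x).norm) (k := 0) (n := n) le_rfl
      le_top w
    rw [norm_iteratedFDeriv_zero] at this
    refine this.trans ?_
    rw [Finset.sum_product]
    simp only [zero_add, Finset.range_one, Finset.sum_singleton, pow_zero, one_mul, Nat.cast_zero,
      mul_zero]
    have hterm : ∀ j ∈ Finset.range (n + 1), ∫ y, ‖iteratedFDeriv ℝ j (windowed f x) y‖ ≤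
        N * Real.exp (1 / h) * I * Real.exp (-(1 / (4 * h)) * ‖x‖) *
          ((n + 1) * (h ^ n * n.factorial)) := by
      intro j hj
      have hjn : j ≤ n := Nat.lt_succ_iff.1 (Finset.mem_range.1 hj)
      refine (hint j).trans ?_
      calc _ ≤ N * ((n + 1) * (Real.exp (1 / h) * (h ^ n * n.factorial))) *
            Real.exp (-(1 / (4 * h)) * ‖x‖) * I := by
            gcongr N * (?_ * ?_) * _ * _
            · gcongr
            · exact factorial_mul_pow_le hh hjn
        _ = _ := by ring
    -- Three factors 2^n turn h into 8h: one from the Fourier estimate, one from the n + 1 summands,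
    -- and one from the factor n + 1 of the Leibniz bound.
    have hn2 : ((n + 1 : ℕ) : ℝ) ≤ 2 ^ n := by exact_mod_cast Nat.lt_two_pow_self
    calc _ ≤ (2 : ℝ) ^ n * ((n + 1 : ℕ) • (N * Real.exp (1 / h) * I *
          Real.exp (-(1 / (4 * h)) * ‖x‖) * ((n + 1) * (h ^ n * n.factorial)))) := by
          have := Finset.sum_le_card_nsmul _ _ _ hterm
          rw [Finset.card_range] at this
          gcongr
      _ = (2 : ℝ) ^ n * ((n + 1 : ℕ) : ℝ) * ((n + 1 : ℕ) : ℝ) * (N * Real.exp (1 / h) * I *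
          Real.exp (-(1 / (4 * h)) * ‖x‖) * (h ^ n * n.factorial)) := by
          rw [nsmul_eq_mul]; push_cast; ring
      _ ≤ (2 : ℝ) ^ n * 2 ^ n * 2 ^ n * (N * Real.exp (1 / h) * I *
          Real.exp (-(1 / (4 * h)) * ‖x‖) * (h ^ n * n.factorial)) := by gcongr
      _ = _ := by
          rw [mul_pow, show (8 : ℝ) = 2 * 2 * 2 by norm_num, mul_pow, mul_pow]; ring
  have := mul_exp_le_of_forall_pow_mul_le (by positivity : 0 < 8 * h) key
  rw [show ‖w‖ / (2 * (8 * h)) = 1 / (16 * h) * ‖w‖ by field_simp; ring] at this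
  rw [neg_mul (1 / (16 * h)), Real.exp_neg, ← div_eq_mul_inv, le_div_iff₀ (Real.exp_pos _)]
  linarith

variable (ι) in
/-- The normalizing factor `(2π)^(-n/2)`. -/
def stftConst : ℝ := (2 * Real.pi) ^ (-(Fintype.card ι : ℝ) / 2)

theorem stftConst_pos : 0 < stftConst ι := by unfold stftConst; positivity

theorem stft_eq (u : GSDistribution ι) (z : EuclideanSpace ℝ ι × EuclideanSpace ℝ ι) :
    stft u z = (stftConst ι : ℂ) * u (gaussianPacket z.1 z.2) := rfl

/-- The dilation by (2π)⁻¹ reconciles the phase ⟨y, ξ⟩ used here with the phase 2π⟨y, w⟩ in the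
definition of `𝓕`. -/
theorem stft_ofGS (f : GelfandShilov ι) (z : EuclideanSpace ℝ ι × EuclideanSpace ℝ ι) :
    stft (GSDistribution.ofGS f) z =
      stftConst ι * 𝓕 (windowed f z.1) ((2 * Real.pi)⁻¹ • z.2) := by
  rw [stft_eq, GSDistribution.ofGS_apply, Real.fourier_eq']
  congr 2
  funext y
  rw [windowed, gaussianPacket_apply, gaussianPacket_zero_apply, smul_eq_mul, inner_smul_right]
  have : ((-2 * Real.pi * ((2 * Real.pi)⁻¹ * inner ℝ y z.2) : ℝ) : ℂ) * Complex.I =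
      -Complex.I * (inner ℝ y z.2 : ℝ) := by
    rw [show -2 * Real.pi * ((2 * Real.pi)⁻¹ * inner ℝ y z.2) = -inner ℝ y z.2 by
      have := Real.pi_pos; field_simp]
    push_cast; ring
  rw [this]
  ring

theorem norm_stft_ofGS_le (f : GelfandShilov ι) (R : ℝ) : ∃ C : ℝ, 0 ≤ C ∧
    ∀ z, ‖stft (GSDistribution.ofGS f) z‖ ≤ C * Real.exp (-R * ‖z‖) := by
  wlog hR : 0 < R generalizing R
  · obtain ⟨C, hC0, hC⟩ := this 1 one_pos
    refine ⟨C, hC0, fun z => (hC z).trans ?_⟩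
    gcongr
    linarith
  have hpi := Real.pi_gt_three
  -- Chosen so that the decay rate 1/(16h) in the frequency variable, after the dilation by (2π)⁻¹,
  -- is exactly R.
  set h : ℝ := 1 / (32 * Real.pi * R) with hh
  have hh0 : 0 < h := by positivity
  obtain ⟨N, hN0, hN⟩ := norm_fourier_windowed_le hh0 f
  refine ⟨stftConst ι * N, mul_nonneg stftConst_pos.le hN0, fun z => ?_⟩
  rw [stft_ofGS, norm_mul, Complex.norm_real, Real.norm_of_nonneg stftConst_pos.le, mul_assoc]
  refine mul_le_mul_of_nonneg_left ((hN _ _).trans ?_) stftConst_pos.le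
  rw [mul_assoc, ← Real.exp_add]
  refine mul_le_mul_of_nonneg_left (Real.exp_le_exp.2 ?_) hN0
  rw [norm_smul, Real.norm_of_nonneg (by positivity)]
  have e1 : 1 / (4 * h) = 8 * Real.pi * R := by rw [hh]; field_simp; norm_num
  have e2 : 1 / (16 * h) * ((2 * Real.pi)⁻¹ * ‖z.2‖) = R * ‖z.2‖ := by
    rw [hh]; field_simp; norm_num
  rw [neg_mul, neg_mul, e2, e1, Prod.norm_def]
  have h1 : R * ‖z.1‖ ≤ 8 * Real.pi * R * ‖z.1‖ := by
    refine mul_le_mul_of_nonneg_right ?_ (norm_nonneg _)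
    nlinarith
  rcases max_cases ‖z.1‖ ‖z.2‖ with ⟨e, -⟩ | ⟨e, -⟩ <;> rw [e]
  · nlinarith [norm_nonneg z.2]
  · nlinarith [norm_nonneg z.1]

/-! ### The inversion formula -/

theorem integral_gaussianWindow_sq (y : EuclideanSpace ℝ ι) :
    ∫ x, gaussianWindow (y - x) ^ 2 = 1 := by
  rw [integral_sub_left_eq_self (fun x : EuclideanSpace ℝ ι => gaussianWindow x ^ 2)]
  have e : (fun x : EuclideanSpace ℝ ι => gaussianWindow x ^ 2) = fun x =>
      (Real.pi ^ (-(Fintype.card ι : ℝ) / 4)) ^ 2 * Real.exp (-1 * ‖x‖ ^ 2) := by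
    funext x
    rw [gaussianWindow, mul_pow, ← Real.exp_nat_mul]
    congr 2
    push_cast; ring
  rw [e, integral_const_mul, GaussianFourier.integral_rexp_neg_mul_sq_norm one_pos, div_one,
    ← Real.rpow_natCast, ← Real.rpow_mul Real.pi_pos.le, ← Real.rpow_add Real.pi_pos,
    finrank_euclideanSpace]
  rw [show -(Fintype.card ι : ℝ) / 4 * (2 : ℕ) + (Fintype.card ι : ℝ) / 2 = 0 by push_cast; ring,
    Real.rpow_zero]

theorem integrable_stft_ofGS_snd (f : GelfandShilov ι) (x : EuclideanSpace ℝ ι) :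
    Integrable fun ξ => stft (GSDistribution.ofGS f) (x, ξ) := by
  obtain ⟨C, hC0, hC⟩ := norm_stft_ofGS_le f 1
  refine ((integrable_exp_neg_mul_norm volume one_pos).const_mul C).mono'
    ((continuous_stft _).comp (Continuous.prodMk_right x)).aestronglyMeasurable
    (Eventually.of_forall fun ξ => (hC _).trans ?_)
  refine mul_le_mul_of_nonneg_left (Real.exp_le_exp.2 ?_) hC0
  have := norm_snd_le (x, ξ)
  linarith

/-- Fourier inversion in ξ for fixed x. The change of variables by 2π contributes (2π)^n, which the
two factors `stftConst` cancel. -/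
theorem windowed_eq_integral (f : GelfandShilov ι) (x y : EuclideanSpace ℝ ι) :
    windowed f x y = stftConst ι * ∫ ξ, stft (GSDistribution.ofGS f) (x, ξ) *
      Complex.exp (Complex.I * (inner ℝ y ξ : ℝ)) := by
  have hpi := Real.pi_pos
  have hc : (stftConst ι : ℂ) ≠ 0 := by exact_mod_cast stftConst_pos.ne'
  have hF : Integrable (𝓕 (windowed f x)) := by
    have h1 := (integrable_stft_ofGS_snd f x).const_mul (stftConst ι : ℂ)⁻¹
    simp only [stft_ofGS, inv_mul_cancel_left₀ hc] at h1
    have := h1.comp_smul (R := 2 * Real.pi) (by positivity)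
    simpa only [smul_smul, inv_mul_cancel₀ (show 2 * Real.pi ≠ 0 by positivity), one_smul] using this
  have hinv := congr_fun ((contDiff_windowed f x).continuous.fourierInv_fourier_eq
    (integrable_windowed f x) hF) y
  rw [← hinv, Real.fourierInv_eq']
  have hs := Measure.integral_comp_inv_smul (volume : Measure (EuclideanSpace ℝ ι))
    (fun v => Complex.exp (((2 * Real.pi * inner ℝ v y : ℝ) : ℂ) * Complex.I) •
      𝓕 (windowed f x) v) (2 * Real.pi)
  have e : ∀ ξ : EuclideanSpace ℝ ι, stft (GSDistribution.ofGS f) (x, ξ) *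
      Complex.exp (Complex.I * (inner ℝ y ξ : ℝ)) = stftConst ι *
      (Complex.exp (((2 * Real.pi * inner ℝ ((2 * Real.pi)⁻¹ • ξ) y : ℝ) : ℂ) * Complex.I) •
        𝓕 (windowed f x) ((2 * Real.pi)⁻¹ • ξ)) := fun ξ => by
    rw [stft_ofGS, inner_smul_left, conj_trivial, mul_inv_cancel_left₀ (by positivity),
      real_inner_comm, smul_eq_mul, mul_comm Complex.I]
    ring
  simp only [e]
  rw [integral_const_mul, hs, abs_of_pos (by positivity), finrank_euclideanSpace, Complex.real_smul,
    ← mul_assoc, ← mul_assoc]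
  have e3 : (stftConst ι : ℂ) * stftConst ι * (((2 * Real.pi) ^ Fintype.card ι : ℝ) : ℂ) = 1 := by
    rw [← Complex.ofReal_mul, ← Complex.ofReal_mul, ← Complex.ofReal_one, Complex.ofReal_inj,
      stftConst, ← Real.rpow_natCast, ← Real.rpow_add (by positivity),
      ← Real.rpow_add (by positivity), add_halves, neg_add_cancel, Real.rpow_zero]
  rw [e3, one_mul]

theorem GelfandShilov.gsNorm_smul {h : ℝ} (hh : 0 < h) (c : ℂ) (f : GelfandShilov ι) :
    gsNorm h (c • f) = ‖c‖ * gsNorm h f := map_smul_eq_mul (gsSeminorm ⟨h, hh⟩) c f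

theorem norm_reflect (z : EuclideanSpace ℝ ι × EuclideanSpace ℝ ι) : ‖(z.1, -z.2)‖ = ‖z‖ := by
  simp [Prod.norm_def]

/-- A distribution is bounded by a single norm, and in each norm the packets grow at most
exponentially. -/
theorem norm_stft_le (u : GSDistribution ι) : ∃ C a : ℝ, 0 ≤ C ∧ 0 ≤ a ∧
    ∀ z, ‖stft u z‖ ≤ C * Real.exp (a * ‖z‖) := by
  obtain ⟨h, hh, C, hC0, hC⟩ := GelfandShilov.exists_le_gsNorm u
  obtain ⟨D, a, hD0, ha, hD⟩ := gsNorm_gaussianPacket_le (ι := ι) h hh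
  refine ⟨stftConst ι * (C * D), a, mul_nonneg stftConst_pos.le (by positivity), ha, fun z => ?_⟩
  rw [stft_eq, norm_mul, Complex.norm_real, Real.norm_of_nonneg stftConst_pos.le, mul_assoc,
    mul_assoc]
  refine mul_le_mul_of_nonneg_left ((hC _).trans ?_) stftConst_pos.le
  exact mul_le_mul_of_nonneg_left (hD z) hC0

theorem continuous_reflect : Continuous fun z : EuclideanSpace ℝ ι × EuclideanSpace ℝ ι =>
    (z.1, -z.2) := by fun_prop

/-- A function of rapid exponential decay times a Gaussian wave packet is integrable in `Σ₁`. -/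
theorem integrable_gsNorm_smul_packet {G : EuclideanSpace ℝ ι × EuclideanSpace ℝ ι → ℂ}
    (hG : Continuous G) (hGR : ∀ R : ℝ, ∃ C : ℝ, 0 ≤ C ∧ ∀ z, ‖G z‖ ≤ C * Real.exp (-R * ‖z‖))
    (h : ℝ) (hh : 0 < h) :
    Integrable fun z => GelfandShilov.gsNorm h (G z • gaussianPacket z.1 (-z.2)) := by
  obtain ⟨D, a, hD0, ha, hD⟩ := gsNorm_gaussianPacket_le (ι := ι) h hh
  obtain ⟨C, hC0, hC⟩ := hGR (a + 1)
  refine ((integrable_exp_neg_mul_norm volume one_pos).const_mul (C * D)).mono' ?_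
    (Eventually.of_forall fun z => ?_)
  · exact ((GelfandShilov.continuous_gsNorm h hh).comp
      (hG.smul (continuous_gaussianPacket.comp continuous_reflect))).aestronglyMeasurable
  · rw [Real.norm_of_nonneg (GelfandShilov.gsNorm_nonneg ⟨h, hh⟩ _), GelfandShilov.gsNorm_smul hh]
    have h1 := hD (z.1, -z.2)
    rw [norm_reflect] at h1
    calc _ ≤ C * Real.exp (-(a + 1) * ‖z‖) * (D * Real.exp (a * ‖z‖)) :=
          mul_le_mul (hC z) h1 (GelfandShilov.gsNorm_nonneg ⟨h, hh⟩ _) (by positivity)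
      _ = C * D * (Real.exp (-(a + 1) * ‖z‖) * Real.exp (a * ‖z‖)) := by ring
      _ = _ := by rw [← Real.exp_add]; ring_nf

/-- Multiply the Fourier inversion of f φ(· - x) by φ(y - x) and integrate over x: the window has L²
norm one, so f(y) comes back. The frequency -ξ turns the phase of the packet into the phase of the
inverse transform. -/
theorem eq_integral_stft_mul_packet (f : GelfandShilov ι) (y : EuclideanSpace ℝ ι) :
    f y = ∫ z : EuclideanSpace ℝ ι × EuclideanSpace ℝ ι,
      stftConst ι * stft (GSDistribution.ofGS f) z * gaussianPacket z.1 (-z.2) y := by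
  have hint : Integrable fun z : EuclideanSpace ℝ ι × EuclideanSpace ℝ ι =>
      stftConst ι * stft (GSDistribution.ofGS f) z * gaussianPacket z.1 (-z.2) y := by
    have h1 := integrable_gsNorm_smul_packet
      (continuous_stft (GSDistribution.ofGS f)) (norm_stft_ofGS_le f) 1 one_pos
    refine (h1.const_mul (stftConst ι)).mono' ?_ (Eventually.of_forall fun z => ?_)
    · refine (Continuous.mul (continuous_const.mul (continuous_stft _)) ?_).aestronglyMeasurable
      simp only [gaussianPacket_apply, gaussianWindow]
      fun_prop
    · rw [mul_assoc, norm_mul, Complex.norm_real, Real.norm_of_nonneg stftConst_pos.le]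
      refine mul_le_mul_of_nonneg_left ?_ stftConst_pos.le
      have := GelfandShilov.norm_le_gsNorm_one
        (stft (GSDistribution.ofGS f) z • gaussianPacket z.1 (-z.2)) y
      rwa [GelfandShilov.coe_smul, Pi.smul_apply, smul_eq_mul] at this
  rw [Measure.volume_eq_prod, integral_prod _ hint]
  have e : ∀ x : EuclideanSpace ℝ ι, (∫ ξ, stftConst ι * stft (GSDistribution.ofGS f) (x, ξ) *
      gaussianPacket x (-ξ) y) = f y * ((gaussianWindow (y - x) ^ 2 : ℝ) : ℂ) := fun x => by
    have h1 := windowed_eq_integral f x y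
    rw [windowed, gaussianPacket_zero_apply] at h1
    have h2 : ∀ ξ, stftConst ι * stft (GSDistribution.ofGS f) (x, ξ) * gaussianPacket x (-ξ) y =
        (gaussianWindow (y - x) : ℂ) * stftConst ι * (stft (GSDistribution.ofGS f) (x, ξ) *
          Complex.exp (Complex.I * (inner ℝ y ξ : ℝ))) := fun ξ => by
      rw [gaussianPacket_apply, inner_neg_right, Complex.ofReal_neg, neg_mul_neg]
      ring
    simp only [h2]
    rw [integral_const_mul, mul_assoc, ← h1]
    push_cast; ring
  simp only [e]
  rw [integral_const_mul, integral_complex_ofReal, integral_gaussianWindow_sq, Complex.ofReal_one,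
    mul_one]

/-- The pairing of a distribution with a test function in terms of short-time Fourier transforms. -/
theorem apply_eq_integral_stft (u : GSDistribution ι) (f : GelfandShilov ι) :
    u f = ∫ z : EuclideanSpace ℝ ι × EuclideanSpace ℝ ι,
      stft (GSDistribution.ofGS f) z * stft u (z.1, -z.2) := by
  obtain ⟨g, hg, hu⟩ := GelfandShilov.exists_integral (μ := volume)
    (F := fun z : EuclideanSpace ℝ ι × EuclideanSpace ℝ ι =>
      (stftConst ι * stft (GSDistribution.ofGS f) z) • gaussianPacket z.1 (-z.2))
    ((continuous_const.mul (continuous_stft _)).smul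
      (continuous_gaussianPacket.comp continuous_reflect))
    (integrable_gsNorm_smul_packet (continuous_const.mul (continuous_stft _)) fun R => by
      obtain ⟨C, hC0, hC⟩ := norm_stft_ofGS_le f R
      refine ⟨stftConst ι * C, mul_nonneg stftConst_pos.le hC0, fun z => ?_⟩
      rw [norm_mul, Complex.norm_real, Real.norm_of_nonneg stftConst_pos.le, mul_assoc]
      exact mul_le_mul_of_nonneg_left (hC z) stftConst_pos.le)
  -- The Σ₁-valued integral g equals f pointwise by inversion, so u may be evaluated under the
  -- integral sign.
  have hgf : g = f := Subtype.ext (funext fun y =>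
    (hg y).trans (eq_integral_stft_mul_packet f y).symm)
  rw [← hgf, hu, hgf]
  congr 1
  funext z
  rw [map_smul, smul_eq_mul, stft_eq u]
  ring

end Decay

end OrliczModulation

end

noncomputable section

namespace OrliczModulation

open MeasureTheory Set Filter Topology
open scoped ENNReal NNReal

/-! ### Exponential bounds for moderate weights -/

section Weights

variable {V : Type*} [NormedAddCommGroup V] [NormedSpace ℝ V] [FiniteDimensional ℝ V]
  [MeasureSpace V] [BorelSpace V]

theorem IsWeight.exists_ae_le {v : V → ℝ} (hv : IsWeight v) (r : ℝ) :
    ∃ M : ℝ, ∀ᵐ y, y ∈ Metric.closedBall (0 : V) r → v y ≤ M := by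
  have h := (hv.2 _ (isCompact_closedBall (0 : V) r)).1.2
  rw [eLpNorm_exponent_top] at h
  refine ⟨(eLpNormEssSup v (volume.restrict (Metric.closedBall 0 r))).toReal, ?_⟩
  rw [← ae_restrict_iff' Metric.isClosed_closedBall.measurableSet]
  filter_upwards [ae_le_eLpNormEssSup (f := v) (μ := volume.restrict (Metric.closedBall 0 r))]
    with y hy
  refine (le_abs_self _).trans ?_
  rw [← Real.norm_eq_abs, ← toReal_enorm]
  exact ENNReal.toReal_mono h.ne hy

variable [(volume : Measure V).IsAddHaarMeasure]

/-- The function v is bounded only almost everywhere on compact sets, while a pointwise bound is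
wanted. So y is split as w + (y - w), with w in the unit ball outside the null sets where v(w) or
v(y - w) could be large. -/
theorem ModerateWeight.exists_le_unit (ω : ModerateWeight V) : ∃ B : ℝ, 1 ≤ B ∧
    ∀ x y : V, ‖y‖ ≤ 1 → ω (x + y) ≤ B * ω x := by
  obtain ⟨v, hv, C, hC⟩ := ω.moderate'
  obtain ⟨M, hM⟩ := hv.exists_ae_le 2
  have hC0 : 0 < C := by
    have h1 := (ω.pos (0 + 0)).trans_le (hC 0 0)
    exact pos_of_mul_pos_left h1 (mul_pos (ω.pos 0) (hv.1 0)).le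
  refine ⟨max 1 (C * C * (M * M)), le_max_left _ _, fun x y hy => ?_⟩
  have hM' : ∀ᵐ w, y - w ∈ Metric.closedBall (0 : V) 2 → v (y - w) ≤ M :=
    (quasiMeasurePreserving_sub_left_of_right_invariant volume y).ae hM
  obtain ⟨w, hw, h1, h2⟩ := Measure.exists_mem_of_measure_ne_zero_of_ae
    (Metric.measure_ball_pos volume (0 : V) one_pos).ne' (ae_restrict_of_ae (hM.and hM'))
  rw [mem_ball_zero_iff] at hw
  have h1' := h1 (by rw [mem_closedBall_zero_iff]; linarith)
  have h2' := h2 (by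
    rw [mem_closedBall_zero_iff]
    linarith [norm_sub_le y w])
  have hw0 := hv.1 w
  have hyw0 := hv.1 (y - w)
  have hx0 := ω.pos x
  calc ω (x + y) = ω (x + w + (y - w)) := by congr 1; abel
    _ ≤ C * (ω (x + w) * v (y - w)) := hC _ _
    _ ≤ C * (C * (ω x * v w) * v (y - w)) := by
        gcongr
        exact hC x w
    _ = C * C * (v w * v (y - w)) * ω x := by ring
    _ ≤ C * C * (M * M) * ω x := by
        gcongr
        exact hw0.le.trans h1'
    _ ≤ _ := by
        gcongr
        exact le_max_right _ _

/-- A translation by y is made of ⌈‖y‖⌉ translations of length at most one, each of which costs a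
factor B. Hence the rate r = log B. -/
theorem ModerateWeight.exists_le_exp (ω : ModerateWeight V) : ∃ B r : ℝ, 0 < B ∧ 0 ≤ r ∧
    ∀ x y : V, ω (x + y) ≤ B * Real.exp (r * ‖y‖) * ω x := by
  obtain ⟨B, hB1, hB⟩ := ω.exists_le_unit
  have key : ∀ (n : ℕ) (x y : V), ‖y‖ ≤ n → ω (x + y) ≤ B ^ n * ω x := by
    intro n
    induction n with
    | zero =>
      intro x y hy
      have : y = 0 := norm_le_zero_iff.1 (by simpa using hy)
      simp [this]
    | succ n ih =>
      intro x y hy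
      have hn : (0 : ℝ) < n + 1 := by positivity
      push_cast at hy
      have e : x + y = x + ((n : ℝ) / (n + 1)) • y + ((1 : ℝ) / (n + 1)) • y := by
        rw [add_assoc, ← add_smul, ← add_div, div_self hn.ne', one_smul]
      rw [e, pow_succ', mul_assoc]
      refine (hB _ _ ?_).trans (mul_le_mul_of_nonneg_left (ih _ _ ?_) (by linarith))
      · rw [norm_smul, Real.norm_of_nonneg (by positivity), div_mul_eq_mul_div, one_mul]
        exact (div_le_one hn).2 hy
      · rw [norm_smul, Real.norm_of_nonneg (by positivity), div_mul_eq_mul_div,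
          div_le_iff₀ hn]
        gcongr
  refine ⟨B, Real.log B, by linarith, Real.log_nonneg hB1, fun x y => ?_⟩
  have hB0 : 0 < B := by linarith
  refine (key ⌈‖y‖⌉₊ x y (Nat.le_ceil _)).trans (mul_le_mul_of_nonneg_right ?_ (ω.pos x).le)
  rw [← Real.rpow_natCast, Real.rpow_def_of_pos hB0]
  nth_rewrite 2 [← Real.exp_log hB0]
  rw [← Real.exp_add, Real.exp_le_exp]
  nlinarith [Real.log_nonneg hB1, Nat.ceil_lt_add_one (norm_nonneg y)]

theorem ModerateWeight.exists_le_exp_sub (ω : ModerateWeight V) : ∃ B r : ℝ, 0 < B ∧ 0 ≤ r ∧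
    ∀ x y : V, ω x ≤ B * Real.exp (r * ‖y - x‖) * ω y := by
  obtain ⟨B, r, hB, hr, h⟩ := ω.exists_le_exp
  refine ⟨B, r, hB, hr, fun x y => ?_⟩
  simpa [norm_sub_rev] using h y (x - y)

end Weights

/-! ### Jensen's inequality for Young functions -/

namespace YoungFunction

variable (Φ : YoungFunction)

theorem map_mul_le {θ : ℝ≥0} (hθ : θ ≤ 1) (t : ℝ≥0∞) : Φ (θ * t) ≤ θ * Φ t := by
  have := Φ.convex (add_tsub_cancel_of_le hθ) t 0
  rwa [Φ.map_zero', mul_zero, add_zero, add_zero] at this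

theorem ne_top_of_lt {s t : ℝ≥0∞} (h : s ≤ t) (ht : Φ t ≠ ∞) : Φ s ≠ ∞ :=
  ne_top_of_le_ne_top ht (Φ.mono h)

theorem slope_le {r s t : ℝ≥0} (hrs : r < s) (hst : s < t) (ht : Φ t ≠ ∞) :
    ((Φ s).toReal - (Φ r).toReal) / ((s : ℝ) - r) ≤
      ((Φ t).toReal - (Φ s).toReal) / ((t : ℝ) - s) := by
  have hrs' : (0 : ℝ) < s - r := sub_pos.2 hrs
  have hst' : (0 : ℝ) < t - s := sub_pos.2 hst
  have hrt' : (0 : ℝ) < t - r := by linarith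
  have hr : Φ r ≠ ∞ := Φ.ne_top_of_lt (by exact_mod_cast (hrs.trans hst).le) ht
  have hs : Φ s ≠ ∞ := Φ.ne_top_of_lt (by exact_mod_cast hst.le) ht
  set a : ℝ≥0 := ⟨(t - s) / (t - r), by positivity⟩ with ha
  set b : ℝ≥0 := ⟨(s - r) / (t - r), by positivity⟩ with hb
  have hab : a + b = 1 := by
    ext
    change ((t : ℝ) - s) / (t - r) + (s - r) / (t - r) = 1
    field_simp
    ring
  have he : a * r + b * t = s := by
    ext
    change ((t : ℝ) - s) / (t - r) * r + (s - r) / (t - r) * t = s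
    field_simp
    ring
  have hc := Φ.convex hab (r : ℝ≥0∞) t
  rw [← ENNReal.coe_mul, ← ENNReal.coe_mul, ← ENNReal.coe_add, he] at hc
  have hc' := ENNReal.toReal_mono (ENNReal.add_ne_top.2
    ⟨ENNReal.mul_ne_top ENNReal.coe_ne_top hr, ENNReal.mul_ne_top ENNReal.coe_ne_top ht⟩) hc
  rw [ENNReal.toReal_add (ENNReal.mul_ne_top ENNReal.coe_ne_top hr)
    (ENNReal.mul_ne_top ENNReal.coe_ne_top ht), ENNReal.toReal_mul, ENNReal.toReal_mul] at hc'
  change (Φ s).toReal ≤ ((t : ℝ) - s) / (t - r) * (Φ r).toReal +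
    ((s : ℝ) - r) / (t - r) * (Φ t).toReal at hc'
  rw [div_mul_eq_mul_div, div_mul_eq_mul_div, ← add_div, le_div_iff₀ hrt'] at hc'
  rw [div_le_div_iff₀ hrs' hst']
  linarith

/-- Supporting lines at interior points of the domain. -/
theorem exists_supporting_line {s t₀ : ℝ≥0} (hs : s < t₀) (ht₀ : Φ t₀ ≠ ∞) :
    ∃ a : ℝ≥0, ∀ x : ℝ≥0∞, Φ s + a * x ≤ Φ x + a * s := by
  -- The slope of the line is the supremum of the difference quotients to the left of s. They are
  -- bounded by the slope from s to t₀, which is where a finite value beyond s is needed. For s = 0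
  -- the set is empty and the default supremum 0 gives a horizontal line.
  set S : Set ℝ := {q | ∃ r : ℝ≥0, r < s ∧ q = ((Φ s).toReal - (Φ r).toReal) / ((s : ℝ) - r)}
  have hΦs : Φ s ≠ ∞ := Φ.ne_top_of_lt (by exact_mod_cast hs.le) ht₀
  have hbdd : BddAbove S :=
    ⟨_, by rintro q ⟨r, hr, rfl⟩; exact Φ.slope_le hr hs ht₀⟩
  have hS0 : 0 ≤ sSup S := Real.sSup_nonneg (by
    rintro q ⟨r, hr, rfl⟩
    refine div_nonneg (sub_nonneg.2 (ENNReal.toReal_mono hΦs (Φ.mono ?_))) (sub_pos.2 (NNReal.coe_lt_coe.2 hr)).le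
    exact_mod_cast hr.le)
  refine ⟨⟨sSup S, hS0⟩, fun x => ?_⟩
  by_cases hx : Φ x = ∞
  · rw [hx, top_add]; exact le_top
  have hxt : x ≠ ∞ := fun h => hx (by rw [h]; exact Φ.map_top')
  lift x to ℝ≥0 using hxt
  have key : (Φ s).toReal + sSup S * x ≤ (Φ x).toReal + sSup S * s := by
    rcases lt_trichotomy x s with h | rfl | h
    · have h1 := le_csSup hbdd ⟨x, h, rfl⟩
      rw [div_le_iff₀ (sub_pos.2 (NNReal.coe_lt_coe.2 h))] at h1
      linarith
    · rfl
    · have h1 : sSup S ≤ ((Φ x).toReal - (Φ s).toReal) / ((x : ℝ) - s) := by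
        refine Real.sSup_le (by rintro q ⟨r, hr, rfl⟩; exact Φ.slope_le hr h hx) ?_
        refine div_nonneg (sub_nonneg.2 (ENNReal.toReal_mono hx (Φ.mono ?_))) (sub_pos.2 (NNReal.coe_lt_coe.2 h)).le
        exact_mod_cast h.le
      rw [le_div_iff₀ (sub_pos.2 (NNReal.coe_lt_coe.2 h))] at h1
      linarith
  rw [← ENNReal.toReal_le_toReal (by finiteness) (by finiteness),
    ENNReal.toReal_add hΦs (by finiteness), ENNReal.toReal_add hx (by finiteness),
    ENNReal.toReal_mul, ENNReal.toReal_mul]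
  exact key

/-- Jensen's inequality; the strict inequality takes care of a possible jump of `Φ`. -/
theorem le_lintegral_of_lt_lintegral {Z : Type*} [MeasurableSpace Z] {μ : Measure Z}
    [IsProbabilityMeasure μ] {g : Z → ℝ≥0∞} (hg : AEMeasurable g μ) {s : ℝ≥0∞}
    (hs : s < ∫⁻ z, g z ∂μ) : Φ s ≤ ∫⁻ z, Φ (g z) ∂μ := by
  have hΦg : AEMeasurable (fun z => Φ (g z)) μ := Φ.measurable.comp_aemeasurable hg
  lift s to ℝ≥0 using hs.ne_top
  -- If Φ is finite somewhere beyond s, the supporting line at s is integrated.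
  by_cases h : ∃ t : ℝ≥0∞, s < t ∧ Φ t ≠ ∞
  · obtain ⟨t, hst, ht⟩ := h
    have htt : t ≠ ∞ := fun h => ht (by rw [h]; exact Φ.map_top')
    lift t to ℝ≥0 using htt
    obtain ⟨a, ha⟩ := Φ.exists_supporting_line (by exact_mod_cast hst) ht
    have h1 : ∫⁻ z, (Φ s + a * g z) ∂μ ≤ ∫⁻ z, (Φ (g z) + a * s) ∂μ :=
      lintegral_mono fun z => ha (g z)
    rw [lintegral_add_left measurable_const, lintegral_const, measure_univ, mul_one,
      lintegral_const_mul' _ _ ENNReal.coe_ne_top, lintegral_add_left' hΦg, lintegral_const,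
      measure_univ, mul_one] at h1
    have h2 : Φ s + a * s ≤ ∫⁻ z, Φ (g z) ∂μ + a * s :=
      le_trans (by gcongr) h1
    exact (ENNReal.add_le_add_iff_right (by finiteness)).1 h2
  -- Here Φ is infinite beyond s, so a finite integral of Φ ∘ g would force g ≤ s almost everywhere,
  -- against s < ∫ g.
  · push Not at h
    by_cases hfin : ∫⁻ z, Φ (g z) ∂μ = ∞
    · rw [hfin]; exact le_top
    exfalso
    have h1 : ∀ᵐ z ∂μ, g z ≤ s := by
      filter_upwards [ae_lt_top' hΦg hfin] with z hz
      by_contra! hgt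
      exact hz.ne (h _ hgt)
    have h2 := lintegral_mono_ae h1
    rw [lintegral_const, measure_univ, mul_one] at h2
    exact absurd hs (not_lt.2 h2)

end YoungFunction

/-! ### Convolution in Orlicz spaces -/

section Convolution

variable {V : Type*} [NormedAddCommGroup V]

/-- The kernel `exp(-|w|)`. -/
def expKernel (w : V) : ℝ≥0∞ := ENNReal.ofReal (Real.exp (-‖w‖))

theorem continuous_expKernel : Continuous (expKernel : V → ℝ≥0∞) := by
  exact ENNReal.continuous_ofReal.comp (by fun_prop)

variable [MeasureSpace V]

variable (V) in
/-- The total mass of `expKernel`. -/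
def expMass : ℝ≥0∞ := ∫⁻ w : V, expKernel w

variable [BorelSpace V] [(volume : Measure V).IsAddHaarMeasure]

theorem lintegral_expKernel_sub (x : V) : ∫⁻ w, expKernel (w - x) = expMass V :=
  lintegral_sub_right_eq_self expKernel x

theorem expMass_ne_zero : expMass V ≠ 0 := by
  rw [expMass, Ne, lintegral_eq_zero_iff continuous_expKernel.measurable]
  intro h
  have : ∀ᵐ w : V, False := h.mono fun w hw => by
    have : 0 < expKernel w := ENNReal.ofReal_pos.2 (Real.exp_pos _)
    exact this.ne' hw
  exact (NeZero.ne (volume : Measure V)) (ae_eq_bot.1 (eventually_false_iff_eq_bot.1 this))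

variable [NormedSpace ℝ V] [FiniteDimensional ℝ V]

theorem expMass_ne_top : expMass V ≠ ∞ := by
  have := (integrable_exp_neg_mul_norm (volume : Measure V) one_pos).lintegral_lt_top
  simpa [expMass, expKernel] using this.ne

/-- Jensen's inequality for the probability measure proportional to exp(-‖w - x‖) dw. The factor 2
only serves to make the inequality strict when s ≠ 0. -/
theorem map_le_lintegral_expKernel (Φ : YoungFunction) {G : V → ℝ≥0∞} (hG : AEMeasurable G)
    {s : ℝ≥0∞} (hs : s ≠ ∞) (x : V)
    (h : 2 * (expMass V * s) ≤ ∫⁻ w, G w * expKernel (w - x)) :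
    Φ s ≤ (expMass V)⁻¹ * ∫⁻ w, Φ (G w) * expKernel (w - x) := by
  rcases eq_or_ne s 0 with rfl | hs0
  · rw [Φ.map_zero']; exact zero_le
  set p : V → ℝ≥0∞ := fun w => (expMass V)⁻¹ * expKernel (w - x) with hp
  have hpm : Measurable p :=
    ((continuous_expKernel.comp (continuous_id.sub continuous_const)).measurable).const_mul _
  set μ : Measure V := volume.withDensity p with hμ
  have hI := expMass_ne_top (V := V)
  have hI0 := expMass_ne_zero (V := V)
  have : IsProbabilityMeasure μ := ⟨by
    rw [hμ, withDensity_apply _ MeasurableSet.univ, Measure.restrict_univ, hp,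
      lintegral_const_mul' _ _ (ENNReal.inv_ne_top.2 hI0), lintegral_expKernel_sub,
      ENNReal.inv_mul_cancel hI0 hI]⟩
  have hint : ∀ g : V → ℝ≥0∞, AEMeasurable g →
      ∫⁻ w, g w ∂μ = (expMass V)⁻¹ * ∫⁻ w, g w * expKernel (w - x) := fun g hg => by
    rw [hμ, lintegral_withDensity_eq_lintegral_mul₀ hpm.aemeasurable hg,
      ← lintegral_const_mul' _ _ (ENNReal.inv_ne_top.2 hI0)]
    refine lintegral_congr fun w => ?_
    rw [Pi.mul_apply, hp, mul_comm (g w), mul_assoc]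
  rw [← hint (fun w => Φ (G w)) (Φ.measurable.comp_aemeasurable hG)]
  refine Φ.le_lintegral_of_lt_lintegral (hG.mono_ac (withDensity_absolutelyContinuous _ _)) ?_
  rw [hint G hG]
  calc s < 2 * s := by
        rw [two_mul]; exact ENNReal.lt_add_right hs hs0
    _ = (expMass V)⁻¹ * (2 * (expMass V * s)) := by
        rw [mul_left_comm 2, ← mul_assoc, ENNReal.inv_mul_cancel hI0 hI, one_mul]
    _ ≤ _ := by gcongr

/-- A pointwise use of Jensen's inequality is followed by integration in z and Tonelli's theorem.
The change of variables by Λ costs a factor D; to absorb it, H is divided by a further M ≥ max(1,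
D), since Φ(t/M) ≤ Φ(t)/M. The constant C depends on Λ alone. -/
theorem exists_lintegral_map_le_one (Λ : V ≃L[ℝ] V) : ∃ C : ℝ, 0 < C ∧
    ∀ (Φ : YoungFunction) (G : V → ℝ≥0∞) (H : V → ℝ), AEMeasurable G → (∀ z, 0 ≤ H z) →
      (∀ z, ENNReal.ofReal (H z) ≤ ∫⁻ w, G w * expKernel (w - Λ z)) → ∫⁻ w, Φ (G w) ≤ 1 →
        ∫⁻ z, Φ (ENNReal.ofReal (H z / C)) ≤ 1 := by
  have hI := expMass_ne_top (V := V)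
  have hI0 := expMass_ne_zero (V := V)
  -- The constant D is |det Λ|⁻¹.
  obtain ⟨D, hD⟩ : ∃ D : ℝ≥0, ∀ w : V, ∫⁻ z, expKernel (w - Λ z) = D * expMass V := by
    have hdet := (LinearEquiv.isUnit_det' Λ.toLinearEquiv).ne_zero
    refine ⟨‖(LinearMap.det (Λ.toLinearEquiv : V →ₗ[ℝ] V))⁻¹‖₊, fun w => ?_⟩
    have h1 := lintegral_map' (μ := (volume : Measure V)) (g := Λ)
      (f := fun y => expKernel (w - y))
      (continuous_expKernel.comp (continuous_const.sub continuous_id)).measurable.aemeasurable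
      Λ.continuous.measurable.aemeasurable
    rw [← h1]
    have h2 := Measure.map_linearMap_addHaar_eq_smul_addHaar (volume : Measure V) hdet
    have h3 : ⇑(Λ.toLinearEquiv : V →ₗ[ℝ] V) = Λ := rfl
    rw [h3] at h2
    rw [h2, lintegral_smul_measure, lintegral_sub_left_eq_self expKernel w, smul_eq_mul, expMass,
      ← Real.norm_eq_abs, ofReal_norm]
    rfl
  set M : ℝ≥0 := max 1 D with hM
  have hM1 : 1 ≤ M := le_max_left _ _
  have hM0 : 0 < M := lt_of_lt_of_le one_pos hM1
  have hIr : 0 < (expMass V).toReal := ENNReal.toReal_pos hI0 hI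
  refine ⟨2 * (expMass V).toReal * M, by positivity, fun Φ G H hG hH0 hH hΦ => ?_⟩
  have hpt : ∀ z, Φ (ENNReal.ofReal (H z / (2 * (expMass V).toReal * M))) ≤
      (M⁻¹ : ℝ≥0) * ((expMass V)⁻¹ * ∫⁻ w, Φ (G w) * expKernel (w - Λ z)) := by
    intro z
    have e : ENNReal.ofReal (H z / (2 * (expMass V).toReal * M)) =
        (M⁻¹ : ℝ≥0) * ENNReal.ofReal (H z / (2 * (expMass V).toReal)) := by
      rw [← ENNReal.ofReal_coe_nnreal, ← ENNReal.ofReal_mul (by positivity)]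
      congr 1
      push_cast
      field_simp
    rw [e]
    refine (Φ.map_mul_le (inv_le_one_of_one_le₀ hM1) _).trans ?_
    gcongr
    refine map_le_lintegral_expKernel Φ hG ENNReal.ofReal_ne_top _ (le_trans (le_of_eq ?_) (hH z))
    rw [← ENNReal.ofReal_toReal hI, ← ENNReal.ofReal_ofNat, ← ENNReal.ofReal_mul (by positivity),
      ← ENNReal.ofReal_mul (by positivity), ENNReal.toReal_ofReal hIr.le]
    congr 1
    field_simp
  have hker : Measurable fun q : V × V => expKernel (q.2 - Λ q.1) :=
    (continuous_expKernel.comp (by fun_prop)).measurable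
  calc _ ≤ ∫⁻ z, (M⁻¹ : ℝ≥0) * ((expMass V)⁻¹ * ∫⁻ w, Φ (G w) * expKernel (w - Λ z)) :=
        lintegral_mono hpt
    _ = (M⁻¹ : ℝ≥0) * ((expMass V)⁻¹ * ∫⁻ z, ∫⁻ w, Φ (G w) * expKernel (w - Λ z)) := by
        rw [lintegral_const_mul' _ _ ENNReal.coe_ne_top,
          lintegral_const_mul' _ _ (ENNReal.inv_ne_top.2 hI0)]
    _ = (M⁻¹ : ℝ≥0) * ((expMass V)⁻¹ * ∫⁻ w, Φ (G w) * (D * expMass V)) := by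
        rw [lintegral_lintegral_swap]
        · congr 2
          refine lintegral_congr fun w => ?_
          have hm : Measurable fun z => expKernel (w - Λ z) :=
            (continuous_expKernel.comp (by fun_prop)).measurable
          rw [lintegral_const_mul _ hm, hD]
        · exact ((Φ.measurable.comp_aemeasurable hG).comp_snd).mul hker.aemeasurable
    _ = (M⁻¹ : ℝ≥0) * D * ∫⁻ w, Φ (G w) := by
        rw [lintegral_mul_const' _ _ (by finiteness)]
        rw [mul_comm (∫⁻ w, Φ (G w)), ← mul_assoc (expMass V)⁻¹, mul_left_comm (expMass V)⁻¹,
          ENNReal.inv_mul_cancel hI0 hI, mul_one, mul_assoc]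
    _ ≤ (M⁻¹ : ℝ≥0) * M * 1 := by
        gcongr
        exact le_max_right _ _
    _ = 1 := by
        rw [mul_one, ← ENNReal.coe_mul, inv_mul_cancel₀ hM0.ne', ENNReal.coe_one]

/-- Functions of rapid exponential decay belong to all weighted Orlicz spaces. -/
theorem memOrlicz_of_decay (Φ : YoungFunction) (hΦ : ∃ t : ℝ≥0∞, 0 < t ∧ Φ t ≠ ∞)
    (ω : ModerateWeight V) {F : V → ℂ} (hF : AEStronglyMeasurable F)
    (hdec : ∀ R : ℝ, ∃ C : ℝ, 0 ≤ C ∧ ∀ z, ‖F z‖ ≤ C * Real.exp (-R * ‖z‖)) :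
    MemOrlicz Φ ω F := by
  refine ⟨hF, ?_⟩
  obtain ⟨t, ht0, ht⟩ := hΦ
  have htt : t ≠ ∞ := fun h => ht (by rw [h]; exact Φ.map_top')
  lift t to ℝ≥0 using htt
  have ht0' : 0 < t := by exact_mod_cast ht0
  obtain ⟨B, r, hB, hr, hω⟩ := ω.exists_le_exp
  -- The rate exceeds the growth r of the weight by one, which leaves exp(-‖z‖).
  obtain ⟨C, hC0, hC⟩ := hdec (r + 1)
  set A : ℝ := C * (B * ω 0) with hA
  have hA0 : 0 ≤ A := mul_nonneg hC0 (mul_nonneg hB.le (ω.pos 0).le)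
  have hbd : ∀ z, ‖F z‖ * ω z ≤ A * Real.exp (-‖z‖) := fun z => by
    have h1 := hω 0 z
    rw [zero_add] at h1
    calc _ ≤ C * Real.exp (-(r + 1) * ‖z‖) * (B * Real.exp (r * ‖z‖) * ω 0) :=
          mul_le_mul (hC z) h1 (ω.pos z).le (by positivity)
      _ = A * (Real.exp (-(r + 1) * ‖z‖) * Real.exp (r * ‖z‖)) := by rw [hA]; ring
      _ = _ := by rw [← Real.exp_add]; ring_nf
  have hI := expMass_ne_top (V := V)
  set N : ℝ := (expMass V).toReal * (Φ t).toReal + 1 with hN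
  have hN1 : 1 ≤ N := by rw [hN]; linarith [mul_nonneg (ENNReal.toReal_nonneg (a := expMass V)) (ENNReal.toReal_nonneg (a := Φ t))]
  have hN0 : 0 < N := by linarith
  -- With this value the argument of Φ is at most θt with θ = exp(-‖z‖)/N ≤ 1. Convexity gives Φ(θt)
  -- ≤ θΦ(t), and N is large enough for the integral of θΦ(t) to be at most 1.
  set lam : ℝ := (A + 1) * N / t with hlam
  have htr : (0 : ℝ) < t := ht0'
  have hlam0 : 0 < lam := by positivity
  refine ⟨lam, hlam0, ?_⟩
  have hpt : ∀ z, Φ (ENNReal.ofReal (‖F z‖ * ω z / lam)) ≤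
      ENNReal.ofReal N⁻¹ * Φ t * expKernel z := by
    intro z
    have hθ : N⁻¹ * Real.exp (-‖z‖) ≤ 1 :=
      mul_le_one₀ (inv_le_one_of_one_le₀ hN1) (Real.exp_pos _).le
        (Real.exp_le_one_iff.2 (neg_nonpos.2 (norm_nonneg z)))
    have hθ' : (N⁻¹ * Real.exp (-‖z‖)).toNNReal ≤ 1 := by
      rw [Real.toNNReal_le_one]; exact hθ
    have h1 : ENNReal.ofReal (‖F z‖ * ω z / lam) ≤
        ((N⁻¹ * Real.exp (-‖z‖)).toNNReal : ℝ≥0∞) * t := by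
      change _ ≤ ENNReal.ofReal _ * _
      rw [← ENNReal.ofReal_coe_nnreal, ← ENNReal.ofReal_mul (by positivity)]
      refine ENNReal.ofReal_le_ofReal ?_
      rw [div_le_iff₀ hlam0]
      calc _ ≤ A * Real.exp (-‖z‖) := hbd z
        _ ≤ (A + 1) * Real.exp (-‖z‖) := by gcongr; linarith
        _ = _ := by rw [hlam]; field_simp
    refine (Φ.mono h1).trans ((Φ.map_mul_le hθ' _).trans (le_of_eq ?_))
    change ENNReal.ofReal _ * _ = _
    rw [ENNReal.ofReal_mul (by positivity), expKernel]
    ring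
  refine (lintegral_mono hpt).trans ?_
  rw [lintegral_const_mul' _ _ (by finiteness)]
  change _ * expMass V ≤ 1
  rw [← ENNReal.ofReal_toReal hI, ← ENNReal.ofReal_toReal ht, ← ENNReal.ofReal_mul (by positivity),
    ← ENNReal.ofReal_mul (by positivity), ← ENNReal.ofReal_one]
  refine ENNReal.ofReal_le_ofReal ?_
  rw [mul_assoc, inv_mul_le_iff₀ hN0, mul_one, hN]
  linarith

end Convolution

end OrliczModulation

end

noncomputable section

namespace OrliczModulation

open MeasureTheory Set Filter Topology
open scoped ENNReal NNReal

/-! ### Linear pullbacks and the short-time Fourier transform -/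

section Pullback

variable {ι : Type*} [Fintype ι]

theorem integral_reflect (F : EuclideanSpace ℝ ι × EuclideanSpace ℝ ι → ℂ) :
    ∫ z : EuclideanSpace ℝ ι × EuclideanSpace ℝ ι, F (z.1, -z.2) = ∫ z, F z := by
  let e := (Homeomorph.refl (EuclideanSpace ℝ ι)).prodCongr (Homeomorph.neg (EuclideanSpace ℝ ι))
  have h : MeasurePreserving e volume volume :=
    (MeasurePreserving.id volume).prod (Measure.measurePreserving_neg volume)
  exact h.integral_comp e.measurableEmbedding F

theorem ofGS_comm (f g : GelfandShilov ι) :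
    GSDistribution.ofGS f g = GSDistribution.ofGS g f := by
  rw [GSDistribution.ofGS_apply, GSDistribution.ofGS_apply]
  simp only [mul_comm]

/-- The integral of `g ∘ L`. -/
theorem integral_comp_linear (L : EuclideanSpace ℝ ι ≃L[ℝ] EuclideanSpace ℝ ι)
    (g : EuclideanSpace ℝ ι → ℂ) : ∫ y, g (L y) =
      ((|(L : EuclideanSpace ℝ ι →L[ℝ] EuclideanSpace ℝ ι).det|⁻¹ : ℝ) : ℂ) * ∫ y, g y := by
  have hdet : LinearMap.det (L.toLinearEquiv : EuclideanSpace ℝ ι →ₗ[ℝ] EuclideanSpace ℝ ι) ≠ 0 :=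
    (LinearEquiv.isUnit_det' L.toLinearEquiv).ne_zero
  have h2 := Measure.map_linearMap_addHaar_eq_smul_addHaar
    (volume : Measure (EuclideanSpace ℝ ι)) hdet
  have h1 := L.toHomeomorph.measurableEmbedding.integral_map (μ := volume) g
  change ∫ y, g y ∂(Measure.map L volume) = ∫ y, g (L y) at h1
  have h3 : ⇑(L.toLinearEquiv : EuclideanSpace ℝ ι →ₗ[ℝ] EuclideanSpace ℝ ι) = L := rfl
  rw [h3] at h2
  rw [← h1, h2, integral_smul_measure, ENNReal.toReal_ofReal (abs_nonneg _), abs_inv,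
    Complex.real_smul]
  rfl

theorem pullback_ofGS (L : EuclideanSpace ℝ ι ≃L[ℝ] EuclideanSpace ℝ ι) (f : GelfandShilov ι) :
    GSDistribution.pullback L (GSDistribution.ofGS f) =
      GSDistribution.ofGS (GelfandShilov.compLin L f) := by
  ext φ
  have := integral_comp_linear L fun y => f y * φ (L.symm y)
  simp only [ContinuousLinearEquiv.symm_apply_apply] at this
  exact this.symm

theorem pullback_apply (L : EuclideanSpace ℝ ι ≃L[ℝ] EuclideanSpace ℝ ι) (u : GSDistribution ι)
    (φ : GelfandShilov ι) : GSDistribution.pullback L u φ =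
      ((|(L : EuclideanSpace ℝ ι →L[ℝ] EuclideanSpace ℝ ι).det|⁻¹ : ℝ) : ℂ) *
        u (GelfandShilov.compLin L.symm φ) := rfl

theorem det_mul_det_symm {E : Type*} [NormedAddCommGroup E] [NormedSpace ℝ E] (L : E ≃L[ℝ] E) :
    (L : E →L[ℝ] E).det * (L.symm : E →L[ℝ] E).det = 1 :=
  LinearEquiv.det_mul_det_symm L.toLinearEquiv

theorem abs_det_inv_ne_zero (L : EuclideanSpace ℝ ι ≃L[ℝ] EuclideanSpace ℝ ι) :
    ((|(L : EuclideanSpace ℝ ι →L[ℝ] EuclideanSpace ℝ ι).det|⁻¹ : ℝ) : ℂ) ≠ 0 := by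
  have := left_ne_zero_of_mul_eq_one (det_mul_det_symm L)
  exact_mod_cast inv_ne_zero (abs_ne_zero.2 this)

theorem pullback_symm_pullback (L : EuclideanSpace ℝ ι ≃L[ℝ] EuclideanSpace ℝ ι)
    (u : GSDistribution ι) :
    GSDistribution.pullback L.symm (GSDistribution.pullback L u) = u := by
  ext φ
  have e : GelfandShilov.compLin L.symm (GelfandShilov.compLin L.symm.symm φ) = φ :=
    Subtype.ext (funext fun y => by
      change φ (L (L.symm y)) = φ y
      rw [L.apply_symm_apply])
  rw [pullback_apply, pullback_apply, e, ← mul_assoc, ← Complex.ofReal_mul, ← mul_inv, ← abs_mul,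
    mul_comm (ContinuousLinearMap.det _), det_mul_det_symm, abs_one, inv_one, Complex.ofReal_one,
    one_mul]

/-- The wave packet at `w`, composed with `L⁻¹`. -/
def packetComp (L : EuclideanSpace ℝ ι ≃L[ℝ] EuclideanSpace ℝ ι)
    (w : EuclideanSpace ℝ ι × EuclideanSpace ℝ ι) : GelfandShilov ι :=
  GelfandShilov.compLin L.symm (gaussianPacket w.1 w.2)

/-- The kernel that represents the pullback by `L` on the side of short-time Fourier
transforms. -/
def pullbackKernel (L : EuclideanSpace ℝ ι ≃L[ℝ] EuclideanSpace ℝ ι)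
    (w z : EuclideanSpace ℝ ι × EuclideanSpace ℝ ι) : ℂ :=
  stft (GSDistribution.ofGS (packetComp L w)) (z.1, -z.2)

theorem apply_packetComp (L : EuclideanSpace ℝ ι ≃L[ℝ] EuclideanSpace ℝ ι)
    (u : GSDistribution ι) (w : EuclideanSpace ℝ ι × EuclideanSpace ℝ ι) :
    u (packetComp L w) = ∫ z, pullbackKernel L w z * stft u z := by
  rw [apply_eq_integral_stft, ← integral_reflect]
  simp only [neg_neg]
  rfl

theorem integrable_pullbackKernel_mul (L : EuclideanSpace ℝ ι ≃L[ℝ] EuclideanSpace ℝ ι)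
    (u : GSDistribution ι) (w : EuclideanSpace ℝ ι × EuclideanSpace ℝ ι) :
    Integrable fun z => pullbackKernel L w z * stft u z := by
  obtain ⟨D, a, hD0, ha, hD⟩ := norm_stft_le u
  obtain ⟨C, hC0, hC⟩ := norm_stft_ofGS_le (packetComp L w) (a + 1)
  refine ((integrable_exp_neg_mul_norm volume one_pos).const_mul (C * D)).mono' ?_
    (Eventually.of_forall fun z => ?_)
  · exact (((continuous_stft _).comp continuous_reflect).mul
      (continuous_stft u)).aestronglyMeasurable
  · rw [norm_mul]
    have h1 := hC (z.1, -z.2)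
    rw [norm_reflect] at h1
    calc _ ≤ C * Real.exp (-(a + 1) * ‖z‖) * (D * Real.exp (a * ‖z‖)) :=
          mul_le_mul h1 (hD z) (norm_nonneg _) (by positivity)
      _ = C * D * (Real.exp (-(a + 1) * ‖z‖) * Real.exp (a * ‖z‖)) := by ring
      _ = _ := by rw [← Real.exp_add]; ring_nf

/-- Covariance: `hLM` says that M is the inverse transpose of L, so composing with L⁻¹ moves the
centre of a packet from w to (L w.1, M w.2). The substitution y ↦ y + L w.1 exhibits this shift, and
the phase it produces has modulus one. -/
theorem norm_pullbackKernel_eq (L M : EuclideanSpace ℝ ι ≃L[ℝ] EuclideanSpace ℝ ι)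
    (hLM : ∀ y ξ, inner ℝ (L y) (M ξ) = inner ℝ y ξ)
    (w z : EuclideanSpace ℝ ι × EuclideanSpace ℝ ι) :
    ‖pullbackKernel L w z‖ =
      ‖stft (GSDistribution.ofGS (packetComp L 0)) (z.1 - L w.1, M w.2 - z.2)‖ := by
  have key : GSDistribution.ofGS (packetComp L w) (gaussianPacket z.1 (-z.2)) =
      Complex.exp (((inner ℝ (L w.1) (z.2 - M w.2) : ℝ) : ℂ) * Complex.I) *
      GSDistribution.ofGS (packetComp L 0) (gaussianPacket (z.1 - L w.1) (M w.2 - z.2)) := by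
    rw [GSDistribution.ofGS_apply, GSDistribution.ofGS_apply, ← integral_const_mul,
      ← integral_add_right_eq_self _ (L w.1)]
    congr 1
    funext y
    change gaussianPacket w.1 w.2 (L.symm (y + L w.1)) * gaussianPacket z.1 (-z.2) (y + L w.1) =
      _ * (gaussianPacket 0 0 (L.symm y) * gaussianPacket (z.1 - L w.1) (M w.2 - z.2) y)
    have e1 : inner ℝ (L.symm y + w.1) w.2 = inner ℝ y (M w.2) + inner ℝ (L w.1) (M w.2) := by
      rw [← hLM, map_add, L.apply_symm_apply, inner_add_left]
    rw [map_add, L.symm_apply_apply, gaussianPacket_zero_apply, gaussianPacket_apply,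
      gaussianPacket_apply, gaussianPacket_apply, add_sub_cancel_right, sub_zero, e1,
      show y + L w.1 - z.1 = y - (z.1 - L w.1) by abel, inner_sub_right, inner_sub_right,
      inner_neg_right, inner_add_left]
    rw [mul_mul_mul_comm, ← Complex.exp_add, mul_left_comm (Complex.exp _), mul_assoc,
      mul_left_comm (Complex.exp _), ← Complex.exp_add]
    congr 3
    push_cast
    ring
  rw [pullbackKernel, stft_eq, stft_eq, key, norm_mul, norm_mul, norm_mul,
    Complex.norm_exp_ofReal_mul_I, one_mul]

theorem norm_pullbackKernel_le (L M : EuclideanSpace ℝ ι ≃L[ℝ] EuclideanSpace ℝ ι)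
    (hLM : ∀ y ξ, inner ℝ (L y) (M ξ) = inner ℝ y ξ) (R : ℝ) : ∃ C : ℝ, 0 < C ∧ ∀ w z,
      ‖pullbackKernel L w z‖ ≤ C * Real.exp (-R * ‖z - L.prodCongr M w‖) := by
  obtain ⟨C, hC0, hC⟩ := norm_stft_ofGS_le (packetComp L 0) R
  refine ⟨C + 1, by positivity, fun w z => ?_⟩
  rw [norm_pullbackKernel_eq L M hLM]
  have e : ‖(z.1 - L w.1, M w.2 - z.2)‖ = ‖z - L.prodCongr M w‖ := by
    rw [Prod.norm_def, Prod.norm_def]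
    congr 1
    exact norm_sub_rev _ _
  refine (hC _).trans ?_
  rw [e]
  gcongr
  linarith

/-- Passing from ω' w = ω(Λw) to ω z costs at most B exp(s‖z - Λw‖), and the kernel decays at rate s
+ 1, so exp(-‖z - Λw‖) remains. No integrability of U is needed: the norm of a Bochner integral
never exceeds the integral of the norm. -/
theorem exists_ofReal_le_lintegral (L M : EuclideanSpace ℝ ι ≃L[ℝ] EuclideanSpace ℝ ι)
    (hLM : ∀ y ξ, inner ℝ (L y) (M ξ) = inner ℝ y ξ)
    (ω ω' : ModerateWeight (EuclideanSpace ℝ ι × EuclideanSpace ℝ ι))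
    (hω : ∀ w, ω' w = ω (L.prodCongr M w)) : ∃ A : ℝ, 0 < A ∧
      ∀ (U : EuclideanSpace ℝ ι × EuclideanSpace ℝ ι → ℂ)
        (w : EuclideanSpace ℝ ι × EuclideanSpace ℝ ι) (r : ℝ), 0 < r →
        ENNReal.ofReal (‖∫ z, pullbackKernel L w z * U z‖ * ω' w / (A * r)) ≤
          ∫⁻ z, ENNReal.ofReal (‖U z‖ * ω z / r) * expKernel (z - L.prodCongr M w) := by
  obtain ⟨B, s, hB, hs, hBω⟩ := ω.exists_le_exp_sub
  obtain ⟨C, hC0, hC⟩ := norm_pullbackKernel_le L M hLM (s + 1)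
  refine ⟨C * B, by positivity, fun U w r hr => ?_⟩
  have hω0 := ω'.pos w
  have hd : 0 ≤ ω' w / (C * B * r) := by positivity
  rw [mul_div_assoc, ENNReal.ofReal_mul (norm_nonneg _), ofReal_norm]
  refine (mul_le_mul_left (enorm_integral_le_lintegral_enorm _) _).trans ?_
  rw [← lintegral_mul_const' _ _ ENNReal.ofReal_ne_top]
  refine lintegral_mono fun z => ?_
  have hωz := ω.pos z
  rw [← ofReal_norm, expKernel, ← ENNReal.ofReal_mul (norm_nonneg _),
    ← ENNReal.ofReal_mul (by positivity)]
  refine ENNReal.ofReal_le_ofReal ?_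
  rw [norm_mul]
  set ρ := ‖z - L.prodCongr M w‖ with hρ
  have h1 : ω' w ≤ B * Real.exp (s * ρ) * ω z := by
    rw [hω w]; exact hBω _ _
  have h2 : ‖pullbackKernel L w z‖ ≤ C * Real.exp (-(s + 1) * ρ) := hC w z
  calc _ ≤ C * Real.exp (-(s + 1) * ρ) * ‖U z‖ *
        (B * Real.exp (s * ρ) * ω z / (C * B * r)) := by gcongr
    _ = ‖U z‖ * ω z / r * (Real.exp (-(s + 1) * ρ) * Real.exp (s * ρ)) := by
        field_simp
    _ = _ := by rw [← Real.exp_add]; ring_nf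

/-- The operator with kernel `pullbackKernel L` is bounded between weighted Orlicz spaces. -/
theorem exists_mem_orliczSet (L M : EuclideanSpace ℝ ι ≃L[ℝ] EuclideanSpace ℝ ι)
    (hLM : ∀ y ξ, inner ℝ (L y) (M ξ) = inner ℝ y ξ)
    (ω ω' : ModerateWeight (EuclideanSpace ℝ ι × EuclideanSpace ℝ ι))
    (hω : ∀ w, ω' w = ω (L.prodCongr M w)) : ∃ C : ℝ, 0 < C ∧
      ∀ (Φ : YoungFunction) (U : EuclideanSpace ℝ ι × EuclideanSpace ℝ ι → ℂ),
        AEStronglyMeasurable U → ∀ r ∈ orliczSet Φ ω U,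
          C * r ∈ orliczSet Φ ω' fun w => ∫ z, pullbackKernel L w z * U z := by
  obtain ⟨A, hA, hAU⟩ := exists_ofReal_le_lintegral L M hLM ω ω' hω
  obtain ⟨C, hC, hCΦ⟩ := exists_lintegral_map_le_one (L.prodCongr M)
  refine ⟨A * C, by positivity, fun Φ U hU r hr => ⟨mul_pos (by positivity) hr.1, ?_⟩⟩
  have hr0 := hr.1
  have := hCΦ Φ (fun z => ENNReal.ofReal (‖U z‖ * ω z / r))
    (fun w => ‖∫ z, pullbackKernel L w z * U z‖ * ω' w / (A * r))
    ((hU.norm.aemeasurable.mul ω.aemeasurable).div_const r).ennreal_ofReal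
    (fun w => by have := ω'.pos w; positivity) (fun w => hAU U w r hr0) hr.2
  refine le_trans (le_of_eq ?_) this
  refine lintegral_congr fun w => ?_
  rw [div_div, mul_right_comm]

/-- The pullback acts on short-time Fourier transforms as an integral operator, by the inversion
formula applied to the composed packet. -/
theorem stft_pullback (L : EuclideanSpace ℝ ι ≃L[ℝ] EuclideanSpace ℝ ι) (u : GSDistribution ι) :
    stft (GSDistribution.pullback L u) = fun w => (stftConst ι *
      ((|(L : EuclideanSpace ℝ ι →L[ℝ] EuclideanSpace ℝ ι).det|⁻¹ : ℝ) : ℂ)) *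
        ∫ z, pullbackKernel L w z * stft u z := by
  funext w
  rw [stft_eq, pullback_apply, mul_assoc, ← apply_packetComp]
  rfl

theorem exists_mem_orliczSet_pullback (L M : EuclideanSpace ℝ ι ≃L[ℝ] EuclideanSpace ℝ ι)
    (hLM : ∀ y ξ, inner ℝ (L y) (M ξ) = inner ℝ y ξ)
    (ω ω' : ModerateWeight (EuclideanSpace ℝ ι × EuclideanSpace ℝ ι))
    (hω : ∀ w, ω' w = ω (L.prodCongr M w)) (Φ : YoungFunction) : ∃ C : ℝ, 0 < C ∧
      ∀ u : GSDistribution ι, ∀ r ∈ orliczSet Φ ω (stft u),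
          C * r ∈ orliczSet Φ ω' (stft (GSDistribution.pullback L u)) := by
  obtain ⟨C, hC, H⟩ := exists_mem_orliczSet L M hLM ω ω' hω
  have hc : (stftConst ι : ℂ) *
      ((|(L : EuclideanSpace ℝ ι →L[ℝ] EuclideanSpace ℝ ι).det|⁻¹ : ℝ) : ℂ) ≠ 0 :=
    mul_ne_zero (by exact_mod_cast stftConst_pos.ne') (abs_det_inv_ne_zero L)
  refine ⟨_ * C, mul_pos (norm_pos_iff.2 hc) hC, fun u r hr => ?_⟩
  rw [stft_pullback, mul_assoc]
  exact mul_mem_orliczSet Φ ω' _ hc (H Φ _ (continuous_stft u).aestronglyMeasurable r hr)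

namespace OrliczModulationSpace

variable {Φ : YoungFunction} {ω ω' : ModerateWeight (EuclideanSpace ℝ ι × EuclideanSpace ℝ ι)}

theorem toDistribution_injective : Function.Injective (toDistribution Φ ω) :=
  Subtype.val_injective

/-- The pullback by `L` as a bounded operator between Orlicz modulation spaces. -/
theorem exists_pullback (L M : EuclideanSpace ℝ ι ≃L[ℝ] EuclideanSpace ℝ ι)
    (hLM : ∀ y ξ, inner ℝ (L y) (M ξ) = inner ℝ y ξ)
    (hω : ∀ w, ω' w = ω (L.prodCongr M w)) :
    ∃ T : OrliczModulationSpace Φ ω →L[ℂ] OrliczModulationSpace Φ ω', ∀ u,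
      toDistribution Φ ω' (T u) = GSDistribution.pullback L (toDistribution Φ ω u) := by
  obtain ⟨C, hC, H⟩ := exists_mem_orliczSet_pullback L M hLM ω ω' hω Φ
  have hmem : ∀ u : OrliczModulationSpace Φ ω,
      GSDistribution.pullback L (toDistribution Φ ω u) ∈ modulationSubmodule Φ ω' := fun u => by
    obtain ⟨r, hr⟩ := u.2.2
    exact ⟨(continuous_stft _).aestronglyMeasurable, _, H _ r hr⟩
  let T₀ : OrliczModulationSpace Φ ω →ₗ[ℂ] OrliczModulationSpace Φ ω' :=
    { toFun := fun u => ⟨_, hmem u⟩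
      map_add' := fun u v => Subtype.ext (by
        change GSDistribution.pullback L (toDistribution Φ ω (u + v)) =
          GSDistribution.pullback L (toDistribution Φ ω u) +
            GSDistribution.pullback L (toDistribution Φ ω v)
        ext φ
        simp only [pullback_apply, map_add, add_apply, mul_add])
      map_smul' := fun c u => Subtype.ext (by
        change GSDistribution.pullback L (toDistribution Φ ω (c • u)) =
          c • GSDistribution.pullback L (toDistribution Φ ω u)
        ext φ
        simp only [pullback_apply, map_smul, smul_apply, smul_eq_mul]
        ring) }
  refine ⟨T₀.mkContinuous C fun u => ?_, fun u => rfl⟩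
  rw [norm_def, norm_def]
  change orliczNorm Φ ω' (stft (GSDistribution.pullback L (toDistribution Φ ω u))) ≤ _
  rw [← div_le_iff₀' hC]
  refine le_csInf u.2.2 fun r hr => ?_
  rw [div_le_iff₀' hC]
  exact csInf_le (orliczSet_bddBelow _ _ _) (H _ r hr)

/-- The inverse comes from the same bound for L⁻¹ and M⁻¹ with the two weights exchanged. -/
theorem exists_pullbackEquiv (L M : EuclideanSpace ℝ ι ≃L[ℝ] EuclideanSpace ℝ ι)
    (hLM : ∀ y ξ, inner ℝ (L y) (M ξ) = inner ℝ y ξ)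
    (hω : ∀ w, ω' w = ω (L.prodCongr M w)) :
    ∃ T : OrliczModulationSpace Φ ω ≃L[ℂ] OrliczModulationSpace Φ ω', ∀ u,
      toDistribution Φ ω' (T u) = GSDistribution.pullback L (toDistribution Φ ω u) := by
  obtain ⟨T, hT⟩ := exists_pullback (Φ := Φ) L M hLM hω
  obtain ⟨S, hS⟩ := exists_pullback (Φ := Φ) (ω := ω') (ω' := ω) L.symm M.symm
    (fun y ξ => by rw [← hLM, L.apply_symm_apply, M.apply_symm_apply])
    (fun w => by
      rw [hω]
      congr 1
      ext : 1
      · exact (L.apply_symm_apply _).symm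
      · exact (M.apply_symm_apply _).symm)
  refine ⟨ContinuousLinearEquiv.equivOfInverse T S (fun u => ?_) (fun u => ?_), hT⟩
  · exact toDistribution_injective (by rw [hS, hT, pullback_symm_pullback])
  · exact toDistribution_injective (by
      rw [hT, hS]; exact pullback_symm_pullback L.symm _)

theorem ofGS_mem (hΦ : ∃ t : ℝ≥0∞, 0 < t ∧ Φ t ≠ ∞) (f : GelfandShilov ι) :
    GSDistribution.ofGS f ∈ modulationSubmodule Φ ω :=
  memOrlicz_of_decay Φ hΦ ω (continuous_stft _).aestronglyMeasurable (norm_stft_ofGS_le f)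

/-- The pullback is a multiple of the transpose of a map on Σ₁, so each of its values on a test
function is a multiple of a value of u on another test function. -/
theorem continuous_weakStar_of_pullback (L : EuclideanSpace ℝ ι ≃L[ℝ] EuclideanSpace ℝ ι)
    (T : OrliczModulationSpace Φ ω → OrliczModulationSpace Φ ω')
    (hT : ∀ u, toDistribution Φ ω' (T u) = GSDistribution.pullback L (toDistribution Φ ω u)) :
    Continuous[weakStarTopology Φ ω, weakStarTopology Φ ω'] T := by
  let := weakStarTopology Φ ω
  refine continuous_induced_rng.2 (continuous_pi fun φ => ?_)
  simp only [Function.comp_apply, hT, pullback_apply]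
  have h1 : Continuous fun (u : OrliczModulationSpace Φ ω) (φ : GelfandShilov ι) =>
      toDistribution Φ ω u φ := continuous_induced_dom
  exact ((continuous_apply (GelfandShilov.compLin L.symm φ)).comp h1).const_mul _

end OrliczModulationSpace

end Pullback

end OrliczModulation

end

noncomputable section

namespace OrliczModulation

open MeasureTheory Set Filter Topology
open scoped ENNReal NNReal

/-! ### Uniqueness with respect to the weak-* topology -/

section WeakStar

variable {ι : Type*} [Fintype ι]

/-- Taking for f the Gaussian packets shows that the short-time Fourier transform of g vanishes, and
then every pairing with g does. -/
theorem apply_eq_zero_of_forall_ofGS (u : GSDistribution ι) {g : GelfandShilov ι}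
    (hg : ∀ f : GelfandShilov ι, GSDistribution.ofGS f g = 0) : u g = 0 := by
  rw [apply_eq_integral_stft]
  simp only [stft_eq (GSDistribution.ofGS g), ofGS_comm g, hg, mul_zero, zero_mul, integral_zero]

/-- On finitely many test functions every distribution agrees with an element of `Σ₁`. -/
theorem exists_ofGS_eq_on_finset (u : GSDistribution ι) (I : Finset (GelfandShilov ι)) :
    ∃ f : GelfandShilov ι, ∀ φ ∈ I, GSDistribution.ofGS f φ = u φ := by
  classical
  let B : GelfandShilov ι →ₗ[ℂ] (I → ℂ) :=
    LinearMap.pi fun φ => (GSDistribution.ofGS φ.1).toLinearMap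
  by_cases hv : (fun φ : I => u φ.1) ∈ LinearMap.range B
  · obtain ⟨f, hf⟩ := hv
    refine ⟨f, fun φ hφ => ?_⟩
    rw [ofGS_comm]
    exact congr_fun hf ⟨φ, hφ⟩
  exfalso
  -- A linear form on ℂ^I that kills the values of Σ₁ but not those of u amounts to pairing with one
  -- test function, a combination of the members of `I`. All of Σ₁ annihilates it, hence so does u,
  -- a contradiction.
  obtain ⟨l, hl, hker⟩ := Submodule.exists_le_ker_of_notMem hv
  have hsum : ∀ v : GSDistribution ι, l (fun φ : I => v φ.1) =
      v (∑ φ : I, l (Pi.single φ 1) • φ.1) := fun v => by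
    rw [LinearMap.pi_apply_eq_sum_univ l, map_sum]
    refine Finset.sum_congr rfl fun φ _ => ?_
    rw [map_smul, smul_eq_mul, smul_eq_mul, mul_comm]
    congr 2
    ext ψ
    simp [Pi.single_apply, eq_comm]
  refine hl ?_
  rw [hsum]
  refine apply_eq_zero_of_forall_ofGS u fun f => ?_
  rw [← hsum]
  have h1 : B f ∈ LinearMap.ker l := hker ⟨f, rfl⟩
  have h2 : B f = fun φ : I => GSDistribution.ofGS f φ.1 := funext fun φ => ofGS_comm φ.1 f
  rw [h2] at h1
  exact h1

namespace OrliczModulationSpace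

variable {Φ : YoungFunction} {ω ω' : ModerateWeight (EuclideanSpace ℝ ι × EuclideanSpace ℝ ι)}

variable (Φ ω) in
/-- The elements of `M^Φ_(ω)` that are given by functions in `Σ₁`. -/
def gsSet : Set (OrliczModulationSpace Φ ω) :=
  {u | ∃ f : GelfandShilov ι, toDistribution Φ ω u = GSDistribution.ofGS f}

theorem ExtendsPullback.eqOn {L : EuclideanSpace ℝ ι ≃L[ℝ] EuclideanSpace ℝ ι}
    {S T : OrliczModulationSpace Φ ω → OrliczModulationSpace Φ ω'} (hS : ExtendsPullback L S)
    (hT : ExtendsPullback L T) : EqOn S T (gsSet Φ ω) := by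
  rintro u ⟨f, hf⟩
  exact toDistribution_injective (by rw [hS f u hf, hT f u hf])

/-- A basic weak-* neighbourhood restricts only finitely many test functions, and on these u agrees
exactly with an element of Σ₁. -/
theorem dense_gsSet_weakStar (hΦ : ∃ t : ℝ≥0∞, 0 < t ∧ Φ t ≠ ∞) :
    @Dense _ (weakStarTopology Φ ω) (gsSet Φ ω) := by
  let := weakStarTopology Φ ω
  rw [dense_iff_inter_open]
  rintro O hO ⟨u, hu⟩
  obtain ⟨O', hO', rfl⟩ := isOpen_induced_iff.1 hO
  obtain ⟨I, s, hs, hsub⟩ := isOpen_pi_iff.1 hO' _ hu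
  obtain ⟨f, hf⟩ := exists_ofGS_eq_on_finset (toDistribution Φ ω u) I
  refine ⟨⟨GSDistribution.ofGS f, ofGS_mem hΦ f⟩, hsub fun φ hφ => ?_, f, rfl⟩
  change GSDistribution.ofGS f φ ∈ s φ
  rw [hf φ hφ]
  exact (hs φ hφ).2

theorem eq_of_continuous_weakStar (hΦ : ∃ t : ℝ≥0∞, 0 < t ∧ Φ t ≠ ∞)
    {L : EuclideanSpace ℝ ι ≃L[ℝ] EuclideanSpace ℝ ι}
    {S T : OrliczModulationSpace Φ ω → OrliczModulationSpace Φ ω'} (hS : ExtendsPullback L S)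
    (hT : ExtendsPullback L T)
    (hSc : Continuous[weakStarTopology Φ ω, weakStarTopology Φ ω'] S)
    (hTc : Continuous[weakStarTopology Φ ω, weakStarTopology Φ ω'] T) : S = T := by
  let := weakStarTopology Φ ω
  let := weakStarTopology Φ ω'
  have hinj : Function.Injective fun (u : OrliczModulationSpace Φ ω') (φ : GelfandShilov ι) =>
      toDistribution Φ ω' u φ := fun u v huv =>
    toDistribution_injective (ContinuousLinearMap.ext fun φ => congr_fun huv φ)
  have : T2Space (OrliczModulationSpace Φ ω') :=
    T2Space.of_injective_continuous hinj continuous_induced_dom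
  exact hSc.ext_on (dense_gsSet_weakStar hΦ) hTc (hS.eqOn hT)

end OrliczModulationSpace

end WeakStar

/-! ### Separation and density for the norm topology -/

section Norm

variable {ι : Type*} [Fintype ι]

/-- If Vu is nonzero at a point, continuity and moderateness bound |Vu|ω below by some κ > 0 on a
ball. Then Φ(κ/r) times the volume of the ball is at most 1 for arbitrarily small r, which
contradicts Φ → ∞. -/
theorem stft_eq_zero_of_orliczNorm_eq_zero {Φ : YoungFunction}
    {ω : ModerateWeight (EuclideanSpace ℝ ι × EuclideanSpace ℝ ι)} {u : GSDistribution ι}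
    (hu : (orliczSet Φ ω (stft u)).Nonempty) (h0 : orliczNorm Φ ω (stft u) = 0) : stft u = 0 := by
  funext z₀
  by_contra hz
  obtain ⟨B, s, hB, hs, hω⟩ := ω.exists_le_exp_sub
  have hδ : 0 < ‖stft u z₀‖ / 2 := half_pos (norm_pos_iff.2 hz)
  obtain ⟨ρ, hρ, hρδ⟩ := Metric.mem_nhds_iff.1
    ((continuous_stft u).norm.continuousAt.eventually
      (lt_mem_nhds (half_lt_self (norm_pos_iff.2 hz))))
  set κ : ℝ := ‖stft u z₀‖ / 2 * (ω z₀ / (B * Real.exp (s * ρ))) with hκ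
  have hω0 := ω.pos z₀
  have hκ0 : 0 < κ := by positivity
  have hlow : ∀ z ∈ Metric.ball z₀ ρ, κ ≤ ‖stft u z‖ * ω z := fun z hz => by
    have h1 : ‖stft u z₀‖ / 2 < ‖stft u z‖ := hρδ hz
    have h2 : ω z₀ / (B * Real.exp (s * ρ)) ≤ ω z := by
      rw [div_le_iff₀ (by positivity), mul_comm]
      refine (hω z₀ z).trans ?_
      have := (ω.pos z).le
      rw [mem_ball_iff_norm] at hz
      gcongr
    exact mul_le_mul h1.le h2 (by positivity) (norm_nonneg _)
  have hm := Metric.measure_ball_pos volume z₀ hρ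
  obtain ⟨t, ht⟩ := (Φ.tendsto'.eventually
    (lt_mem_nhds (ENNReal.inv_lt_top.2 hm))).exists_forall_of_atTop
  obtain ⟨r, hr, hrt⟩ : ∃ r ∈ orliczSet Φ ω (stft u), r < κ / (t + 1) :=
    exists_lt_of_csInf_lt hu (by
      change orliczNorm Φ ω (stft u) < _
      rw [h0]; positivity)
  have hr0 := hr.1
  have hbig : (volume (Metric.ball z₀ ρ))⁻¹ < Φ (ENNReal.ofReal (κ / r)) := by
    refine ht (κ / r).toNNReal ?_
    rw [← NNReal.coe_le_coe, Real.coe_toNNReal _ (by positivity), le_div_iff₀ hr0]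
    rw [lt_div_iff₀ (by positivity)] at hrt
    nlinarith
  have hint : Φ (ENNReal.ofReal (κ / r)) * volume (Metric.ball z₀ ρ) ≤ 1 := by
    rw [← setLIntegral_const]
    refine le_trans ?_ hr.2
    refine (setLIntegral_mono' measurableSet_ball fun z hz => ?_).trans
      (setLIntegral_le_lintegral _ _)
    refine Φ.mono (ENNReal.ofReal_le_ofReal ?_)
    gcongr
    exact hlow z hz
  have hfin : volume (Metric.ball z₀ ρ) ≠ ∞ := measure_ball_lt_top.ne
  have h2 := (ENNReal.mul_lt_mul_iff_left hm.ne' hfin).2 hbig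
  rw [ENNReal.inv_mul_cancel hm.ne' hfin] at h2
  exact absurd h2 (not_lt.2 hint)

namespace OrliczModulationSpace

/-- Makes the seminorm a norm, as uniqueness of continuous extensions requires: norm zero gives Vu =
0, and the pairing formula recovers u from Vu. -/
instance (Φ : YoungFunction) (ω : ModerateWeight (EuclideanSpace ℝ ι × EuclideanSpace ℝ ι)) :
    T2Space (OrliczModulationSpace Φ ω) := by
  have : T0Space (OrliczModulationSpace Φ ω) := ⟨fun u v huv => by
    rw [Metric.inseparable_iff, dist_eq_norm, norm_def] at huv
    have h1 : stft (toDistribution Φ ω (u - v)) = 0 :=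
      stft_eq_zero_of_orliczNorm_eq_zero (u - v).2.2 huv
    refine sub_eq_zero.1 (toDistribution_injective (ContinuousLinearMap.ext fun φ => ?_))
    rw [apply_eq_integral_stft, h1, map_zero]
    simp⟩
  infer_instance

end OrliczModulationSpace

/-! ### Decay at infinity and norm density of Σ₁ -/

theorem map_two_pow_mul_le {Φ : YoungFunction} {r C : ℝ≥0}
    (h : ∀ t : ℝ≥0∞, t ≤ r → Φ (2 * t) ≤ C * Φ t) (k : ℕ) (t : ℝ≥0∞) (ht : 2 ^ k * t ≤ r) :
    Φ (2 ^ k * t) ≤ C ^ k * Φ t := by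
  induction k with
  | zero => simp
  | succ k ih =>
    have h1 : 2 ^ k * t ≤ r := by
      refine le_trans ?_ ht
      gcongr
      · norm_num
      · omega
    rw [pow_succ', mul_assoc, pow_succ', mul_assoc]
    exact (h _ h1).trans (by gcongr; exact ih h1)

theorem packetComp_refl (w : EuclideanSpace ℝ ι × EuclideanSpace ℝ ι) :
    packetComp (ContinuousLinearEquiv.refl ℝ (EuclideanSpace ℝ ι)) w = gaussianPacket w.1 w.2 :=
  Subtype.ext rfl

/-- The reproducing formula: the case L = id of the kernel representation, so all kernel bounds
apply to it. -/
theorem stft_eq_integral (u : GSDistribution ι) (w : EuclideanSpace ℝ ι × EuclideanSpace ℝ ι) :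
    stft u w = stftConst ι * ∫ z,
      pullbackKernel (ContinuousLinearEquiv.refl ℝ (EuclideanSpace ℝ ι)) w z * stft u z := by
  rw [← apply_packetComp, packetComp_refl, stft_eq]

theorem tendsto_lintegral_mul_expKernel {V : Type*} [NormedAddCommGroup V] [MeasureSpace V]
    [BorelSpace V] {g : V → ℝ≥0∞} (hg : AEMeasurable g) (hfin : ∫⁻ z, g z ≠ ∞) :
    Tendsto (fun w => ∫⁻ z, g z * expKernel (z - w)) (comap norm atTop) (𝓝 0) := by
  have h0 : ∫⁻ _ : V, (0 : ℝ≥0∞) = 0 := by simp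
  rw [← h0]
  refine tendsto_lintegral_filter_of_dominated_convergence' g
    (Eventually.of_forall fun w => hg.mul ?_)
    (Eventually.of_forall fun w => Eventually.of_forall fun z => mul_le_of_le_one_right' ?_)
    hfin ?_
  · exact (continuous_expKernel.comp (continuous_id.sub continuous_const)).measurable.aemeasurable
  · rw [expKernel, ENNReal.ofReal_le_one, Real.exp_le_one_iff]
    exact neg_nonpos.2 (norm_nonneg _)
  · filter_upwards [ae_lt_top' hg hfin] with z hz
    rw [← mul_zero (g z)]
    refine ENNReal.Tendsto.const_mul ?_ (Or.inr hz.ne)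
    have h1 : Tendsto (fun w : V => ‖z - w‖) (comap norm atTop) atTop := by
      refine tendsto_atTop_mono (fun w => ?_)
        (tendsto_atTop_add_const_right _ (-‖z‖) tendsto_comap)
      have := norm_sub_norm_le w z
      rw [norm_sub_rev] at this
      linarith
    have h2 := ENNReal.tendsto_ofReal (Real.tendsto_exp_neg_atTop_nhds_zero.comp h1)
    rw [ENNReal.ofReal_zero] at h2
    exact h2

/-- If `Φ` is positive, the weighted short-time Fourier transform of an element of `M^Φ_(ω)`
vanishes at infinity. -/
theorem eventually_stft_lt {Φ : YoungFunction} (hpos : ∀ t : ℝ≥0∞, 0 < t → 0 < Φ t)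
    (ω : ModerateWeight (EuclideanSpace ℝ ι × EuclideanSpace ℝ ι)) {u : GSDistribution ι} {r : ℝ}
    (hr : r ∈ orliczSet Φ ω (stft u)) {ε : ℝ} (hε : 0 < ε) :
    ∀ᶠ w in comap norm atTop, ‖stft u w‖ * ω w / r < ε := by
  let L := ContinuousLinearEquiv.refl ℝ (EuclideanSpace ℝ ι)
  obtain ⟨A, hA, hAU⟩ := exists_ofReal_le_lintegral L L (fun y ξ => rfl) ω ω (fun w => rfl)
  set I : ℝ := (expMass (EuclideanSpace ℝ ι × EuclideanSpace ℝ ι)).toReal with hI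
  have hI0 : 0 < I := ENNReal.toReal_pos expMass_ne_zero expMass_ne_top
  have hr0 := hr.1
  have hc := stftConst_pos (ι := ι)
  -- The constants collected here are those of the reproducing formula, of the kernel bound and of
  -- Jensen's inequality.
  set κ : ℝ := 1 / (stftConst ι * A * (2 * I)) with hκ
  have hκ0 : 0 < κ := by positivity
  have hG : AEMeasurable fun z => ENNReal.ofReal (‖stft u z‖ * ω z / r) :=
    (((continuous_stft u).norm.aemeasurable.mul ω.aemeasurable).div_const r).ennreal_ofReal
  have hΦG := Φ.measurable.comp_aemeasurable hG
  have hpt : ∀ w, Φ (ENNReal.ofReal (κ * (‖stft u w‖ * ω w / r))) ≤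
      (expMass (EuclideanSpace ℝ ι × EuclideanSpace ℝ ι))⁻¹ *
        ∫⁻ z, Φ (ENNReal.ofReal (‖stft u z‖ * ω z / r)) * expKernel (z - w) := fun w => by
    have hωw := ω.pos w
    refine map_le_lintegral_expKernel Φ hG ENNReal.ofReal_ne_top w
      (le_trans (le_of_eq ?_) (hAU (stft u) w r hr0))
    have e : ‖stft u w‖ = stftConst ι * ‖∫ z, pullbackKernel L w z * stft u z‖ := by
      rw [stft_eq_integral u w, norm_mul, Complex.norm_real, Real.norm_of_nonneg hc.le]
    rw [← ENNReal.ofReal_toReal (expMass_ne_top (V := EuclideanSpace ℝ ι × EuclideanSpace ℝ ι)),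
      ← hI, ← ENNReal.ofReal_mul hI0.le, two_mul, ← ENNReal.ofReal_add (by positivity)
      (by positivity), e, hκ]
    congr 1
    field_simp
    ring
  have hlim : Tendsto (fun w => (expMass (EuclideanSpace ℝ ι × EuclideanSpace ℝ ι))⁻¹ *
      ∫⁻ z, Φ (ENNReal.ofReal (‖stft u z‖ * ω z / r)) * expKernel (z - w))
      (comap norm atTop) (𝓝 0) := by
    have := ENNReal.Tendsto.const_mul
      (a := (expMass (EuclideanSpace ℝ ι × EuclideanSpace ℝ ι))⁻¹)
      (tendsto_lintegral_mul_expKernel hΦG (ne_top_of_le_ne_top ENNReal.one_ne_top hr.2))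
      (Or.inr (ENNReal.inv_ne_top.2 expMass_ne_zero))
    rwa [mul_zero] at this
  -- Positivity of Φ enters here: Φ(κ|Vu|ω/r) tends to 0 at infinity, and falling below Φ(κε) > 0
  -- forces |Vu|ω/r < ε.
  have hΦε : 0 < Φ (ENNReal.ofReal (κ * ε)) := hpos _ (ENNReal.ofReal_pos.2 (by positivity))
  filter_upwards [hlim.eventually (gt_mem_nhds hΦε)] with w hw
  by_contra! hge
  refine absurd ((hpt w).trans_lt hw) (not_lt.2 (Φ.mono (ENNReal.ofReal_le_ofReal ?_)))
  gcongr

/-- The tails of the short-time Fourier transform are small in `L^Φ_(ω)`. -/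
theorem exists_mem_orliczSet_indicator {Φ : YoungFunction} (hΔ : Φ.LocalDelta2)
    (hpos : ∀ t : ℝ≥0∞, 0 < t → 0 < Φ t)
    (ω : ModerateWeight (EuclideanSpace ℝ ι × EuclideanSpace ℝ ι)) {u : GSDistribution ι}
    (hu : (orliczSet Φ ω (stft u)).Nonempty) {r : ℝ} (hr : 0 < r) :
    ∃ N : ℕ, r ∈ orliczSet Φ ω ((Metric.closedBall 0 (N : ℝ))ᶜ.indicator (stft u)) := by
  obtain ⟨r₀, hr₀⟩ := hu
  have hr₀0 := hr₀.1
  obtain ⟨r₁, hr₁, C, hC⟩ := hΔ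
  -- Replacing r₀ by the smaller scale r multiplies the argument of Φ by r₀/r < 2^k, so k doublings
  -- suffice.
  obtain ⟨k, hk⟩ := pow_unbounded_of_one_lt (r₀ / r) (one_lt_two (α := ℝ))
  set g : EuclideanSpace ℝ ι × EuclideanSpace ℝ ι → ℝ≥0∞ :=
    fun z => Φ (ENNReal.ofReal (‖stft u z‖ * ω z / r₀)) with hg
  have hgm : AEMeasurable g := Φ.measurable.comp_aemeasurable
    (((continuous_stft u).norm.aemeasurable.mul ω.aemeasurable).div_const r₀).ennreal_ofReal
  have hgfin : ∫⁻ z, g z ≠ ∞ := ne_top_of_le_ne_top ENNReal.one_ne_top hr₀.2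
  set S : ℕ → Set (EuclideanSpace ℝ ι × EuclideanSpace ℝ ι) :=
    fun N => (Metric.closedBall 0 (N : ℝ))ᶜ with hS
  have hSm : ∀ N, MeasurableSet (S N) := fun N => Metric.isClosed_closedBall.measurableSet.compl
  have hSanti : Antitone S := fun N M hNM => compl_subset_compl.2
    (Metric.closedBall_subset_closedBall (by exact_mod_cast hNM))
  have htail : Tendsto (fun N => (C : ℝ≥0∞) ^ k * ∫⁻ z in S N, g z) atTop (𝓝 0) := by
    have h1 := tendsto_measure_iInter_atTop (μ := volume.withDensity g) (s := S)
      (fun N => (hSm N).nullMeasurableSet) hSanti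
      ⟨0, by
        rw [withDensity_apply _ (hSm 0)]
        exact ne_top_of_le_ne_top hgfin (setLIntegral_le_lintegral _ _)⟩
    have h2 : ⋂ N, S N = ∅ := by
      refine eq_empty_of_forall_notMem fun z hz => ?_
      obtain ⟨N, hN⟩ := exists_nat_ge ‖z‖
      exact mem_iInter.1 hz N (mem_closedBall_zero_iff.2 hN)
    rw [h2, measure_empty] at h1
    have h3 := ENNReal.Tendsto.const_mul (a := (C : ℝ≥0∞) ^ k) h1 (Or.inr (by finiteness))
    rw [mul_zero] at h3
    refine h3.congr fun N => ?_
    rw [Function.comp_apply, withDensity_apply _ (hSm N)]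
  -- Far out, the arguments are so small that all k doublings stay below r₁, where the Δ₂-condition
  -- holds. The price C^k is paid by the tail of the integral.
  have hsmall : ∀ᶠ N : ℕ in atTop, ∀ z ∈ S N, ‖stft u z‖ * ω z / r₀ < r₁ / 2 ^ k := by
    have h1 := eventually_stft_lt hpos ω hr₀ (ε := r₁ / 2 ^ k) (by positivity)
    rw [eventually_comap] at h1
    obtain ⟨a, ha⟩ := eventually_atTop.1 h1
    filter_upwards [eventually_ge_atTop ⌈a⌉₊] with N hN z hz
    refine ha ‖z‖ ?_ z rfl
    have : ¬ ‖z‖ ≤ N := fun h => hz (mem_closedBall_zero_iff.2 h)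
    have h2 : a ≤ N := (Nat.le_ceil a).trans (by exact_mod_cast hN)
    linarith
  obtain ⟨N, hN1, hN2⟩ := ((htail.eventually (gt_mem_nhds one_pos)).and hsmall).exists
  refine ⟨N, hr, le_trans ?_ hN1.le⟩
  rw [← lintegral_const_mul' _ _ (by finiteness), ← lintegral_indicator (hSm N)]
  refine lintegral_mono fun z => ?_
  by_cases hz : z ∈ S N
  · have hωz := ω.pos z
    rw [indicator_of_mem hz, indicator_of_mem hz]
    have e : (2 : ℝ≥0∞) ^ k * ENNReal.ofReal (‖stft u z‖ * ω z / r₀) =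
        ENNReal.ofReal (2 ^ k * (‖stft u z‖ * ω z / r₀)) := by
      rw [ENNReal.ofReal_mul (by positivity), ENNReal.ofReal_pow (by norm_num),
        ENNReal.ofReal_ofNat]
    refine (Φ.mono ?_).trans (map_two_pow_mul_le hC k _ ?_)
    · rw [e]
      refine ENNReal.ofReal_le_ofReal ?_
      calc ‖stft u z‖ * ω z / r = r₀ / r * (‖stft u z‖ * ω z / r₀) := by field_simp
        _ ≤ _ := by gcongr
    · rw [e, ← ENNReal.ofReal_coe_nnreal]
      refine ENNReal.ofReal_le_ofReal ?_
      have := (hN2 z hz).le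
      rwa [le_div_iff₀' (by positivity)] at this
  · rw [indicator_of_notMem hz]
    simp [Φ.map_zero']

/-- The truncated inversion formula. -/
theorem exists_truncation (u : GSDistribution ι) (N : ℕ) : ∃ f : GelfandShilov ι,
    stft (u - GSDistribution.ofGS f) = fun w => stftConst ι * ∫ z,
      pullbackKernel (ContinuousLinearEquiv.refl ℝ (EuclideanSpace ℝ ι)) w z *
        (Metric.closedBall 0 (N : ℝ))ᶜ.indicator (stft u) z := by
  have hF : Continuous fun z : EuclideanSpace ℝ ι × EuclideanSpace ℝ ι =>
      (stftConst ι * stft u z) • gaussianPacket z.1 (-z.2) :=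
    (continuous_const.mul (continuous_stft u)).smul
      (continuous_gaussianPacket.comp continuous_reflect)
  -- On a ball, continuity alone makes the integrand of the inversion formula integrable in every
  -- norm, so the truncated integral lies in Σ₁.
  obtain ⟨f, -, hf⟩ := GelfandShilov.exists_integral
    (μ := volume.restrict (Metric.closedBall 0 (N : ℝ))) hF fun h hh =>
      ((GelfandShilov.continuous_gsNorm h hh).comp hF).continuousOn.integrableOn_compact
        (isCompact_closedBall _ _)
  refine ⟨f, funext fun w => ?_⟩
  set K := pullbackKernel (ContinuousLinearEquiv.refl ℝ (EuclideanSpace ℝ ι)) w with hK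
  have hfw : GSDistribution.ofGS f (gaussianPacket w.1 w.2) =
      ∫ z in Metric.closedBall 0 (N : ℝ), K z * stft u z := by
    rw [ofGS_comm, hf]
    congr 1
    funext z
    rw [map_smul, smul_eq_mul, hK, pullbackKernel, packetComp_refl, stft_eq (GSDistribution.ofGS _)]
    ring
  have huw : u (gaussianPacket w.1 w.2) = ∫ z, K z * stft u z := by
    rw [← packetComp_refl, apply_packetComp]
  have hind : ∀ z, K z * (Metric.closedBall 0 (N : ℝ))ᶜ.indicator (stft u) z =
      (Metric.closedBall 0 (N : ℝ))ᶜ.indicator (fun z => K z * stft u z) z := fun z => by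
    by_cases hz : z ∈ (Metric.closedBall 0 (N : ℝ))ᶜ
    · rw [indicator_of_mem hz, indicator_of_mem hz]
    · rw [indicator_of_notMem hz, indicator_of_notMem hz, mul_zero]
  have hmeas : MeasurableSet (Metric.closedBall (0 : EuclideanSpace ℝ ι × EuclideanSpace ℝ ι) N) :=
    Metric.isClosed_closedBall.measurableSet
  simp only [hind]
  rw [integral_indicator hmeas.compl, stft_eq, sub_apply, hfw, huw,
    ← integral_add_compl hmeas (integrable_pullbackKernel_mul _ u w), add_sub_cancel_left]

namespace OrliczModulationSpace

variable {Φ : YoungFunction} {ω ω' : ModerateWeight (EuclideanSpace ℝ ι × EuclideanSpace ℝ ι)}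

/-- The error of the truncated inversion formula is the reproducing operator applied to the tail of
Vu. That operator is bounded on L^Φ_(ω), and the tail is small. -/
theorem dense_gsSet (hΦ : ∃ t : ℝ≥0∞, 0 < t ∧ Φ t ≠ ∞) (hΔ : Φ.LocalDelta2)
    (hpos : ∀ t : ℝ≥0∞, 0 < t → 0 < Φ t) : Dense (gsSet Φ ω) := by
  let L := ContinuousLinearEquiv.refl ℝ (EuclideanSpace ℝ ι)
  obtain ⟨C, hC, H⟩ := exists_mem_orliczSet L L (fun y ξ => rfl) ω ω (fun w => rfl)
  have hc := stftConst_pos (ι := ι)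
  intro u
  rw [Metric.mem_closure_iff]
  intro ε hε
  -- The denominator anticipates the norm of the reproducing operator; the half makes the final
  -- inequality strict.
  obtain ⟨N, hN⟩ := exists_mem_orliczSet_indicator hΔ hpos ω u.2.2
    (r := ε / 2 / (stftConst ι * C)) (by positivity)
  obtain ⟨f, hf⟩ := exists_truncation (toDistribution Φ ω u) N
  let v : OrliczModulationSpace Φ ω := ⟨GSDistribution.ofGS f, ofGS_mem hΦ f⟩
  refine ⟨v, ⟨f, rfl⟩, ?_⟩
  have hv : toDistribution Φ ω (u - v) = toDistribution Φ ω u - GSDistribution.ofGS f := rfl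
  have hmeas : AEStronglyMeasurable ((Metric.closedBall
      (0 : EuclideanSpace ℝ ι × EuclideanSpace ℝ ι) (N : ℝ))ᶜ.indicator
        (stft (toDistribution Φ ω u))) :=
    (continuous_stft _).aestronglyMeasurable.indicator
      Metric.isClosed_closedBall.measurableSet.compl
  have h1 := mul_mem_orliczSet Φ ω _ (c := (stftConst ι : ℂ)) (by exact_mod_cast hc.ne')
    (H Φ _ hmeas _ hN)
  rw [← hf, ← hv, Complex.norm_real, Real.norm_of_nonneg hc.le] at h1
  rw [dist_eq_norm, norm_def]
  refine (csInf_le (orliczSet_bddBelow _ _ _) h1).trans_lt ?_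
  rw [← mul_assoc, mul_div_cancel₀ _ (by positivity)]
  linarith

theorem eq_of_continuous (hΦ : ∃ t : ℝ≥0∞, 0 < t ∧ Φ t ≠ ∞) (hΔ : Φ.LocalDelta2)
    (hpos : ∀ t : ℝ≥0∞, 0 < t → 0 < Φ t) {L : EuclideanSpace ℝ ι ≃L[ℝ] EuclideanSpace ℝ ι}
    {S T : OrliczModulationSpace Φ ω → OrliczModulationSpace Φ ω'} (hS : ExtendsPullback L S)
    (hT : ExtendsPullback L T) (hSc : Continuous S) (hTc : Continuous T) : S = T :=
  hSc.ext_on (dense_gsSet hΦ hΔ hpos) hTc (hS.eqOn hT)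

end OrliczModulationSpace

end Norm

/-! ### The contragredient of the shear -/

section ShearDual

variable {d : ℕ}

theorem inner_pair (x y ξ η : EuclideanSpace ℝ (Fin d)) :
    inner ℝ (pair x y) (pair ξ η) = inner ℝ x ξ + inner ℝ y η := by
  simp [pair, PiLp.inner_apply]

theorem inner_act (A : Matrix (Fin d) (Fin d) ℝ) (x y : EuclideanSpace ℝ (Fin d)) :
    inner ℝ (act A x) y = inner ℝ x (act A.transpose y) := by
  rw [act, act, ← Matrix.conjTranspose_eq_transpose_of_trivial,
    Matrix.toEuclideanLin_conjTranspose_eq_adjoint, LinearMap.adjoint_inner_right]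

/-- The map `(ξ, η) ↦ (ξ + A^*(ξ + η), η - A^*(ξ + η))`, the inverse transpose of `T_A`. -/
def shearDual (A : Matrix (Fin d) (Fin d) ℝ) :
    EuclideanSpace ℝ (Fin d ⊕ Fin d) ≃L[ℝ] EuclideanSpace ℝ (Fin d ⊕ Fin d) :=
  LinearEquiv.toContinuousLinearEquiv
    { toFun := fun z => pair (fstPart z + act A.transpose (fstPart z + sndPart z))
        (sndPart z - act A.transpose (fstPart z + sndPart z))
      invFun := fun z => pair (fstPart z - act A.transpose (fstPart z + sndPart z))
        (sndPart z + act A.transpose (fstPart z + sndPart z))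
      map_add' := fun z w => by
        rw [← pair_add]
        simp only [fstPart_add, sndPart_add, act, map_add]
        congr 1 <;> abel
      map_smul' := fun c z => by
        rw [RingHom.id_apply, ← pair_smul]
        simp only [fstPart_smul, sndPart_smul, act, ← smul_add, map_smul, smul_sub]
      left_inv := fun z => by
        simp only [fstPart_pair, sndPart_pair, add_add_sub_cancel, add_sub_cancel_right,
          sub_add_cancel, pair_fstPart_sndPart]
      right_inv := fun z => by
        simp only [fstPart_pair, sndPart_pair, sub_add_add_cancel, add_sub_cancel_right,
          sub_add_cancel, pair_fstPart_sndPart] }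

theorem shearDual_pair (A : Matrix (Fin d) (Fin d) ℝ) (ξ η : EuclideanSpace ℝ (Fin d)) :
    shearDual A (pair ξ η) =
      pair (ξ + act A.transpose (ξ + η)) (η - act A.transpose (ξ + η)) := rfl

/-- The terms linear in A cancel by the definition of the transpose. The terms quadratic in A cancel
because A^*(ξ + η) enters the two components with opposite signs, whereas A(x - y) enters with the
same sign. -/
theorem inner_shear_shearDual (A : Matrix (Fin d) (Fin d) ℝ)
    (z ζ : EuclideanSpace ℝ (Fin d ⊕ Fin d)) :
    inner ℝ (shear A z) (shearDual A ζ) = inner ℝ z ζ := by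
  rw [← pair_fstPart_sndPart z, ← pair_fstPart_sndPart ζ, shear_pair, shearDual_pair, inner_pair,
    inner_pair]
  set p := fstPart z
  set q := sndPart z
  set s := fstPart ζ
  set t := sndPart ζ
  have h := inner_act A (p - q) (s + t)
  simp only [inner_sub_left, inner_add_right, inner_sub_right] at h ⊢
  linarith

end ShearDual

end OrliczModulation

end

/-! ### The proposition for the shear T_A -/

theorem mainTheorem9 (d : ℕ) (A : Matrix (Fin d) (Fin d) ℝ) (Φ : YoungFunction)
    (hΦ : ∃ t : ℝ≥0∞, 0 < t ∧ Φ t ≠ ∞)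
    (ω₀ ωA : ModerateWeight
      (EuclideanSpace ℝ (Fin d ⊕ Fin d) × EuclideanSpace ℝ (Fin d ⊕ Fin d)))
    (hω : ∀ x y ξ η : EuclideanSpace ℝ (Fin d),
      ωA (pair x y, pair ξ η) =
        ω₀ (pair (x - act A (x - y)) (y - act A (x - y)),
          pair (ξ + act A.transpose (ξ + η)) (η - act A.transpose (ξ + η)))) :
    (∀ f : GelfandShilov (Fin d ⊕ Fin d),
      GSDistribution.ofGS f ∈ modulationSubmodule Φ ω₀ ∧
        GSDistribution.ofGS f ∈ modulationSubmodule Φ ωA) ∧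
    ∃ T : OrliczModulationSpace Φ ω₀ ≃L[ℂ] OrliczModulationSpace Φ ωA,
      ExtendsPullback (shear A) T ∧
      (∀ u : OrliczModulationSpace Φ ω₀,
        toDistribution Φ ωA (T u) =
          GSDistribution.pullback (shear A) (toDistribution Φ ω₀ u)) ∧
      Continuous[weakStarTopology Φ ω₀, weakStarTopology Φ ωA] T ∧
      (∀ S : OrliczModulationSpace Φ ω₀ → OrliczModulationSpace Φ ωA,
        ExtendsPullback (shear A) S →
          Continuous[weakStarTopology Φ ω₀, weakStarTopology Φ ωA] S → S = T) ∧
      (Φ.LocalDelta2 → (∀ t : ℝ≥0∞, 0 < t → 0 < Φ t) →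
        ∀ S : OrliczModulationSpace Φ ω₀ → OrliczModulationSpace Φ ωA,
          ExtendsPullback (shear A) S → Continuous S → S = T) := by
  -- Every point of ℝ^{2d} is a pair, so the hypothesis reads ω_A = ω_0 ∘ (T_A × inverse transpose
  -- of T_A), the form required by the general theorem.
  have hω' : ∀ w, ωA w = ω₀ ((shear A).prodCongr (shearDual A) w) := fun w => by
    have := hω (fstPart w.1) (sndPart w.1) (fstPart w.2) (sndPart w.2)
    rw [pair_fstPart_sndPart, pair_fstPart_sndPart] at this
    exact this
  obtain ⟨T, hT⟩ := exists_pullbackEquiv (Φ := Φ) (shear A) (shearDual A)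
    (inner_shear_shearDual A) hω'
  have hext : ExtendsPullback (shear A) T := fun f u hu => by rw [hT, hu, pullback_ofGS]
  have hweak : Continuous[weakStarTopology Φ ω₀, weakStarTopology Φ ωA] T :=
    continuous_weakStar_of_pullback (shear A) T hT
  exact ⟨fun f => ⟨ofGS_mem hΦ f, ofGS_mem hΦ f⟩, T, hext, hT, hweak,
    fun S hS hSc => eq_of_continuous_weakStar hΦ hS hext hSc hweak,
    fun hΔ hpos S hS hSc => eq_of_continuous hΦ hΔ hpos hS hext hSc T.continuous⟩
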